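/- Let $k$ be a field of arbitrary characteristic, $V$ a finite-dimensional $k$-vector space, and $G$ a finite group acting linearly on $V$; write ${}^g v$ for the action. Let $\lambda: kG\otimes V\to kG$ be $k$-linear and let $\kappa: V\otimes V\to kG$ be $k$-linear and alternating. Let $\mathcal H_{\lambda,\kappa}$ be the associative unital $k$-algebra generated by $V$ and $kG$ subject to the relations of $kG$ and $vw-wv=\kappa(v,w)$, $\ gv-{}^g v\,g=\lambda(g,v)$ for $v,w\in V$, $g\in G$, filtered by $\deg v=1$, $\deg g=0$. Let $A=S(V)\#G$ be the skew group algebra, with the grading $\deg v=1$, $\deg g=0$. One says that $\mathcal H_{\lambda,\kappa}$ has the PBW property if $\operatorname{gr}\mathcal H_{\lambda,\kappa}\cong A$ as graded algebras. Let $X_\bullet$ be the total complex of $X_{i,j}=A\otimes (kG)^{\otimes i}\otimes\bigwedge^j V\otimes A$, $X_n=\bigoplus_{i+j=n}X_{i,j}$, whose differential $d=d^h+d^v$ is the $A$-bimodule map given by $$d^h(1\otimes g_1\otimes\cdots\otimes g_i\otimes x\otimes 1)= g_1\otimes\cdots\otimes g_i\otimes x\otimes 1+\sum_{l=1}^{i-1}(-1)^l\,1\otimes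 g_1\otimes\cdots\otimes g_lg_{l+1}\otimes\cdots\otimes g_i\otimes x\otimes 1+(-1)^i\,1\otimes g_1\otimes\cdots\otimes g_{i-1}\otimes{}^{g_i}x\otimes g_i$$ (and $d^h=0$ for $i=0$), and $$d^v(1\otimes g_1\otimes\cdots\otimes g_i\otimes v_1\wedge\cdots\wedge v_j\otimes 1)=(-1)^i\sum_{l=1}^j(-1)^{l-1}\bigl({}^{g_1\cdots g_i}v_l\otimes g_1\otimes\cdots\otimes g_i\otimes v_1\wedge\cdots\hat v_l\cdots\wedge v_j\otimes 1-1\otimes g_1\otimes\cdots\otimes g_i\otimes v_1\wedge\cdots\hat v_l\cdots\wedge v_j\otimes v_l\bigr).$$ Let $(A^{\otimes(\bullet+2)},\delta)$ be the bar resolution of $A$. Grade $X_\bullet$ by giving $\bigwedge^jV$ degree $j$ and $(kG)^{\otimes i}$ degree $0$. Regard $\lambda$ as the 2-cochain (bimodule map $X_2\to A$) with $1\otimes g\otimes v\otimes 1\mapsto\lambda(g,v)$ on $X_{1,1}$ and zero on $X_{2,0}$, $X_{0,2}$, and $\kappa$ as the 2-cochain with $1\otimes v\wedge w\otimes 1\mapsto\kappa(v,w)$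 on $X_{0,2}$ and zero on $X_{2,0}$, $X_{1,1}$. Write $d^*f=f\circ d$. Consider $A$-bimodule chain maps of degree $0$, $\phi_n:X_n\to A^{\otimes (n+2)}$ (in homological degrees $n\le 3$) and $\psi_n:A^{\otimes(n+2)}\to X_n$ (in degrees $n\le 2$), that lift the identity of $A$, satisfy $\psi_n\phi_n=\mathrm{id}$ for $n=0,1,2$, and for which $\phi$ is given on free generators (omitting the outer factors $1\otimes\cdots\otimes 1$) by $\phi_0(1\otimes 1)=1\otimes 1$ and $$\begin{aligned} &g\mapsto g,\qquad v\mapsto v,\qquad g\otimes h\mapsto g\otimes h,\qquad g\otimes v\mapsto g\otimes v-{}^gv\otimes g,\qquad v\wedge w\mapsto v\otimes w-w\otimes v,\\ &g\otimes h\otimes\ell\mapsto g\otimes h\otimes \ell,\qquad g\otimes h\otimes v\mapsto g\otimes h\otimes v-g\otimes{}^hv\otimes h+{}^{gh}v\otimes g\otimes h,\\ &g\otimes v\wedge w\mapsto g\otimes v\otimes w-g\otimes w\otimes v+{}^gv\otimes{}^gw\otimes g-{}^gw\otimes{}^gv\otimes g-{}^gv\otimes g\otimes w+{}^gw\otimes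 g\otimes v,\\ &v_1\wedge v_2\wedge v_3\mapsto\sum_{\sigma\in \mathrm{Sym}_3}\operatorname{sgn}(\sigma)\,v_{\sigma(1)}\otimes v_{\sigma(2)}\otimes v_{\sigma(3)} . \end{aligned}$$ For 2-cochains $\mu,\nu:A\otimes A\to A$ on the bar resolution put $(\mu\circ\nu)(a\otimes b\otimes c)=\mu(\nu(a\otimes b)\otimes c)-\mu(a\otimes\nu(b\otimes c))$ and $[\mu,\nu]=\mu\circ\nu+\nu\circ\mu$ (the Gerstenhaber bracket); for 2-cochains $f,f'$ on $X_\bullet$ put $[f,f']=\phi_3^*[\psi_2^*f,\psi_2^*f']$ and $\tfrac12[f,f]:=\phi_3^*(\psi_2^*f\circ\psi_2^*f)$, the latter being defined in every characteristic. Theorem. Such $(\phi,\psi)$ exist, and for every choice of them: $\mathcal H_{\lambda,\kappa}$ has the PBW property if and only if $$d^*\lambda=0,\qquad \tfrac12[\lambda,\lambda]=d^*\kappa,\qquad [\lambda,\kappa]=0$$ as cochains. In particular, when $\operatorname{char}k\ne2$, $\mathcal H_{\lambda,\kappa}$ has the PBW property if and only if $d^*\lambda=0$, $[\lambda,\lambda]=2d^*\kappa$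 and $[\lambda,\kappa]=0$. -/

import Mathlib

namespace SkewHecke

open scoped TensorProduct DirectSum

noncomputable section

/-! ### Filtered algebras and their associated graded algebras -/

section AssociatedGraded

variable {k R : Type*} [CommRing k] [Ring R] [Algebra k R]

/-- The degree `n` component `F_n / F_{<n}` of the associated graded algebra. -/
abbrev Gr (F : ℕ → Submodule k R) (n : ℕ) : Type _ :=
  F n ⧸ (⨆ m : Fin n, F m).submoduleOf (F n)

variable (F : ℕ → Submodule k R)

/-- The class in `F_n / F_{<n}` of an element of `F_n`. -/
abbrev Gr.mk (n : ℕ) : F n →ₗ[k] Gr F n := Submodule.mkQ _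

theorem gradedMonoid_mk_eq {m n : ℕ} (h : m = n) (x : F m) (y : F n) (hxy : x.1 = y.1) :
    GradedMonoid.mk (A := Gr F) m (Gr.mk F m x) = GradedMonoid.mk n (Gr.mk F n y) := by
  subst h
  rw [Subtype.ext hxy]

variable [SetLike.GradedMonoid F]

/-- Multiplication `F_m × F_n → F_{m+n}`. -/
def filMul (m n : ℕ) : F m →ₗ[k] F n →ₗ[k] F (m + n) :=
  LinearMap.mk₂ k (fun x y => ⟨x.1 * y.1, SetLike.mul_mem_graded x.2 y.2⟩)
    (fun _ _ _ => Subtype.ext (add_mul _ _ _))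
    (fun _ _ _ => Subtype.ext (smul_mul_assoc _ _ _))
    (fun _ _ _ => Subtype.ext (mul_add _ _ _))
    (fun _ _ _ => Subtype.ext (mul_smul_comm _ _ _))

theorem mul_mem_lower_left {m n : ℕ} {x y : R} (hx : x ∈ ⨆ i : Fin m, F i) (hy : y ∈ F n) :
    x * y ∈ ⨆ i : Fin (m + n), F i := by
  induction hx using Submodule.iSup_induction' with
  | mem i x hx =>
    exact Submodule.mem_iSup_of_mem (p := fun i : Fin (m + n) => F i) ⟨i + n, by omega⟩
      (SetLike.mul_mem_graded hx hy)
  | zero => simp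
  | add x z _ _ h1 h2 => rw [add_mul]; exact add_mem h1 h2

theorem mul_mem_lower_right {m n : ℕ} {x y : R} (hx : x ∈ F m) (hy : y ∈ ⨆ i : Fin n, F i) :
    x * y ∈ ⨆ i : Fin (m + n), F i := by
  induction hy using Submodule.iSup_induction' with
  | mem i y hy =>
    exact Submodule.mem_iSup_of_mem (p := fun i : Fin (m + n) => F i) ⟨m + i, by omega⟩
      (SetLike.mul_mem_graded hx hy)
  | zero => simp
  | add y z _ _ h1 h2 => rw [mul_add]; exact add_mem h1 h2

/-- The multiplication `[x] [y] = [x y]` of the associated graded algebra. -/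
def grMul (m n : ℕ) : Gr F m →ₗ[k] Gr F n →ₗ[k] Gr F (m + n) :=
  Submodule.liftQ _
    { toFun := fun x => Submodule.liftQ _ ((Gr.mk F (m + n)).comp (filMul F m n x)) (by
        intro y hy
        exact (Submodule.Quotient.mk_eq_zero _).2 (mul_mem_lower_right F x.2 hy))
      map_add' := fun x y => by
        apply Submodule.linearMap_qext
        exact LinearMap.ext fun z =>
          congrArg (Gr.mk F (m + n)) (LinearMap.map_add₂ (filMul F m n) x y z)
      map_smul' := fun c x => by
        apply Submodule.linearMap_qext
        exact LinearMap.ext fun z =>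
          congrArg (Gr.mk F (m + n)) (LinearMap.map_smul₂ (filMul F m n) c x z) }
    (by
      intro x hx
      rw [LinearMap.mem_ker]
      apply Submodule.linearMap_qext
      ext y
      exact (Submodule.Quotient.mk_eq_zero _).2 (mul_mem_lower_left F hx y.2))

theorem grMul_mk (m n : ℕ) (x : F m) (y : F n) :
    grMul F m n (Gr.mk F m x) (Gr.mk F n y)
      = Gr.mk F (m + n) ⟨x.1 * y.1, SetLike.mul_mem_graded x.2 y.2⟩ := rfl

instance : GradedMonoid.GOne (Gr F) := ⟨Gr.mk F 0 ⟨1, SetLike.one_mem_graded F⟩⟩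

instance : GradedMonoid.GMul (Gr F) := ⟨fun {m n} x y => grMul F m n x y⟩

instance : GradedMonoid.GMonoid (Gr F) where
  one_mul := by
    rintro ⟨n, x⟩
    obtain ⟨x, rfl⟩ := Submodule.mkQ_surjective _ x
    exact gradedMonoid_mk_eq F (zero_add n) _ x (one_mul _)
  mul_one := by
    rintro ⟨n, x⟩
    obtain ⟨x, rfl⟩ := Submodule.mkQ_surjective _ x
    exact gradedMonoid_mk_eq F (add_zero n) _ x (mul_one _)
  mul_assoc := by
    rintro ⟨l, x⟩ ⟨m, y⟩ ⟨n, z⟩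
    obtain ⟨x, rfl⟩ := Submodule.mkQ_surjective _ x
    obtain ⟨y, rfl⟩ := Submodule.mkQ_surjective _ y
    obtain ⟨z, rfl⟩ := Submodule.mkQ_surjective _ z
    exact gradedMonoid_mk_eq F (add_assoc l m n) _ _ (mul_assoc _ _ _)

instance : DirectSum.GSemiring (Gr F) where
  mul_zero := fun {i j} a => map_zero (grMul F i j a)
  zero_mul := fun {i j} b => by
    change grMul F i j 0 b = 0
    simp
  mul_add := fun {i j} a b c => map_add (grMul F i j a) b c
  add_mul := fun {i j} a b c => by
    change grMul F i j (a + b) c = grMul F i j a c + grMul F i j b c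
    simp
  natCast := fun n => n • GradedMonoid.GOne.one
  natCast_zero := zero_smul _ _
  natCast_succ := fun n => succ_nsmul _ n

instance : DirectSum.GAlgebra k (Gr F) where
  toFun :=
    { toFun := fun r => Gr.mk F 0 ⟨algebraMap k R r, SetLike.algebraMap_mem_graded F r⟩
      map_zero' := by
        rw [← map_zero (Gr.mk F 0)]
        exact congrArg _ (Subtype.ext (map_zero (algebraMap k R)))
      map_add' := fun r s => by
        rw [← map_add (Gr.mk F 0)]
        exact congrArg _ (Subtype.ext (map_add (algebraMap k R) r s)) }
  map_one := congrArg (Gr.mk F 0) (Subtype.ext (map_one (algebraMap k R)))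
  map_mul := fun r s =>
    gradedMonoid_mk_eq F (add_zero 0).symm _ (filMul F 0 0 _ _) (map_mul (algebraMap k R) r s)
  commutes := by
    rintro r ⟨n, x⟩
    obtain ⟨x, rfl⟩ := Submodule.mkQ_surjective _ x
    exact gradedMonoid_mk_eq F (by simp) (filMul F 0 n _ x) (filMul F n 0 x _)
      (Algebra.commutes r x.1)
  smul_def := by
    rintro r ⟨n, x⟩
    obtain ⟨x, rfl⟩ := Submodule.mkQ_surjective _ x
    exact gradedMonoid_mk_eq F (by simp) (r • x) (filMul F 0 n _ x) (Algebra.smul_def r x.1)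

end AssociatedGraded

/-! ### The skew group algebra -/

section

variable (k G V : Type*) [Field k] [Group G] [AddCommGroup V] [Module k V]
  [DistribMulAction G V] [SMulCommClass G k V]

/-- The action of `g` on `S(V)` by algebra automorphisms. -/
def symAct (g : G) : SymmetricAlgebra k V →ₐ[k] SymmetricAlgebra k V :=
  SymmetricAlgebra.lift (SymmetricAlgebra.ι k V ∘ₗ DistribSMul.toLinearMap k V g)

/-- The action of `G` on `S(V)` by automorphisms that extends the action on `V`. -/
instance symAction : MulSemiringAction G (SymmetricAlgebra k V) where
  smul g s := symAct k G V g s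
  one_smul s := by
    have h : symAct k G V 1 = AlgHom.id k _ := by
      apply SymmetricAlgebra.algHom_ext; ext v; simp [symAct]
    exact DFunLike.congr_fun h s
  mul_smul g h s := by
    have e : symAct k G V (g * h) = (symAct k G V g).comp (symAct k G V h) := by
      apply SymmetricAlgebra.algHom_ext; ext v; simp [symAct, mul_smul]
    exact DFunLike.congr_fun e s
  smul_zero g := map_zero (symAct k G V g)
  smul_add g := map_add (symAct k G V g)
  smul_one g := map_one (symAct k G V g)
  smul_mul g := map_mul (symAct k G V g)

theorem smul_ι (g : G) (v : V) :
    g • SymmetricAlgebra.ι k V v = SymmetricAlgebra.ι k V (g • v) := by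
  change symAct k G V g _ = _
  simp [symAct]

instance : SMulCommClass G k (SymmetricAlgebra k V) where
  smul_comm g c s := map_smul (symAct k G V g) c s

/-- The skew group algebra `A = S(V) # G`; the element `s g` is `SkewMonoidAlgebra.single g s`. -/
abbrev Skew : Type _ := SkewMonoidAlgebra (SymmetricAlgebra k V) G

variable {k G V}

variable (k G) in
/-- The inclusion `V ⊆ A`. -/
def vec : V →ₗ[k] Skew k G V where
  toFun v := SkewMonoidAlgebra.single 1 (SymmetricAlgebra.ι k V v)
  map_add' v w := by rw [map_add, SkewMonoidAlgebra.single_add]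
  map_smul' c v := by rw [map_smul, ← SkewMonoidAlgebra.smul_single, RingHom.id_apply]

variable (k V) in
/-- A group element `g ∈ G`, as an element of `A`. -/
def grp (g : G) : Skew k G V := SkewMonoidAlgebra.of (SymmetricAlgebra k V) G g

variable (k G V) in
/-- The inclusion `kG ⊆ A`. -/
def groupIncl : MonoidAlgebra k G →ₐ[k] Skew k G V :=
  MonoidAlgebra.lift k (Skew k G V) G (SkewMonoidAlgebra.of (SymmetricAlgebra k V) G)

variable (k V) in
/-- The degree `n` component `S^n(V)` of `S(V)`. -/
def symDeg (n : ℕ) : Submodule k (SymmetricAlgebra k V) := LinearMap.range (SymmetricAlgebra.ι k V) ^ n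

variable (k G V) in
/-- The degree `n` component `S^n(V) ⊗ kG` of `A` (vectors have degree `1`, group elements `0`). -/
def skewDeg (n : ℕ) : Submodule k (Skew k G V) where
  carrier := {a | ∀ g, a.coeff g ∈ symDeg k V n}
  zero_mem' := fun _ => zero_mem _
  add_mem' := fun ha hb g => by
    rw [SkewMonoidAlgebra.coeff_add]; exact add_mem (ha g) (hb g)
  smul_mem' := fun c a ha g => by
    rw [SkewMonoidAlgebra.coeff_smul]; exact Submodule.smul_mem _ c (ha g)

/-! ### The algebra `H_{λ,κ}` and the PBW property -/

variable (k) in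
/-- The linear span of the generators `g`, in the free algebra on the set `V ⊔ G`. -/
def freeGroupPart : MonoidAlgebra k G →ₗ[k] FreeAlgebra k (V ⊕ G) :=
  Finsupp.linearCombination k (fun g : G => FreeAlgebra.ι k (Sum.inr g : V ⊕ G)) ∘ₗ
    (MonoidAlgebra.coeffLinearEquiv k).toLinearMap

open FreeAlgebra in
/-- The relations of `H_{λ,κ}`: those of the vector space `V`, those of `kG`, and
`vw - wv = κ(v,w)` and `gv - (ᵍv)g = λ(g,v)`. -/
inductive HeckeRel (lam : MonoidAlgebra k G →ₗ[k] V →ₗ[k] MonoidAlgebra k G)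
    (kap : V [⋀^Fin 2]→ₗ[k] MonoidAlgebra k G) :
    FreeAlgebra k (V ⊕ G) → FreeAlgebra k (V ⊕ G) → Prop
  | vec_add (v w : V) : HeckeRel lam kap (ι k (.inl (v + w))) (ι k (.inl v) + ι k (.inl w))
  | vec_smul (c : k) (v : V) : HeckeRel lam kap (ι k (.inl (c • v))) (c • ι k (.inl v))
  | grp_one : HeckeRel lam kap (ι k (.inr 1)) 1
  | grp_mul (g h : G) : HeckeRel lam kap (ι k (.inr (g * h))) (ι k (.inr g) * ι k (.inr h))
  | comm (v w : V) : HeckeRel lam kap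
      (ι k (.inl v) * ι k (.inl w) - ι k (.inl w) * ι k (.inl v)) (freeGroupPart k (kap ![v, w]))
  | cross (g : G) (v : V) : HeckeRel lam kap
      (ι k (.inr g) * ι k (.inl v) - ι k (.inl (g • v)) * ι k (.inr g))
      (freeGroupPart k (lam (MonoidAlgebra.of k G g) v))

section Hecke

variable (lam : MonoidAlgebra k G →ₗ[k] V →ₗ[k] MonoidAlgebra k G)
  (kap : V [⋀^Fin 2]→ₗ[k] MonoidAlgebra k G)

/-- The algebra `H_{λ,κ}`. -/
def Hecke : Type _ := RingQuot (HeckeRel lam kap)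

instance : Ring (Hecke lam kap) := inferInstanceAs (Ring (RingQuot (HeckeRel lam kap)))

instance : Algebra k (Hecke lam kap) := inferInstanceAs (Algebra k (RingQuot (HeckeRel lam kap)))

/-- The quotient map from the free algebra. -/
def heckeMk : FreeAlgebra k (V ⊕ G) →ₐ[k] Hecke lam kap := RingQuot.mkAlgHom k (HeckeRel lam kap)

/-- The image in `H_{λ,κ}` of a generator. -/
def heckeGen (x : V ⊕ G) : Hecke lam kap :=
  heckeMk lam kap (FreeAlgebra.ι k x)

/-- The filtration of `H_{λ,κ}` by degree: `F_n` is spanned by the words in the generators with at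
most `n` letters from `V`. -/
def heckeFil (n : ℕ) : Submodule k (Hecke lam kap) :=
  Submodule.span k {x | ∃ l : List (V ⊕ G), l.countP Sum.isLeft ≤ n ∧
    x = (l.map (heckeGen lam kap)).prod}

instance : SetLike.GradedMonoid (heckeFil lam kap) where
  one_mem := Submodule.subset_span ⟨[], by simp, by simp⟩
  mul_mem := by
    intro m n x y hx hy
    have h : x * y ∈ heckeFil lam kap m * heckeFil lam kap n := Submodule.mul_mem_mul hx hy
    rw [heckeFil, heckeFil, Submodule.span_mul_span] at h
    refine Submodule.span_mono ?_ h
    rintro _ ⟨_, ⟨l, hl, rfl⟩, _, ⟨l', hl', rfl⟩, rfl⟩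
    exact ⟨l ++ l', by rw [List.countP_append]; omega, by simp⟩

/-- The PBW property: the associated graded algebra of `H_{λ,κ}` and `S(V) # G` are isomorphic as
graded algebras. -/
def HasPBW : Prop :=
  ∃ e : (⨁ n, Gr (heckeFil lam kap) n) ≃ₐ[k] Skew k G V,
    ∀ (n : ℕ) (x : Gr (heckeFil lam kap) n),
      e (DirectSum.of (Gr (heckeFil lam kap)) n x) ∈ skewDeg k G V n

end Hecke

/-! ### Free bimodules and cochains

A bimodule is represented by its `k`-module `P` with `β : A → A → End_k P`, `β a b x = a x b`. -/

section FreeBimodule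

variable {A M P : Type*} [Ring A] [Algebra k A] [AddCommMonoid M] [Module k M]
  [AddCommMonoid P] [Module k P]

variable (k A) in
/-- `a x b` on `A` itself. -/
def algAct : A →ₗ[k] A →ₗ[k] A →ₗ[k] A :=
  LinearMap.mk₂ k (fun a b => LinearMap.mulLeft k a ∘ₗ LinearMap.mulRight k b)
    (fun _ _ _ => LinearMap.ext fun _ => add_mul _ _ _)
    (fun _ _ _ => LinearMap.ext fun _ => smul_mul_assoc _ _ _)
    (fun _ _ _ => LinearMap.ext fun _ => by simp [mul_add])
    (fun _ _ _ => LinearMap.ext fun _ => by simp)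

variable (k A M) in
/-- The free bimodule `A ⊗ M ⊗ A`. -/
abbrev Free : Type _ := A ⊗[k] (M ⊗[k] A)

variable (k A M) in
/-- `a x b` on `A ⊗ M ⊗ A`, through multiplication on the outermost factors. -/
def freeAct : A →ₗ[k] A →ₗ[k] Free k A M →ₗ[k] Free k A M :=
  LinearMap.mk₂ k (fun a b => TensorProduct.map (LinearMap.mulLeft k a)
      (TensorProduct.map LinearMap.id (LinearMap.mulRight k b)))
    (fun _ _ _ => by ext; simp [add_mul, TensorProduct.add_tmul])
    (fun _ _ _ => by ext; simp [TensorProduct.smul_tmul'])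
    (fun _ _ _ => by ext; simp [mul_add, TensorProduct.tmul_add])
    (fun _ _ _ => by ext; simp)

variable (k A) in
/-- `m ↦ 1 ⊗ m ⊗ 1`. -/
def freeIncl : M →ₗ[k] Free k A M :=
  TensorProduct.mk k A (M ⊗[k] A) 1 ∘ₗ (TensorProduct.mk k M A).flip 1

/-- The bimodule map `A ⊗ M ⊗ A → P`, `a ⊗ m ⊗ b ↦ a f(m) b`, that extends `f : M → P`. -/
def biExtend (β : A →ₗ[k] A →ₗ[k] P →ₗ[k] P) (f : M →ₗ[k] P) : Free k A M →ₗ[k] P :=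
  TensorProduct.lift
    { toFun := fun a => TensorProduct.lift ((β a).flip ∘ₗ f)
      map_add' := fun _ _ => by ext; simp
      map_smul' := fun _ _ => by ext; simp }

theorem biExtend_tmul (β : A →ₗ[k] A →ₗ[k] P →ₗ[k] P) (f : M →ₗ[k] P) (a b : A) (m : M) :
    biExtend β f (a ⊗ₜ (m ⊗ₜ b)) = β a b (f m) := rfl

end FreeBimodule
/-! ### The bar resolution -/

section Bar

variable {A : Type*} [Ring A] [Algebra k A]

theorem contractNth_update {n : ℕ} [DecidableEq (Fin (n + 1))] [DecidableEq (Fin n)] (j : Fin n)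
    (a : Fin (n + 1) → A) (i : Fin (n + 1)) (x : A) :
    Fin.contractNth j.castSucc (· * ·) (Function.update a i x) =
      Function.update (Fin.contractNth j.castSucc (· * ·) a) (j.predAbove i)
        (if i = j.castSucc then x * a j.succ else if i = j.succ then a j.castSucc * x else x) := by
  funext l
  simp only [Fin.contractNth, Function.update_apply, Fin.predAbove, Fin.ext_iff, Fin.lt_def,
    Fin.val_castSucc, Fin.val_succ]
  obtain ⟨j, hj⟩ := j
  obtain ⟨i, hi⟩ := i
  obtain ⟨l, hl⟩ := l
  simp only [Fin.castSucc_mk, Fin.succ_mk]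
  split_ifs <;> simp_all <;> omega

variable (k) in
/-- `a_1 ⊗ ⋯ ⊗ a_{n+1} ↦ a_1 ⊗ ⋯ ⊗ a_j a_{j+1} ⊗ ⋯ ⊗ a_{n+1}` (with `j` counted from `0`). -/
def contract {n : ℕ} (j : Fin n) : MultilinearMap k (fun _ : Fin (n + 1) => A) (⨂[k]^n A) where
  toFun a := PiTensorProduct.tprod k (Fin.contractNth j.castSucc (· * ·) a)
  map_update_add' a i x y := by
    rw [contractNth_update, contractNth_update, contractNth_update,
      ← MultilinearMap.map_update_add]
    split_ifs <;> simp [add_mul, mul_add]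
  map_update_smul' a i c x := by
    rw [contractNth_update, contractNth_update, ← MultilinearMap.map_update_smul]
    split_ifs <;> simp

variable (k A) in
/-- The term `A^{⊗(n+2)} = A ⊗ A^{⊗n} ⊗ A` of the bar resolution of `A`. -/
abbrev Bar (n : ℕ) : Type _ := Free k A (⨂[k]^n A)

variable (k) in
/-- `1 ⊗ a_1 ⊗ ⋯ ⊗ a_n ⊗ 1`. -/
def barGen {n : ℕ} (a : Fin n → A) : Bar k A n := freeIncl k A (PiTensorProduct.tprod k a)

variable (k A) in
/-- `(a_1, …, a_{n+1}) ↦ a_1 ⊗ (a_2 ⊗ ⋯ ⊗ a_{n+1}) ⊗ 1`. -/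
def barFirst (n : ℕ) : MultilinearMap k (fun _ : Fin (n + 1) => A) (Bar k A n) :=
  LinearMap.uncurryLeft
    { toFun := fun a =>
        (freeAct k A _ a 1 ∘ₗ freeIncl k A).compMultilinearMap (PiTensorProduct.tprod k)
      map_add' := fun _ _ => by ext; simp
      map_smul' := fun _ _ => by ext; simp }

variable (k A) in
/-- `(a_1, …, a_{n+1}) ↦ 1 ⊗ (a_1 ⊗ ⋯ ⊗ a_n) ⊗ a_{n+1}`. -/
def barLast (n : ℕ) : MultilinearMap k (fun _ : Fin (n + 1) => A) (Bar k A n) :=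
  MultilinearMap.uncurryRight
    (((freeAct k A _ 1).flip ∘ₗ freeIncl k A).compMultilinearMap (PiTensorProduct.tprod k))

variable (k A) in
/-- The differential `A^{⊗(n+3)} → A^{⊗(n+2)}` of the bar resolution, i.e.
`a_0 ⊗ ⋯ ⊗ a_{n+2} ↦ ∑_i (-1)^i a_0 ⊗ ⋯ ⊗ a_i a_{i+1} ⊗ ⋯ ⊗ a_{n+2}`. -/
def barD (n : ℕ) : Bar k A (n + 1) →ₗ[k] Bar k A n :=
  biExtend (freeAct k A _) (PiTensorProduct.lift
    (barFirst k A n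
      + ∑ j : Fin n, (-1 : k) ^ (j.val + 1) • (freeIncl k A).compMultilinearMap (contract k j)
      + (-1 : k) ^ (n + 1) • barLast k A n))

variable (k A) in
/-- The bilinear map `(a, b) ↦ a ⊗ b`, with values in `⨂[k]^2 A`. -/
def pair : A →ₗ[k] A →ₗ[k] ⨂[k]^2 A :=
  LinearMap.mk₂ k (fun a b => PiTensorProduct.tprod k ![a, b])
    (fun a a' b => by
      have e (x : A) : ![x, b] = Function.update ![0, b] 0 x := by ext i; fin_cases i <;> rfl
      rw [e a, e a', e (a + a'), MultilinearMap.map_update_add])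
    (fun c a b => by
      have e (x : A) : ![x, b] = Function.update ![0, b] 0 x := by ext i; fin_cases i <;> rfl
      rw [e a, e (c • a), MultilinearMap.map_update_smul])
    (fun a b b' => by
      have e (x : A) : ![a, x] = Function.update ![a, 0] 1 x := by ext i; fin_cases i <;> rfl
      rw [e b, e b', e (b + b'), MultilinearMap.map_update_add])
    (fun c a b => by
      have e (x : A) : ![a, x] = Function.update ![a, 0] 1 x := by ext i; fin_cases i <;> rfl
      rw [e b, e (c • b), MultilinearMap.map_update_smul])

/-- For 2-cochains `μ`, `ν` on the bar resolution, viewed as maps `A ⊗ A → A`, the Gerstenhaber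
circle product `(μ ∘ ν)(a ⊗ b ⊗ c) = μ(ν(a ⊗ b) ⊗ c) - μ(a ⊗ ν(b ⊗ c))`. -/
def circ (μ ν : (⨂[k]^2 A) →ₗ[k] A) : (⨂[k]^3 A) →ₗ[k] A :=
  PiTensorProduct.lift
    (MultilinearMap.mk' (fun a => μ (pair k A (ν (pair k A (a 0) (a 1))) (a 2))
        - μ (pair k A (a 0) (ν (pair k A (a 1) (a 2)))))
      (by
        intro a i x y
        fin_cases i <;> simp <;> abel)
      (by
        intro a i c x
        fin_cases i <;> simp [smul_sub]))

/-- The Gerstenhaber bracket `[μ, ν] = μ ∘ ν + ν ∘ μ` of 2-cochains on the bar resolution. -/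
def gerstenhaber (μ ν : (⨂[k]^2 A) →ₗ[k] A) : (⨂[k]^3 A) →ₗ[k] A := circ μ ν + circ ν μ

end Bar

/-! ### The resolution `X` -/

section Resolution

variable (k G V) in
/-- `(kG)^{⊗i} ⊗ ⋀^j V`, where `(kG)^{⊗i}` has the basis `G^i`. -/
abbrev XGen (i j : ℕ) : Type _ := (Fin i → G) →₀ ⋀[k]^j V

variable (k G V) in
/-- The direct sum of the `(kG)^{⊗i} ⊗ ⋀^j V` with `i + j = n`. -/
abbrev XGenTot (n : ℕ) : Type _ := ⨁ p : {p : ℕ × ℕ // p.1 + p.2 = n}, XGen k G V p.1.1 p.1.2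

variable (k G V) in
/-- The term `X_n`, the direct sum of the `X_{i,j} = A ⊗ (kG)^{⊗i} ⊗ ⋀^j V ⊗ A` with
`i + j = n`. -/
abbrev X (n : ℕ) : Type _ := Free k (Skew k G V) (XGenTot k G V n)

/-- `1 ⊗ g_1 ⊗ ⋯ ⊗ g_i ⊗ x ⊗ 1` in `X_{i,j}`, as a linear function of `x ∈ ⋀^j V`. -/
def xIncl {n i j : ℕ} (h : i + j = n) (g : Fin i → G) : ⋀[k]^j V →ₗ[k] X k G V n :=
  freeIncl k _ ∘ₗ
    DirectSum.lof k _ (fun p : {p : ℕ × ℕ // p.1 + p.2 = n} => XGen k G V p.1.1 p.1.2)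
      ⟨(i, j), h⟩ ∘ₗ Finsupp.lsingle g

variable (k) in
/-- `1 ⊗ g_1 ⊗ ⋯ ⊗ g_i ⊗ v_1 ∧ ⋯ ∧ v_j ⊗ 1` in `X_{i,j}`. -/
def xGen {n i j : ℕ} (h : i + j = n) (g : Fin i → G) (v : Fin j → V) : X k G V n :=
  xIncl h g (exteriorPower.ιMulti k j v)

variable (k G V) in
/-- `a x b` on `X_n`. -/
abbrev xAct (n : ℕ) : Skew k G V →ₗ[k] Skew k G V →ₗ[k] X k G V n →ₗ[k] X k G V n :=
  freeAct k (Skew k G V) (XGenTot k G V n)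

/-- The horizontal differential on `1 ⊗ (kG)^{⊗i} ⊗ ⋀^j V ⊗ 1`. -/
def dHor (n : ℕ) : (i j : ℕ) → i + j = n + 1 → (XGen k G V i j →ₗ[k] X k G V n)
  | 0, _, _ => 0
  | i + 1, j, h =>
    have h' : i + j = n := by omega
    Finsupp.lsum k fun g : Fin (i + 1) → G =>
      xAct k G V n (grp k V (g 0)) 1 ∘ₗ xIncl h' (Fin.tail g)
      + ∑ l : Fin i, (-1 : k) ^ (l.val + 1) • xIncl h' (Fin.contractNth l.castSucc (· * ·) g)
      + (-1 : k) ^ (i + 1) • (xAct k G V n 1 (grp k V (g (Fin.last i))) ∘ₗ xIncl h' (Fin.init g) ∘ₗ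
          exteriorPower.map j (DistribSMul.toLinearMap k V (g (Fin.last i))))

/-- `(v, x) ↦ (ᵍv) ⊗ g_1 ⊗ ⋯ ⊗ g_i ⊗ x ⊗ 1 - 1 ⊗ g_1 ⊗ ⋯ ⊗ g_i ⊗ x ⊗ v` with `g = g_1 ⋯ g_i`. -/
def dVerAux {n i j : ℕ} (h : i + j = n) (g : Fin i → G) :
    V →ₗ[k] V [⋀^Fin j]→ₗ[k] X k G V n :=
  exteriorPower.alternatingMapLinearEquiv.symm.toLinearMap ∘ₗ
    (((xAct k G V n).flip 1 ∘ₗ vec k G ∘ₗ DistribSMul.toLinearMap k V (List.ofFn g).prod).compl₂ (xIncl h g)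
      - (xAct k G V n 1 ∘ₗ vec k G).compl₂ (xIncl h g))

/-- The vertical differential on `1 ⊗ (kG)^{⊗i} ⊗ ⋀^j V ⊗ 1`: it maps
`1 ⊗ g_1 ⊗ ⋯ ⊗ g_i ⊗ v_1 ∧ ⋯ ∧ v_j ⊗ 1` to the sum over `l = 1, …, j` of `(-1)^i (-1)^{l-1}` times
`ᵍv_l ⊗ g_1 ⊗ ⋯ ⊗ g_i ⊗ v_1 ∧ ⋯ v̂_l ⋯ ∧ v_j ⊗ 1 - 1 ⊗ g_1 ⊗ ⋯ ⊗ g_i ⊗ v_1 ∧ ⋯ v̂_l ⋯ ∧ v_j ⊗ v_l`,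
where `g = g_1 ⋯ g_i`. -/
def dVer (n : ℕ) : (i j : ℕ) → i + j = n + 1 → (XGen k G V i j →ₗ[k] X k G V n)
  | _, 0, _ => 0
  | i, j + 1, h =>
    have h' : i + j = n := by omega
    (-1 : k) ^ i • Finsupp.lsum k fun g : Fin i → G =>
      exteriorPower.alternatingMapLinearEquiv
        (AlternatingMap.alternatizeUncurryFin (dVerAux h' g))

variable (k G V) in
/-- The differential `X_{n+1} → X_n`. -/
def xD (n : ℕ) : X k G V (n + 1) →ₗ[k] X k G V n :=
  biExtend (xAct k G V n) (DirectSum.toModule k _ _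
    fun p => dHor n p.1.1 p.1.2 p.2 + dVer n p.1.1 p.1.2 p.2)

end Resolution
/-! ### Gradings, chain maps and brackets -/

section ChainMaps

variable (k G V) in
/-- The degree `d` part of `X_n`: elements of `⋀^j V` have degree `j`, those of `(kG)^{⊗i}` have
degree `0`, and `A` is graded as above. -/
def xDeg (n d : ℕ) : Submodule k (X k G V n) :=
  Submodule.span k {y | ∃ (i j : ℕ) (h : i + j = n) (g : Fin i → G) (v : Fin j → V) (p q : ℕ),
    ∃ a ∈ skewDeg k G V p, ∃ b ∈ skewDeg k G V q,
      p + j + q = d ∧ y = xAct k G V n a b (xGen k h g v)}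

variable (k G V) in
/-- The degree `d` part of `A^{⊗(n+2)}`. -/
def barDeg (n d : ℕ) : Submodule k (Bar k (Skew k G V) n) :=
  Submodule.span k {y | ∃ (x : Fin n → Skew k G V) (c : Fin n → ℕ) (p q : ℕ),
    (∀ i, x i ∈ skewDeg k G V (c i)) ∧
    ∃ a ∈ skewDeg k G V p, ∃ b ∈ skewDeg k G V q,
      p + (∑ i, c i) + q = d ∧ y = freeAct k (Skew k G V) _ a b (barGen k x)}

variable (k G V) in
/-- Chain maps of degree `0` between `X` and the bar resolution of `A`, in the homological degrees
that are involved in brackets of 2-cochains: `φ` up to degree `3` and `ψ` up to degree `2`. They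
lift the identity of `A`, satisfy `ψ_n φ_n = 1` for `n ≤ 2`, and `φ` is given in these degrees by
the usual formulas on free generators. -/
structure ChainMaps where
  /-- `φ : X → A^{⊗(• + 2)}` -/
  phi (n : ℕ) : X k G V n →ₗ[k] Bar k (Skew k G V) n
  /-- `ψ : A^{⊗(• + 2)} → X` -/
  psi (n : ℕ) : Bar k (Skew k G V) n →ₗ[k] X k G V n
  phi_act (n : ℕ) (a b : Skew k G V) (x : X k G V n) :
    phi n (xAct k G V n a b x) = freeAct k _ _ a b (phi n x)
  psi_act (n : ℕ) (a b : Skew k G V) (x : Bar k (Skew k G V) n) :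
    psi n (freeAct k _ _ a b x) = xAct k G V n a b (psi n x)
  phi_deg (n d : ℕ) (x : X k G V n) : x ∈ xDeg k G V n d → phi n x ∈ barDeg k G V n d
  psi_deg (n d : ℕ) (x : Bar k (Skew k G V) n) : x ∈ barDeg k G V n d → psi n x ∈ xDeg k G V n d
  phi_comm (n : ℕ) : n < 3 → barD k (Skew k G V) n ∘ₗ phi (n + 1) = phi n ∘ₗ xD k G V n
  psi_comm (n : ℕ) : n < 2 → xD k G V n ∘ₗ psi (n + 1) = psi n ∘ₗ barD k (Skew k G V) n
  psi_phi (n : ℕ) : n ≤ 2 → psi n ∘ₗ phi n = LinearMap.id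
  phi_00 : phi 0 (xGen (i := 0) (j := 0) k rfl ![] ![]) = barGen k ![]
  phi_10 (g : G) : phi 1 (xGen (i := 1) (j := 0) k rfl ![g] ![]) = barGen k ![grp k V g]
  phi_01 (v : V) : phi 1 (xGen (i := 0) (j := 1) k rfl ![] ![v]) = barGen k ![vec k G v]
  phi_20 (g h : G) : phi 2 (xGen (i := 2) (j := 0) k rfl ![g, h] ![]) =
    barGen k ![grp k V g, grp k V h]
  phi_11 (g : G) (v : V) : phi 2 (xGen (i := 1) (j := 1) k rfl ![g] ![v]) =
    barGen k ![grp k V g, vec k G v] - barGen k ![vec k G (g • v), grp k V g]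
  phi_02 (v w : V) : phi 2 (xGen (i := 0) (j := 2) k rfl ![] ![v, w]) =
    barGen k ![vec k G v, vec k G w] - barGen k ![vec k G w, vec k G v]
  phi_30 (g h l : G) : phi 3 (xGen (i := 3) (j := 0) k rfl ![g, h, l] ![]) =
    barGen k ![grp k V g, grp k V h, grp k V l]
  phi_21 (g h : G) (v : V) : phi 3 (xGen (i := 2) (j := 1) k rfl ![g, h] ![v]) =
    barGen k ![grp k V g, grp k V h, vec k G v] - barGen k ![grp k V g, vec k G (h • v), grp k V h]
      + barGen k ![vec k G ((g * h) • v), grp k V g, grp k V h]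
  phi_12 (g : G) (v w : V) : phi 3 (xGen (i := 1) (j := 2) k rfl ![g] ![v, w]) =
    barGen k ![grp k V g, vec k G v, vec k G w] - barGen k ![grp k V g, vec k G w, vec k G v]
      + barGen k ![vec k G (g • v), vec k G (g • w), grp k V g]
      - barGen k ![vec k G (g • w), vec k G (g • v), grp k V g]
      - barGen k ![vec k G (g • v), grp k V g, vec k G w]
      + barGen k ![vec k G (g • w), grp k V g, vec k G v]
  phi_03 (v : Fin 3 → V) : phi 3 (xGen (i := 0) (j := 3) k rfl ![] v) =
    ∑ s : Equiv.Perm (Fin 3), (Equiv.Perm.sign s : ℤ) • barGen k (fun i => vec k G (v (s i)))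

/-- The coboundary `d^*` of a 2-cochain on `X`. A cochain is a bimodule map `X_n → A`. -/
def dStar (f : X k G V 2 →ₗ[k] Skew k G V) : X k G V 3 →ₗ[k] Skew k G V := f ∘ₗ xD k G V 2

/-- The parameter `λ` as a cochain on `X_2`: the bimodule map with
`1 ⊗ g ⊗ v ⊗ 1 ↦ λ(g, v)` on `X_{1,1}` that vanishes on `X_{2,0}` and `X_{0,2}`. -/
def lamCochain (lam : MonoidAlgebra k G →ₗ[k] V →ₗ[k] MonoidAlgebra k G) :
    X k G V 2 →ₗ[k] Skew k G V :=
  biExtend (algAct k (Skew k G V))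
    ((Finsupp.lsum k fun g : Fin 1 → G => (groupIncl k G V).toLinearMap ∘ₗ
        lam (MonoidAlgebra.of k G (g 0)) ∘ₗ (exteriorPower.oneEquiv k V).toLinearMap) ∘ₗ
      DirectSum.component k _ (fun p : {p : ℕ × ℕ // p.1 + p.2 = 2} => XGen k G V p.1.1 p.1.2)
        ⟨(1, 1), rfl⟩)

/-- The parameter `κ` as a cochain on `X_2`: the bimodule map with
`1 ⊗ v ∧ w ⊗ 1 ↦ κ(v, w)` on `X_{0,2}` that vanishes on `X_{2,0}` and `X_{1,1}`. -/
def kapCochain (kap : V [⋀^Fin 2]→ₗ[k] MonoidAlgebra k G) : X k G V 2 →ₗ[k] Skew k G V :=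
  biExtend (algAct k (Skew k G V))
    ((Finsupp.lsum k fun _ : Fin 0 → G => (groupIncl k G V).toLinearMap ∘ₗ
        exteriorPower.alternatingMapLinearEquiv kap) ∘ₗ
      DirectSum.component k _ (fun p : {p : ℕ × ℕ // p.1 + p.2 = 2} => XGen k G V p.1.1 p.1.2)
        ⟨(0, 2), rfl⟩)

namespace ChainMaps

variable (C : ChainMaps k G V)

/-- The cochain `ψ_2^* f` on the bar resolution, as a map `A ⊗ A → A`. -/
def toBar (f : X k G V 2 →ₗ[k] Skew k G V) : (⨂[k]^2 (Skew k G V)) →ₗ[k] Skew k G V :=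
  f ∘ₗ C.psi 2 ∘ₗ freeIncl k (Skew k G V)

/-- The cochain `φ_3^* F` on `X`, for a 3-cochain `F` on the bar resolution, given as a map
`A ⊗ A ⊗ A → A`. -/
def ofBar (F : (⨂[k]^3 (Skew k G V)) →ₗ[k] Skew k G V) : X k G V 3 →ₗ[k] Skew k G V :=
  biExtend (algAct k (Skew k G V)) F ∘ₗ C.phi 3

/-- The bracket `[f, g] = φ^* [ψ^* f, ψ^* g]` of 2-cochains on `X`. -/
def bracket (f g : X k G V 2 →ₗ[k] Skew k G V) : X k G V 3 →ₗ[k] Skew k G V :=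
  C.ofBar (gerstenhaber (C.toBar f) (C.toBar g))

/-- The square `½ [f, f] = φ^* (ψ^* f ∘ ψ^* f)` of a 2-cochain on `X`, defined in every
characteristic. -/
def halfSquare (f : X k G V 2 →ₗ[k] Skew k G V) : X k G V 3 →ₗ[k] Skew k G V :=
  C.ofBar (circ (C.toBar f) (C.toBar f))

end ChainMaps

end ChainMaps

end

end

end SkewHecke

namespace SkewHecke

open scoped TensorProduct DirectSum

set_option linter.unusedSectionVars false

noncomputable section

variable {k G V : Type*} [Field k] [Group G] [AddCommGroup V] [Module k V]
  [DistribMulAction G V] [SMulCommClass G k V]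

/-! Both the PBW property and the cochain conditions are shown to be equivalent to five identities
between λ and κ, collected in `Compatible`. They are what remains of associativity on the overlaps
of the defining relations. Comparing (gh)v with g(hv) gives the rule for λ(gh, v). Moving g through
vw - wv = κ(v,w) gives an identity in V ⊗ kG and one in kG. The Jacobi identity for u, v, w again
gives one of each kind. The maps `twist` and `flat` record the products rv and vr of r ∈ kG and v ∈
V as elements of V ⊗ kG.

PBW implies the identities (`HasPBW.compatible`). In H each of them holds after mapping V ⊗ kG ⊕ kG
to H, so it suffices that this map is injective. The isomorphism gr H ≅ A is arbitrary and need not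
send generators to generators, so only dimensions can be compared: F_0 and F_1/F_0 are quotients of
kG and V ⊗ kG, of the dimensions of A_0 and A_1, which are finite, so the quotient maps are
bijective. This is the only use of finiteness.

The identities imply PBW (`Compatible.hasPBW`). There is always a graded surjection A → gr H, and A
is spanned by sorted words in a basis of V, followed by a group element. Injectivity requires that
these words be independent in H modulo lower filtration. On the span of all words, sorted or not, V
acts by left multiplication and g acts by being moved to the right with the cross relation. The
identities make this an action of kG that preserves the span of the relations vw - wv - κ(v,w), so
that H acts on the quotient. It remains to find a linear map on words that kills the relations,
fixes sorted words and does not increase length (`Compatible.exists_reduction`). This is a diamond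
lemma. By induction on the length, a word is sorted by exchanging descents, and each exchange
contributes the known normal form of a shorter correction term. Two overlapping descents agree by
the Jacobi identity, and two disjoint ones because shorter relations are already killed.

The cochain conditions (`ChainMaps.compatible_iff`). On the generators of X_3 the coboundaries of λ
and κ are explicit. The brackets involve ψ_2, about which little is known. However, ψ_2 φ_2 = id
fixes the pullback ψ_2^* f on the image of φ_2, and the formula for φ_3 is such that the inner
values in a circle product are always of this kind. The outer values are then known up to the terms
(ψ_2^* f)(v ⊗ h), gathered in `bilVecGrp`. These are evaluated at exactly those elements of V ⊗ kG
that the degree one identities make zero. Hence the choice of ψ does not matter.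

Existence of the chain maps (`nonempty_chainMaps`). The map φ is checked on generators. For ψ the
exactness of X is not needed. The relations of A become boundaries of generators of X_2, so there is
a derivation from A to X_1/dX_2 that sends v and g to their classes. A homogeneous linear lift of it
is ψ_1, and the Leibniz rule says that ψ_1 maps boundaries of the bar resolution into dX_2, so that
ψ_2 can be chosen. Graded linear retractions of φ on generators then serve to correct ψ so that ψφ =
id. -/

instance skewIsScalarTower : @IsScalarTower k (Skew k G V) (Skew k G V)
    SkewMonoidAlgebra.instModule.toSMul _ SkewMonoidAlgebra.instModule.toSMul :=
  @IsScalarTower.right k (Skew k G V) _ _ _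

instance skewSMulCommClass : @SMulCommClass k (Skew k G V) (Skew k G V)
    SkewMonoidAlgebra.instModule.toSMul _ :=
  @Algebra.to_smulCommClass k (Skew k G V) _ _ _

/-! ### The skew group algebra: generators, universal property and grading -/

section SymmetricLift

variable {B : Type*} [Semiring B] [Algebra k B]

open scoped IsMulCommutative in
/-- A linear map with commuting values extends to an algebra map on the symmetric algebra, for a
target that need not be commutative. -/
theorem exists_symmetric_lift (f : V →ₗ[k] B) (hf : ∀ v w, f v * f w = f w * f v) :
    ∃ F : SymmetricAlgebra k V →ₐ[k] B, ∀ v, F (SymmetricAlgebra.ι k V v) = f v := by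
  -- The subalgebra generated by the commuting values is commutative, so the universal property of
  -- S(V) applies with that target.
  have := Algebra.isMulCommutative_adjoin k (s := Set.range f) (by
    rintro _ ⟨v, rfl⟩ _ ⟨w, rfl⟩
    exact hf v w)
  let f' : V →ₗ[k] Algebra.adjoin k (Set.range f) :=
    { toFun := fun v => ⟨f v, Algebra.subset_adjoin ⟨v, rfl⟩⟩
      map_add' := fun v w => Subtype.ext (map_add f v w)
      map_smul' := fun c v => Subtype.ext (map_smul f c v) }
  refine ⟨(Algebra.adjoin k (Set.range f)).val.comp (SymmetricAlgebra.lift f'), fun v => ?_⟩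
  rw [AlgHom.comp_apply, SymmetricAlgebra.lift_ι_apply]
  rfl

/-- The universal property of `S(V) # G`. -/
theorem exists_skew_lift (f : V →ₗ[k] B) (ρ : G →* B) (hf : ∀ v w, f v * f w = f w * f v)
    (hρ : ∀ g v, ρ g * f v = f (g • v) * ρ g) :
    ∃ F : Skew k G V →ₐ[k] B, (∀ v, F (vec k G v) = f v) ∧ ∀ g, F (grp k V g) = ρ g := by
  obtain ⟨S, hS⟩ := exists_symmetric_lift f hf
  -- Both sides are compatible with products in x, so the cross relation spreads from V to S(V).
  have hcomm : ∀ {x : SymmetricAlgebra k V} {g : G}, S (g • x) * ρ g = ρ g * S x := by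
    intro x g
    induction x using SymmetricAlgebra.induction with
    | algebraMap r =>
      rw [smul_algebraMap, AlgHom.commutes, Algebra.commutes]
    | ι v => rw [smul_ι, hS, hS, hρ]
    | mul a b ha hb => rw [smul_mul', map_mul, map_mul, mul_assoc, hb, ← mul_assoc, ha, mul_assoc]
    | add a b ha hb => rw [smul_add, map_add, map_add, add_mul, mul_add, ha, hb]
  have key : ∀ g s, SkewMonoidAlgebra.liftNCAlgHom S ρ hcomm (SkewMonoidAlgebra.single g s)
      = S s * ρ g := fun g s => by
    change SkewMonoidAlgebra.liftNC _ _ _ = _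
    rw [SkewMonoidAlgebra.liftNC_single]
    rfl
  refine ⟨SkewMonoidAlgebra.liftNCAlgHom S ρ hcomm, fun v => ?_, fun g => ?_⟩
  · rw [vec, LinearMap.coe_mk, AddHom.coe_mk, key, map_one, mul_one, hS]
  · rw [grp, SkewMonoidAlgebra.of_apply, key, map_one, one_mul]

end SymmetricLift

theorem vec_apply (v : V) :
    vec k G v = SkewMonoidAlgebra.single 1 (SymmetricAlgebra.ι k V v) := rfl

theorem grp_apply (g : G) : grp k V g = SkewMonoidAlgebra.single g 1 := by
  rw [grp, SkewMonoidAlgebra.of_apply]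

theorem grp_one : grp k V (1 : G) = 1 := map_one _

theorem grp_mul_grp (g h : G) : grp k V g * grp k V h = grp k V (g * h) := (map_mul _ _ _).symm

theorem grp_mul_vec (g : G) (v : V) :
    grp k V g * vec k G v = vec k G (g • v) * grp k V g := by
  simp [vec_apply, grp_apply, SkewMonoidAlgebra.single_mul_single, smul_ι]

theorem vec_mul_comm (v w : V) : vec k G v * vec k G w = vec k G w * vec k G v := by
  simp [vec_apply, SkewMonoidAlgebra.single_mul_single, mul_comm]

theorem groupIncl_of (g : G) : groupIncl k G V (MonoidAlgebra.of k G g) = grp k V g := by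
  simp [groupIncl, grp]

theorem groupIncl_single (g : G) (c : k) :
    groupIncl k G V (MonoidAlgebra.single g c) = c • grp k V g := by
  simp [groupIncl, grp]

/-- The monomial `v_1 ⋯ v_n g` in `A`. -/
def mono (l : List V) (g : G) : Skew k G V := (l.map (vec k G)).prod * grp k V g

theorem mono_nil (g : G) : mono (k := k) ([] : List V) g = grp k V g := by simp [mono]

theorem mono_cons (v : V) (l : List V) (g : G) :
    mono (k := k) (v :: l) g = vec k G v * mono l g := by simp [mono, mul_assoc]

theorem grp_mul_mono (g : G) (l : List V) (h : G) :
    grp k V g * mono l h = mono (l.map (g • ·)) (g * h) := by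
  induction l with
  | nil => simp [mono_nil, grp_mul_grp]
  | cons v l ih =>
    rw [mono_cons, ← mul_assoc, grp_mul_vec, mul_assoc, ih, List.map_cons, mono_cons]

theorem mono_mul_mono (l : List V) (g : G) (m : List V) (h : G) :
    mono (k := k) l g * mono m h = mono (l ++ m.map (g • ·)) (g * h) := by
  induction l with
  | nil => rw [mono_nil, grp_mul_mono, List.nil_append]
  | cons v l ih => rw [mono_cons, mul_assoc, ih, List.cons_append, mono_cons]

theorem mono_eq_single (l : List V) (g : G) :
    mono (k := k) l g = SkewMonoidAlgebra.single g (l.map (SymmetricAlgebra.ι k V)).prod := by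
  induction l with
  | nil => simp [mono_nil, grp_apply]
  | cons v l ih => simp [mono_cons, ih, vec_apply, SkewMonoidAlgebra.single_mul_single]

theorem symDeg_eq_span (n : ℕ) : symDeg k V n =
    Submodule.span k {s | ∃ l : List V, l.length = n ∧ s = (l.map (SymmetricAlgebra.ι k V)).prod} := by
  induction n with
  | zero =>
    rw [symDeg, pow_zero, Submodule.one_eq_span]
    congr 1
    ext s
    simp [List.length_eq_zero_iff]
  | succ n ih =>
    have h1 : LinearMap.range (SymmetricAlgebra.ι k V)
        = Submodule.span k (Set.range (SymmetricAlgebra.ι k V)) := by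
      rw [← LinearMap.coe_range, Submodule.span_eq]
    have : symDeg k V (n + 1) = LinearMap.range (SymmetricAlgebra.ι k V) * symDeg k V n :=
      pow_succ' _ _
    rw [this, ih, h1, Submodule.span_mul_span]
    congr 1
    ext s
    constructor
    · rintro ⟨_, ⟨v, rfl⟩, _, ⟨l, hl, rfl⟩, rfl⟩
      exact ⟨v :: l, by simp [hl], by simp⟩
    · rintro ⟨_ | ⟨v, l⟩, hl, rfl⟩
      · simp at hl
      · exact ⟨_, ⟨v, rfl⟩, _, ⟨l, by simpa using hl, rfl⟩, by simp⟩

theorem single_mem_skewDeg {n : ℕ} {s : SymmetricAlgebra k V} (hs : s ∈ symDeg k V n) (g : G) :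
    (SkewMonoidAlgebra.single g s : Skew k G V) ∈ skewDeg k G V n := by
  classical
  intro h
  rw [SkewMonoidAlgebra.coeff_single_apply]
  split_ifs
  · exact hs
  · exact zero_mem _

theorem mono_mem_skewDeg (l : List V) (g : G) : mono l g ∈ skewDeg k G V l.length := by
  rw [mono_eq_single]
  refine single_mem_skewDeg ?_ g
  rw [symDeg_eq_span]
  exact Submodule.subset_span ⟨l, rfl, rfl⟩

theorem skewDeg_eq_span (n : ℕ) : skewDeg k G V n =
    Submodule.span k {a | ∃ (l : List V) (g : G), l.length = n ∧ a = mono l g} := by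
  apply le_antisymm
  · intro a ha
    rw [← SkewMonoidAlgebra.sum_single a, SkewMonoidAlgebra.sum_def]
    refine Submodule.sum_mem _ fun g _ => ?_
    have h := ha g
    rw [symDeg_eq_span] at h
    refine Submodule.span_induction (p := fun s _ => SkewMonoidAlgebra.single g s ∈
      Submodule.span k {a | ∃ (l : List V) (g : G), l.length = n ∧ a = mono l g}) ?_ ?_ ?_ ?_ h
    · rintro _ ⟨l, hl, rfl⟩
      exact Submodule.subset_span ⟨l, g, hl, (mono_eq_single l g).symm⟩
    · simp
    · intro x y _ _ hx hy
      rw [SkewMonoidAlgebra.single_add]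
      exact add_mem hx hy
    · intro c x _ hx
      rw [← SkewMonoidAlgebra.smul_single]
      exact Submodule.smul_mem _ c hx
  · rw [Submodule.span_le]
    rintro _ ⟨l, g, rfl, rfl⟩
    exact mono_mem_skewDeg l g

theorem vec_mem_skewDeg (v : V) : vec k G v ∈ skewDeg k G V 1 := by
  simpa [mono, grp_one] using mono_mem_skewDeg (k := k) [v] (1 : G)

theorem grp_mem_skewDeg (g : G) : grp k V g ∈ skewDeg k G V 0 := by
  simpa [mono] using mono_mem_skewDeg (k := k) ([] : List V) g

theorem mul_mem_of_mem_span {A : Type*} [Ring A] [Algebra k A] {s t : Set A} {W : Submodule k A}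
    (h : ∀ x ∈ s, ∀ y ∈ t, x * y ∈ W) {a b : A} (ha : a ∈ Submodule.span k s)
    (hb : b ∈ Submodule.span k t) : a * b ∈ W := by
  have hab := Submodule.mul_mem_mul ha hb
  rw [Submodule.span_mul_span] at hab
  refine Submodule.span_le.2 ?_ hab
  rintro _ ⟨x, hx, y, hy, rfl⟩
  exact h x hx y hy

theorem one_mem_skewDeg : (1 : Skew k G V) ∈ skewDeg k G V 0 := by
  rw [← grp_one]; exact grp_mem_skewDeg 1

theorem mul_mem_skewDeg {m n : ℕ} {a b : Skew k G V} (ha : a ∈ skewDeg k G V m)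
    (hb : b ∈ skewDeg k G V n) : a * b ∈ skewDeg k G V (m + n) := by
  rw [skewDeg_eq_span] at ha hb
  refine mul_mem_of_mem_span ?_ ha hb
  rintro _ ⟨l, g, rfl, rfl⟩ _ ⟨m, h, rfl, rfl⟩
  have := mono_mem_skewDeg (k := k) (l ++ m.map (g • ·)) (g * h)
  rwa [mono_mul_mono, ← List.length_map (f := (g • ·)) (as := m), ← List.length_append]

theorem span_mono_eq_top :
    Submodule.span k (Set.range fun p : List V × G => mono (k := k) p.1 p.2) = ⊤ := by
  rw [eq_top_iff]
  intro a _
  rw [← SkewMonoidAlgebra.sum_single a, SkewMonoidAlgebra.sum_def]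
  refine Submodule.sum_mem _ fun g _ => ?_
  have key : ∀ s : SymmetricAlgebra k V, s ∈ Submodule.span k
      (Set.range fun l : List V => (l.map (SymmetricAlgebra.ι k V)).prod) := by
    intro s
    induction s using SymmetricAlgebra.induction with
    | algebraMap r =>
      rw [Algebra.algebraMap_eq_smul_one]
      exact Submodule.smul_mem _ _ (Submodule.subset_span ⟨[], by simp⟩)
    | ι v => exact Submodule.subset_span ⟨[v], by simp⟩
    | mul a b ha hb =>
      have h := Submodule.mul_mem_mul ha hb
      rw [Submodule.span_mul_span] at h
      refine Submodule.span_mono ?_ h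
      rintro _ ⟨_, ⟨l, rfl⟩, _, ⟨m, rfl⟩, rfl⟩
      exact ⟨l ++ m, by simp⟩
    | add a b ha hb => exact add_mem ha hb
  refine Submodule.span_induction (p := fun s _ => SkewMonoidAlgebra.single g s ∈
      Submodule.span k (Set.range fun p : List V × G => mono (k := k) p.1 p.2))
      ?_ ?_ ?_ ?_ (key (a.coeff g))
  · rintro _ ⟨l, rfl⟩
    exact Submodule.subset_span ⟨(l, g), mono_eq_single l g⟩
  · simp
  · intro x y _ _ hx hy
    rw [SkewMonoidAlgebra.single_add]
    exact add_mem hx hy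
  · intro c x _ hx
    rw [← SkewMonoidAlgebra.smul_single]
    exact Submodule.smul_mem _ c hx

/-- Linear maps on `A` that agree on monomials are equal. -/
theorem skew_linearMap_ext {P : Type*} [AddCommMonoid P] [Module k P] {f f' : Skew k G V →ₗ[k] P}
    (h : ∀ l g, f (mono l g) = f' (mono l g)) : f = f' :=
  LinearMap.ext_on_range span_mono_eq_top fun p => h p.1 p.2

/-- A subspace of `A` that contains `G` and is stable under left multiplication by `V` is `A`. -/
theorem mem_of_grp_vec (W : Submodule k (Skew k G V)) (hg : ∀ g, grp k V g ∈ W)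
    (hv : ∀ v, ∀ a ∈ W, vec k G v * a ∈ W) (a : Skew k G V) : a ∈ W := by
  have h : a ∈ Submodule.span k (Set.range fun p : List V × G => mono (k := k) p.1 p.2) := by
    rw [span_mono_eq_top]; trivial
  refine Submodule.span_le.2 ?_ h
  rintro _ ⟨⟨l, g⟩, rfl⟩
  induction l with
  | nil => simpa [mono_nil] using hg g
  | cons v l ih => simpa [mono_cons] using hv v _ ih

/-- Every functional on V extends to an algebra map on S(V), and functionals separate the points of
V. -/
theorem ι_injective : Function.Injective (SymmetricAlgebra.ι k V) := by
  intro v w h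
  rw [← sub_eq_zero, ← Module.forall_dual_apply_eq_zero_iff k]
  intro f
  have := congrArg (SymmetricAlgebra.lift f) h
  rw [map_sub, sub_eq_zero]
  simpa using this

variable (k G V) in
/-- The inclusion of `V ⊗ kG` in `A`. -/
def vecGrp : (G →₀ V) →ₗ[k] Skew k G V :=
  Finsupp.lsum k fun g => LinearMap.mulRight k (grp k V g) ∘ₗ vec k G

theorem vecGrp_single (g : G) (v : V) :
    vecGrp k G V (Finsupp.single g v) = vec k G v * grp k V g := by simp [vecGrp]

theorem vecGrp_coeff (u : G →₀ V) (g : G) :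
    (vecGrp k G V u).coeff g = SymmetricAlgebra.ι k V (u g) := by
  classical
  induction u using Finsupp.induction_linear with
  | zero => simp
  | add u w hu hw => simp [hu, hw, map_add]
  | single h v =>
    rw [vecGrp_single, vec_apply, grp_apply, SkewMonoidAlgebra.single_mul_single]
    simp only [one_mul, smul_one, mul_one, SkewMonoidAlgebra.coeff_single_apply,
      Finsupp.single_apply]
    split_ifs <;> simp

/-- The coefficients in S(V) recover the element. Together with `groupIncl_injective` this turns
equations in A into equations in V ⊗ kG and kG, and it bounds the dimensions of A_1 and A_0 from
below. -/
theorem vecGrp_injective : Function.Injective (vecGrp k G V) := by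
  intro u w h
  ext g
  apply ι_injective (k := k)
  rw [← vecGrp_coeff, ← vecGrp_coeff, h]

theorem vecGrp_mem_skewDeg (u : G →₀ V) : vecGrp k G V u ∈ skewDeg k G V 1 := by
  intro g
  rw [vecGrp_coeff, symDeg, pow_one]
  exact ⟨_, rfl⟩

theorem groupIncl_coeff (r : MonoidAlgebra k G) (g : G) :
    (groupIncl k G V r).coeff g = algebraMap k _ (r.coeff g) := by
  classical
  induction r using MonoidAlgebra.induction_linear with
  | zero => simp
  | add r s hr hs => simp [hr, hs, map_add]
  | single h c =>
    rw [groupIncl_single, grp_apply]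
    simp only [SkewMonoidAlgebra.coeff_smul, SkewMonoidAlgebra.coeff_single, Finsupp.smul_apply,
      MonoidAlgebra.coeff_single, Finsupp.single_apply]
    split_ifs <;> simp [Algebra.algebraMap_eq_smul_one]

theorem groupIncl_injective : Function.Injective (groupIncl k G V) := by
  intro r s h
  apply MonoidAlgebra.coeff_injective
  ext g
  apply (algebraMap k (SymmetricAlgebra k V)).injective
  rw [← groupIncl_coeff, ← groupIncl_coeff, h]

theorem groupIncl_mem_skewDeg (r : MonoidAlgebra k G) : groupIncl k G V r ∈ skewDeg k G V 0 := by
  intro g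
  rw [groupIncl_coeff, symDeg, pow_zero, Submodule.mem_one]
  exact ⟨_, rfl⟩

end

noncomputable section

/-! ### Free bimodules -/

section FreeBimodule

variable {k A M P : Type*} [Field k] [Ring A] [Algebra k A] [AddCommMonoid M] [Module k M]
  [AddCommMonoid P] [Module k P]

theorem freeAct_tmul (a b a' b' : A) (m : M) :
    freeAct k A M a b (a' ⊗ₜ (m ⊗ₜ b')) = (a * a') ⊗ₜ (m ⊗ₜ (b' * b)) := rfl

theorem freeIncl_apply (m : M) : freeIncl k A m = 1 ⊗ₜ (m ⊗ₜ 1) := rfl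

theorem freeAct_freeIncl (a b : A) (m : M) :
    freeAct k A M a b (freeIncl k A m) = a ⊗ₜ (m ⊗ₜ b) := by
  rw [freeIncl_apply, freeAct_tmul, mul_one, one_mul]

theorem free_hom_ext {f f' : Free k A M →ₗ[k] P}
    (h : ∀ a b m, f (freeAct k A M a b (freeIncl k A m)) = f' (freeAct k A M a b (freeIncl k A m))) :
    f = f' := by
  refine TensorProduct.ext' fun a y => ?_
  induction y using TensorProduct.induction_on with
  | zero => simp
  | add y z hy hz => rw [TensorProduct.tmul_add, map_add, map_add, hy, hz]
  | tmul m b => simpa only [freeAct_freeIncl] using h a b m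

theorem freeAct_freeAct (a b a' b' : A) (x : Free k A M) :
    freeAct k A M a b (freeAct k A M a' b' x) = freeAct k A M (a * a') (b' * b) x := by
  suffices h : freeAct k A M a b ∘ₗ freeAct k A M a' b' = freeAct k A M (a * a') (b' * b) from
    LinearMap.congr_fun h x
  refine free_hom_ext fun c d m => ?_
  simp only [freeAct_freeIncl, LinearMap.comp_apply, freeAct_tmul, mul_assoc]

theorem freeAct_one (x : Free k A M) : freeAct k A M 1 1 x = x := by
  suffices h : freeAct k A M 1 1 = LinearMap.id from LinearMap.congr_fun h x
  refine free_hom_ext fun c d m => ?_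
  simp only [freeAct_freeIncl, freeAct_tmul, one_mul, mul_one, LinearMap.id_apply]

theorem biExtend_freeIncl (β : A →ₗ[k] A →ₗ[k] P →ₗ[k] P) (hβ : ∀ x, β 1 1 x = x) (f : M →ₗ[k] P)
    (m : M) : biExtend β f (freeIncl k A m) = f m := by
  rw [freeIncl_apply, biExtend_tmul, hβ]

theorem biExtend_freeAct (β : A →ₗ[k] A →ₗ[k] P →ₗ[k] P)
    (hβ : ∀ a b a' b' x, β a b (β a' b' x) = β (a * a') (b' * b) x) (f : M →ₗ[k] P)
    (a b : A) (x : Free k A M) : biExtend β f (freeAct k A M a b x) = β a b (biExtend β f x) := by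
  suffices h : biExtend β f ∘ₗ freeAct k A M a b = β a b ∘ₗ biExtend β f from
    LinearMap.congr_fun h x
  refine free_hom_ext fun c d m => ?_
  simp only [freeAct_freeIncl, LinearMap.comp_apply, freeAct_tmul, biExtend_tmul, hβ]

theorem algAct_apply (a b x : A) : algAct k A a b x = a * (x * b) := rfl

theorem biExtend_algAct_freeIncl (f : M →ₗ[k] A) (m : M) :
    biExtend (algAct k A) f (freeIncl k A m) = f m :=
  biExtend_freeIncl _ (fun x => by rw [algAct_apply, one_mul, mul_one]) f m

theorem biExtend_algAct_freeAct (f : M →ₗ[k] A) (a b : A) (x : Free k A M) :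
    biExtend (algAct k A) f (freeAct k A M a b x) = a * (biExtend (algAct k A) f x * b) :=
  biExtend_freeAct _ (fun a b c d x => by simp only [algAct_apply, mul_assoc]) f a b x

theorem biExtend_barGen {n : ℕ} (F : (⨂[k]^n A) →ₗ[k] A) (a : Fin n → A) :
    biExtend (algAct k A) F (barGen k a) = F (PiTensorProduct.tprod k a) :=
  biExtend_algAct_freeIncl F _

theorem circ_tprod (μ ν : (⨂[k]^2 A) →ₗ[k] A) (a b c : A) :
    circ μ ν (PiTensorProduct.tprod k ![a, b, c])
      = μ (pair k A (ν (pair k A a b)) c) - μ (pair k A a (ν (pair k A b c))) := by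
  simp [circ]

end FreeBimodule

variable {k G V : Type*} [Field k] [Group G] [AddCommGroup V] [Module k V]
  [DistribMulAction G V] [SMulCommClass G k V]

/-! ### The resolution `X` on generators -/

theorem x_hom_ext {n : ℕ} {P : Type*} [AddCommGroup P] [Module k P] {f f' : X k G V n →ₗ[k] P}
    (h : ∀ a b (i j : ℕ) (hij : i + j = n) (g : Fin i → G) (v : Fin j → V),
      f (xAct k G V n a b (xGen k hij g v)) = f' (xAct k G V n a b (xGen k hij g v))) :
    f = f' := by
  refine free_hom_ext fun a b m => ?_
  suffices H : (f ∘ₗ xAct k G V n a b) ∘ₗ freeIncl k _ = (f' ∘ₗ xAct k G V n a b) ∘ₗ freeIncl k _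
    from LinearMap.congr_fun H m
  refine DirectSum.linearMap_ext k ?_
  rintro ⟨⟨i, j⟩, hij⟩
  refine Finsupp.lhom_ext' fun g => ?_
  apply exteriorPower.linearMap_ext
  ext v
  exact h a b i j hij g v

theorem xIncl_ιMulti {n i j : ℕ} (h : i + j = n) (g : Fin i → G) (v : Fin j → V) :
    xIncl h g (exteriorPower.ιMulti k j v) = xGen k h g v := rfl

theorem xD_xAct (n : ℕ) (a b : Skew k G V) (x : X k G V (n + 1)) :
    xD k G V n (xAct k G V (n + 1) a b x) = xAct k G V n a b (xD k G V n x) :=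
  biExtend_freeAct _ (fun a b c d x => freeAct_freeAct a b c d x) _ a b x

theorem xD_xGen (n : ℕ) {i j : ℕ} (h : i + j = n + 1) (g : Fin i → G) (v : Fin j → V) :
    xD k G V n (xGen k h g v) = dHor n i j h (Finsupp.single g (exteriorPower.ιMulti k j v))
      + dVer n i j h (Finsupp.single g (exteriorPower.ιMulti k j v)) := by
  rw [xD, xGen, xIncl, LinearMap.comp_apply, biExtend_freeIncl _ freeAct_one, LinearMap.comp_apply,
    DirectSum.toModule_lof]
  rfl

theorem dHor_zero (n j : ℕ) (h : 0 + j = n + 1) : dHor (k := k) (G := G) (V := V) n 0 j h = 0 := rfl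

theorem dHor_single (n : ℕ) {i j : ℕ} (h : i + 1 + j = n + 1) (g : Fin (i + 1) → G)
    (v : Fin j → V) :
    dHor n (i + 1) j h (Finsupp.single g (exteriorPower.ιMulti k j v)) =
      xAct k G V n (grp k V (g 0)) 1 (xGen k (by omega) (Fin.tail g) v)
      + ∑ l : Fin i, (-1 : k) ^ (l.val + 1) •
          xGen k (by omega) (Fin.contractNth l.castSucc (· * ·) g) v
      + (-1 : k) ^ (i + 1) • xAct k G V n 1 (grp k V (g (Fin.last i)))
          (xGen k (by omega) (Fin.init g) (fun l => g (Fin.last i) • v l)) := by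
  simp only [dHor, Finsupp.lsum_single, LinearMap.add_apply, LinearMap.comp_apply,
    LinearMap.smul_apply, LinearMap.sum_apply, exteriorPower.map_apply_ιMulti, xIncl_ιMulti]
  rfl

theorem dVer_zero (n i : ℕ) (h : i + 0 = n + 1) : dVer (k := k) (G := G) (V := V) n i 0 h = 0 := by
  cases i <;> rfl

theorem dVerAux_apply {n i j : ℕ} (h : i + j = n) (g : Fin i → G) (v : V) (w : Fin j → V) :
    dVerAux h g v w = xAct k G V n (vec k G ((List.ofFn g).prod • v)) 1 (xGen k h g w)
      - xAct k G V n 1 (vec k G v) (xGen k h g w) := by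
  simp [dVerAux, xIncl_ιMulti]

theorem dVer_single (n : ℕ) {i j : ℕ} (h : i + (j + 1) = n + 1) (g : Fin i → G)
    (v : Fin (j + 1) → V) :
    dVer n i (j + 1) h (Finsupp.single g (exteriorPower.ιMulti k (j + 1) v)) =
      (-1 : k) ^ i • ∑ l : Fin (j + 1), (-1 : ℤ) ^ l.val •
        (xAct k G V n (vec k G ((List.ofFn g).prod • v l)) 1 (xGen k (by omega) g (l.removeNth v))
          - xAct k G V n 1 (vec k G (v l)) (xGen k (by omega) g (l.removeNth v))) := by
  cases i <;>
  · simp only [dVer, LinearMap.smul_apply, Finsupp.lsum_single,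
      exteriorPower.alternatingMapLinearEquiv_apply_ιMulti,
      AlternatingMap.alternatizeUncurryFin_apply, dVerAux_apply]

theorem xD_xGen_succ_zero (n : ℕ) {i : ℕ} (h : i + 1 + 0 = n + 1) (g : Fin (i + 1) → G)
    (v : Fin 0 → V) : xD k G V n (xGen k h g v) =
      xAct k G V n (grp k V (g 0)) 1 (xGen k (by omega) (Fin.tail g) v)
      + ∑ l : Fin i, (-1 : k) ^ (l.val + 1) •
          xGen k (by omega) (Fin.contractNth l.castSucc (· * ·) g) v
      + (-1 : k) ^ (i + 1) • xAct k G V n 1 (grp k V (g (Fin.last i)))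
          (xGen k (by omega) (Fin.init g) (fun l => g (Fin.last i) • v l)) :=
  (xD_xGen n h g v).trans ((congrArg₂ _ (dHor_single n h g v)
    (LinearMap.congr_fun (dVer_zero n _ h) _)).trans (add_zero _))

theorem xD_xGen_zero_succ (n : ℕ) {j : ℕ} (h : 0 + (j + 1) = n + 1) (g : Fin 0 → G)
    (v : Fin (j + 1) → V) : xD k G V n (xGen k h g v) =
      (-1 : k) ^ 0 • ∑ l : Fin (j + 1), (-1 : ℤ) ^ l.val •
        (xAct k G V n (vec k G ((List.ofFn g).prod • v l)) 1 (xGen k (by omega) g (l.removeNth v))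
          - xAct k G V n 1 (vec k G (v l)) (xGen k (by omega) g (l.removeNth v))) :=
  (xD_xGen n h g v).trans ((congrArg₂ _ (LinearMap.congr_fun (dHor_zero n _ h) _)
    (dVer_single n h g v)).trans (zero_add _))

theorem xD_xGen_succ_succ (n : ℕ) {i j : ℕ} (h : i + 1 + (j + 1) = n + 1) (g : Fin (i + 1) → G)
    (v : Fin (j + 1) → V) : xD k G V n (xGen k h g v) =
      xAct k G V n (grp k V (g 0)) 1 (xGen k (by omega) (Fin.tail g) v)
      + ∑ l : Fin i, (-1 : k) ^ (l.val + 1) •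
          xGen k (by omega) (Fin.contractNth l.castSucc (· * ·) g) v
      + (-1 : k) ^ (i + 1) • xAct k G V n 1 (grp k V (g (Fin.last i)))
          (xGen k (by omega) (Fin.init g) (fun l => g (Fin.last i) • v l))
      + (-1 : k) ^ (i + 1) • ∑ l : Fin (j + 1), (-1 : ℤ) ^ l.val •
        (xAct k G V n (vec k G ((List.ofFn g).prod • v l)) 1 (xGen k (by omega) g (l.removeNth v))
          - xAct k G V n 1 (vec k G (v l)) (xGen k (by omega) g (l.removeNth v))) :=
  (xD_xGen n h g v).trans (congrArg₂ _ (dHor_single n h g v) (dVer_single n h g v))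

end

noncomputable section

variable {k G V : Type*} [Field k] [Group G] [AddCommGroup V] [Module k V]
  [DistribMulAction G V] [SMulCommClass G k V]

/-! ### Values of the cochains on generators -/

theorem lamCochain_xAct (lam : MonoidAlgebra k G →ₗ[k] V →ₗ[k] MonoidAlgebra k G)
    (a b : Skew k G V) (x : X k G V 2) :
    lamCochain lam (xAct k G V 2 a b x) = a * (lamCochain lam x * b) :=
  biExtend_algAct_freeAct _ a b x

theorem kapCochain_xAct (kap : V [⋀^Fin 2]→ₗ[k] MonoidAlgebra k G)
    (a b : Skew k G V) (x : X k G V 2) :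
    kapCochain kap (xAct k G V 2 a b x) = a * (kapCochain kap x * b) :=
  biExtend_algAct_freeAct _ a b x

variable (lam : MonoidAlgebra k G →ₗ[k] V →ₗ[k] MonoidAlgebra k G)
  (kap : V [⋀^Fin 2]→ₗ[k] MonoidAlgebra k G)

theorem lamCochain_xGen_one_one (g : Fin 1 → G) (v : Fin 1 → V) :
    lamCochain lam (xGen k (i := 1) (j := 1) rfl g v)
      = groupIncl k G V (lam (MonoidAlgebra.of k G (g 0)) (v 0)) := by
  rw [lamCochain, xGen, xIncl, LinearMap.comp_apply, biExtend_algAct_freeIncl, LinearMap.comp_apply,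
    LinearMap.comp_apply, DirectSum.component.lof_self]
  simp [exteriorPower.oneEquiv_ιMulti]

theorem lamCochain_xGen_of_ne {i j : ℕ} (h : i + j = 2) (hi : i ≠ 1) (g : Fin i → G)
    (v : Fin j → V) :
    lamCochain lam (xGen k h g v) = 0 := by
  rw [lamCochain, xGen, xIncl, LinearMap.comp_apply, biExtend_algAct_freeIncl, LinearMap.comp_apply,
    LinearMap.comp_apply, DirectSum.component.of, dif_neg, map_zero]
  intro h
  exact hi (congrArg (fun p => p.1.1) h)

theorem kapCochain_xGen_zero_two (g : Fin 0 → G) (v : Fin 2 → V) :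
    kapCochain kap (xGen k (i := 0) (j := 2) rfl g v) = groupIncl k G V (kap v) := by
  rw [kapCochain, xGen, xIncl, LinearMap.comp_apply, biExtend_algAct_freeIncl, LinearMap.comp_apply,
    LinearMap.comp_apply, DirectSum.component.lof_self]
  simp

theorem kapCochain_xGen_of_ne {i j : ℕ} (h : i + j = 2) (hi : i ≠ 0) (g : Fin i → G)
    (v : Fin j → V) :
    kapCochain kap (xGen k h g v) = 0 := by
  rw [kapCochain, xGen, xIncl, LinearMap.comp_apply, biExtend_algAct_freeIncl, LinearMap.comp_apply,
    LinearMap.comp_apply, DirectSum.component.of, dif_neg, map_zero]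
  intro h
  exact hi (congrArg (fun p => p.1.1) h)

/-! ### The differential on generators of `X_3` -/

section Signs

variable {R M : Type*} [CommRing R] [AddCommGroup M] [Module R M]

/-- Evaluates the signs of the differential for arbitrary summands; the same is done below for every
bidegree that occurs. -/
theorem sum_signs_three_zero (a r : M) (c : Fin 2 → M) :
    a + ∑ l : Fin 2, (-1 : R) ^ (l.val + 1) • c l + (-1 : R) ^ (2 + 1) • r
      = a - c 0 + c 1 - r := by
  rw [Fin.sum_univ_two]; simp [pow_succ]; abel

theorem sum_signs_two_one (a r : M) (c f : Fin 1 → M) :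
    a + ∑ l : Fin 1, (-1 : R) ^ (l.val + 1) • c l + (-1 : R) ^ (1 + 1) • r
      + (-1 : R) ^ (1 + 1) • ∑ l : Fin 1, (-1 : ℤ) ^ l.val • f l = a - c 0 + r + f 0 := by
  simp; abel

theorem sum_signs_one_two (a r : M) (c : Fin 0 → M) (f : Fin 2 → M) :
    a + ∑ l : Fin 0, (-1 : R) ^ (l.val + 1) • c l + (-1 : R) ^ (0 + 1) • r
      + (-1 : R) ^ (0 + 1) • ∑ l : Fin 2, (-1 : ℤ) ^ l.val • f l = a - r - (f 0 - f 1) := by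
  rw [Fin.sum_univ_two]; simp; abel

theorem sum_signs_zero_three (f : Fin 3 → M) :
    (-1 : R) ^ 0 • ∑ l : Fin 3, (-1 : ℤ) ^ l.val • f l = f 0 - f 1 + f 2 := by
  rw [Fin.sum_univ_three]; simp; abel

end Signs

theorem xD_two_three_zero (g : Fin 3 → G) (v : Fin 0 → V) :
    xD k G V 2 (xGen k (i := 3) (j := 0) rfl g v)
      = xAct k G V 2 (grp k V (g 0)) 1 (xGen k (i := 2) (j := 0) rfl ![g 1, g 2] v)
        - xGen k (i := 2) (j := 0) rfl ![g 0 * g 1, g 2] v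
        + xGen k (i := 2) (j := 0) rfl ![g 0, g 1 * g 2] v
        - xAct k G V 2 1 (grp k V (g 2)) (xGen k (i := 2) (j := 0) rfl ![g 0, g 1] v) := by
  refine (xD_xGen_succ_zero 2 rfl g v).trans ((sum_signs_three_zero _ _ _).trans ?_)
  have e1 : Fin.tail g = ![g 1, g 2] := by ext i; fin_cases i <;> rfl
  have e2 : Fin.contractNth (Fin.castSucc 0) (· * ·) g = ![g 0 * g 1, g 2] := by
    ext i; fin_cases i <;> rfl
  have e3 : Fin.contractNth (Fin.castSucc 1) (· * ·) g = ![g 0, g 1 * g 2] := by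
    ext i; fin_cases i <;> rfl
  have e4 : Fin.init g = ![g 0, g 1] := by ext i; fin_cases i <;> rfl
  have e5 : (fun l => g (Fin.last 2) • v l) = v := Subsingleton.elim _ _
  simp only [e1, e2, e3, e4, e5]
  rfl

theorem xD_two_two_one (g : Fin 2 → G) (v : Fin 1 → V) :
    xD k G V 2 (xGen k (i := 2) (j := 1) rfl g v)
      = xAct k G V 2 (grp k V (g 0)) 1 (xGen k (i := 1) (j := 1) rfl ![g 1] v)
        - xGen k (i := 1) (j := 1) rfl ![g 0 * g 1] v
        + xAct k G V 2 1 (grp k V (g 1)) (xGen k (i := 1) (j := 1) rfl ![g 0] ![g 1 • v 0])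
        + (xAct k G V 2 (vec k G ((g 0 * g 1) • v 0)) 1 (xGen k (i := 2) (j := 0) rfl g ![])
        - xAct k G V 2 1 (vec k G (v 0)) (xGen k (i := 2) (j := 0) rfl g ![])) := by
  refine (xD_xGen_succ_succ 2 rfl g v).trans ((sum_signs_two_one _ _ _ _).trans ?_)
  have e1 : Fin.tail g = ![g 1] := by ext i; fin_cases i; rfl
  have e2 : Fin.contractNth (Fin.castSucc 0) (· * ·) g = ![g 0 * g 1] := by
    ext i; fin_cases i; rfl
  have e4 : Fin.init g = ![g 0] := by ext i; fin_cases i; rfl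
  have e5 : (fun l => g (Fin.last 1) • v l) = ![g 1 • v 0] := by ext i; fin_cases i; rfl
  have e6 : Fin.removeNth 0 v = ![] := Subsingleton.elim _ _
  have e7 : (List.ofFn g).prod = g 0 * g 1 := by simp
  simp only [e1, e2, e4, e5, e6, e7]
  rfl

theorem xD_two_one_two (g : Fin 1 → G) (v : Fin 2 → V) :
    xD k G V 2 (xGen k (i := 1) (j := 2) rfl g v)
      = xAct k G V 2 (grp k V (g 0)) 1 (xGen k (i := 0) (j := 2) rfl ![] v)
        - xAct k G V 2 1 (grp k V (g 0)) (xGen k (i := 0) (j := 2) rfl ![] ![g 0 • v 0, g 0 • v 1])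
        - (xAct k G V 2 (vec k G (g 0 • v 0)) 1 (xGen k (i := 1) (j := 1) rfl g ![v 1])
        - xAct k G V 2 1 (vec k G (v 0)) (xGen k (i := 1) (j := 1) rfl g ![v 1])
        - (xAct k G V 2 (vec k G (g 0 • v 1)) 1 (xGen k (i := 1) (j := 1) rfl g ![v 0])
        - xAct k G V 2 1 (vec k G (v 1)) (xGen k (i := 1) (j := 1) rfl g ![v 0]))) := by
  refine (xD_xGen_succ_succ (i := 0) (j := 1) 2 rfl g v).trans
    ((sum_signs_one_two _ _ _ _).trans ?_)
  have e1 : Fin.tail g = ![] := Subsingleton.elim _ _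
  have e4 : Fin.init g = ![] := Subsingleton.elim _ _
  have e5 : (fun l => g (Fin.last 0) • v l) = ![g 0 • v 0, g 0 • v 1] := by
    ext i; fin_cases i <;> rfl
  have e6 : Fin.removeNth 0 v = ![v 1] := by ext i; fin_cases i; rfl
  have e7 : Fin.removeNth 1 v = ![v 0] := by ext i; fin_cases i; rfl
  have e8 : (List.ofFn g).prod = g 0 := by simp
  simp only [e1, e4, e5, e6, e7, e8]
  rfl

theorem xD_two_zero_three (g : Fin 0 → G) (v : Fin 3 → V) :
    xD k G V 2 (xGen k (i := 0) (j := 3) rfl g v)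
      = (xAct k G V 2 (vec k G (v 0)) 1 (xGen k (i := 0) (j := 2) rfl g ![v 1, v 2])
        - xAct k G V 2 1 (vec k G (v 0)) (xGen k (i := 0) (j := 2) rfl g ![v 1, v 2]))
        - (xAct k G V 2 (vec k G (v 1)) 1 (xGen k (i := 0) (j := 2) rfl g ![v 0, v 2])
        - xAct k G V 2 1 (vec k G (v 1)) (xGen k (i := 0) (j := 2) rfl g ![v 0, v 2]))
        + (xAct k G V 2 (vec k G (v 2)) 1 (xGen k (i := 0) (j := 2) rfl g ![v 0, v 1])
        - xAct k G V 2 1 (vec k G (v 2)) (xGen k (i := 0) (j := 2) rfl g ![v 0, v 1])) := by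
  refine (xD_xGen_zero_succ 2 rfl g v).trans ((sum_signs_zero_three _).trans ?_)
  have e6 : Fin.removeNth 0 v = ![v 1, v 2] := by ext i; fin_cases i <;> rfl
  have e7 : Fin.removeNth 1 v = ![v 0, v 2] := by ext i; fin_cases i <;> rfl
  have e8 : Fin.removeNth 2 v = ![v 0, v 1] := by ext i; fin_cases i <;> rfl
  simp only [e6, e7, e8, List.ofFn_zero, List.prod_nil, one_smul]

end

noncomputable section

variable {k G V : Type*} [Field k] [Group G] [AddCommGroup V] [Module k V]
  [DistribMulAction G V] [SMulCommClass G k V]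

/-! ### Products of `kG` and `V` -/

/-- `(r, v) ↦ ∑_h r_h (ʰv) h`, the product `r v` in `A`. -/
def twist : MonoidAlgebra k G →ₗ[k] V →ₗ[k] (G →₀ V) :=
  (Finsupp.lsum k fun h => LinearMap.toSpanSingleton k (V →ₗ[k] (G →₀ V))
    (Finsupp.lsingle h ∘ₗ DistribSMul.toLinearMap k V h)) ∘ₗ
    (MonoidAlgebra.coeffLinearEquiv k).toLinearMap

/-- `(r, v) ↦ ∑_h r_h v h`, the product `v r` in `A`. -/
def flat : MonoidAlgebra k G →ₗ[k] V →ₗ[k] (G →₀ V) :=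
  (Finsupp.lsum k fun h => LinearMap.toSpanSingleton k (V →ₗ[k] (G →₀ V))
    (Finsupp.lsingle h)) ∘ₗ (MonoidAlgebra.coeffLinearEquiv k).toLinearMap

theorem twist_of (h : G) (v : V) :
    twist (MonoidAlgebra.of k G h) v = Finsupp.single h (h • v) := by
  simp [twist]

theorem flat_of (h : G) (v : V) : flat (MonoidAlgebra.of k G h) v = Finsupp.single h v := by
  simp [flat]

theorem groupAlgebra_linearMap_ext {P : Type*} [AddCommMonoid P] [Module k P]
    {f f' : MonoidAlgebra k G →ₗ[k] P}
    (h : ∀ g, f (MonoidAlgebra.of k G g) = f' (MonoidAlgebra.of k G g)) : f = f' :=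
  MonoidAlgebra.lhom_ext' fun g => LinearMap.ext_ring (h g)

theorem groupIncl_mul_vec (r : MonoidAlgebra k G) (v : V) :
    groupIncl k G V r * vec k G v = vecGrp k G V (twist r v) := by
  suffices h : LinearMap.mulRight k (vec k G v) ∘ₗ (groupIncl k G V).toLinearMap
      = vecGrp k G V ∘ₗ twist.flip v from LinearMap.congr_fun h r
  refine groupAlgebra_linearMap_ext fun g => ?_
  simp only [LinearMap.comp_apply, LinearMap.flip_apply, twist_of, vecGrp_single,
    AlgHom.toLinearMap_apply, groupIncl_of, LinearMap.mulRight_apply, grp_mul_vec]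

theorem vec_mul_groupIncl (r : MonoidAlgebra k G) (v : V) :
    vec k G v * groupIncl k G V r = vecGrp k G V (flat r v) := by
  suffices h : LinearMap.mulLeft k (vec k G v) ∘ₗ (groupIncl k G V).toLinearMap
      = vecGrp k G V ∘ₗ flat.flip v from LinearMap.congr_fun h r
  refine groupAlgebra_linearMap_ext fun g => ?_
  simp only [LinearMap.comp_apply, LinearMap.flip_apply, flat_of, vecGrp_single,
    AlgHom.toLinearMap_apply, groupIncl_of, LinearMap.mulLeft_apply]

/-- The PBW property in terms of the parameters. -/
structure Compatible (lam : MonoidAlgebra k G →ₗ[k] V →ₗ[k] MonoidAlgebra k G)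
    (kap : V [⋀^Fin 2]→ₗ[k] MonoidAlgebra k G) : Prop where
  lam_mul (g h : G) (v : V) : lam (MonoidAlgebra.of k G (g * h)) v =
    MonoidAlgebra.of k G g * lam (MonoidAlgebra.of k G h) v
      + lam (MonoidAlgebra.of k G g) (h • v) * MonoidAlgebra.of k G h
  lam_swap (g : G) (v w : V) :
    twist (lam (MonoidAlgebra.of k G g) v) w - flat (lam (MonoidAlgebra.of k G g) v) (g • w) =
      twist (lam (MonoidAlgebra.of k G g) w) v - flat (lam (MonoidAlgebra.of k G g) w) (g • v)
  lam_lam (g : G) (v w : V) :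
    lam (lam (MonoidAlgebra.of k G g) v) w - lam (lam (MonoidAlgebra.of k G g) w) v =
      MonoidAlgebra.of k G g * kap ![v, w] - kap ![g • v, g • w] * MonoidAlgebra.of k G g
  kap_swap (u v w : V) : twist (kap ![u, v]) w - flat (kap ![u, v]) w
    + (twist (kap ![v, w]) u - flat (kap ![v, w]) u)
    + (twist (kap ![w, u]) v - flat (kap ![w, u]) v) = 0
  lam_kap (u v w : V) : lam (kap ![u, v]) w + lam (kap ![v, w]) u + lam (kap ![w, u]) v = 0

theorem alternating_swap {P : Type*} [AddCommGroup P] [Module k P] (f : V [⋀^Fin 2]→ₗ[k] P)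
    (v w : V) : f ![w, v] = -f ![v, w] := by
  have := f.map_swap ![v, w] (i := 0) (j := 1) (by decide)
  rw [← this]
  congr 1
  ext i
  fin_cases i <;> rfl

/-! ### Brackets on generators -/

section Combinations

variable {A : Type*} [AddCommGroup A] [Module k A] (m n : A →ₗ[k] A →ₗ[k] A)

/-- The inner arguments are regrouped so that `n` occurs only in the combinations prescribed by φ_2,
on which ψ_2 is known. The same regrouping is made for the other bidegrees. -/
theorem circ_combination_two_one (g h v hv ghv : A) :
    m (n g h) v - m g (n h v) - (m (n g hv) h - m g (n hv h)) + (m (n ghv g) h - m ghv (n g h))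
      = m (n g h) v - m g (n h v - n hv h) - m (n g hv - n ghv g) h - m ghv (n g h) := by
  simp only [map_sub, LinearMap.sub_apply]; abel

theorem circ_combination_one_two (g v w gv gw : A) :
    m (n g v) w - m g (n v w) - (m (n g w) v - m g (n w v)) + (m (n gv gw) g - m gv (n gw g))
        - (m (n gw gv) g - m gw (n gv g)) - (m (n gv g) w - m gv (n g w))
        + (m (n gw g) v - m gw (n g v))
      = m (n g v - n gv g) w - m (n g w - n gw g) v - m g (n v w - n w v)
        + m (n gv gw - n gw gv) g + m gv (n g w - n gw g) - m gw (n g v - n gv g) := by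
  simp only [map_sub, LinearMap.sub_apply]; abel

theorem sum_perm_three {M : Type*} [AddCommGroup M] (F : Fin 3 → Fin 3 → Fin 3 → M) :
    (∑ s : Equiv.Perm (Fin 3), (Equiv.Perm.sign s : ℤ) • F (s 0) (s 1) (s 2))
      = F 0 1 2 - F 1 0 2 + (F 1 2 0 - F 2 1 0) + (F 2 0 1 - F 0 2 1) := by
  have hu : (Finset.univ : Finset (Equiv.Perm (Fin 3))) =
      {1, Equiv.swap 0 1, Equiv.swap 0 1 * Equiv.swap 1 2, Equiv.swap 0 2,
        Equiv.swap 1 2 * Equiv.swap 0 1, Equiv.swap 1 2} := by decide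
  rw [hu, Finset.sum_insert (by decide), Finset.sum_insert (by decide),
    Finset.sum_insert (by decide), Finset.sum_insert (by decide), Finset.sum_insert (by decide),
    Finset.sum_singleton]
  have h1 : ∀ s : Equiv.Perm (Fin 3), ∀ a b c d, Equiv.Perm.sign s = a → s 0 = b → s 1 = c →
      s 2 = d → (Equiv.Perm.sign s : ℤ) • F (s 0) (s 1) (s 2) = (a : ℤ) • F b c d := by
    rintro s _ _ _ _ rfl rfl rfl rfl; rfl
  rw [h1 1 1 0 1 2 (by decide) (by decide) (by decide) (by decide),
    h1 (Equiv.swap 0 1) (-1) 1 0 2 (by decide) (by decide) (by decide) (by decide),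
    h1 (Equiv.swap 0 1 * Equiv.swap 1 2) 1 1 2 0 (by decide) (by decide) (by decide) (by decide),
    h1 (Equiv.swap 0 2) (-1) 2 1 0 (by decide) (by decide) (by decide) (by decide),
    h1 (Equiv.swap 1 2 * Equiv.swap 0 1) 1 2 0 1 (by decide) (by decide) (by decide) (by decide),
    h1 (Equiv.swap 1 2) (-1) 0 2 1 (by decide) (by decide) (by decide) (by decide)]
  simp only [Units.val_one, one_smul, Units.val_neg, neg_smul]
  abel

/-- Even permutations pair with odd ones in the inner argument, which leaves a cyclic sum of
commutators: the shape of the Jacobi identity. -/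
theorem circ_combination_zero_three (c : Fin 3 → A) :
    (∑ s : Equiv.Perm (Fin 3), (Equiv.Perm.sign s : ℤ) •
        (m (n (c (s 0)) (c (s 1))) (c (s 2)) - m (c (s 0)) (n (c (s 1)) (c (s 2)))))
      = m (n (c 0) (c 1) - n (c 1) (c 0)) (c 2) - m (c 2) (n (c 0) (c 1) - n (c 1) (c 0))
        + (m (n (c 1) (c 2) - n (c 2) (c 1)) (c 0) - m (c 0) (n (c 1) (c 2) - n (c 2) (c 1)))
        + (m (n (c 2) (c 0) - n (c 0) (c 2)) (c 1) - m (c 1) (n (c 2) (c 0) - n (c 0) (c 2))) := by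
  rw [sum_perm_three fun i j l => m (n (c i) (c j)) (c l) - m (c i) (n (c j) (c l))]
  simp only [map_sub, LinearMap.sub_apply]
  abel

end Combinations

namespace ChainMaps

variable (C : ChainMaps k G V)

/-- The cochain `ψ_2^* f` as a bilinear map. -/
def bil (f : X k G V 2 →ₗ[k] Skew k G V) : Skew k G V →ₗ[k] Skew k G V →ₗ[k] Skew k G V :=
  (pair k (Skew k G V)).compr₂ (C.toBar f)

theorem bil_apply (f : X k G V 2 →ₗ[k] Skew k G V) (a b : Skew k G V) :
    C.bil f a b = f (C.psi 2 (barGen k ![a, b])) := rfl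

theorem psi_phi_apply (x : X k G V 2) : C.psi 2 (C.phi 2 x) = x :=
  LinearMap.congr_fun (C.psi_phi 2 le_rfl) x

/-- Here and in the next two lemmas the arguments form the image under φ_2 of a generator, so ψ_2
φ_2 = id gives the value whatever ψ_2 is. -/
theorem bil_grp_grp (f : X k G V 2 →ₗ[k] Skew k G V) (g h : G) :
    C.bil f (grp k V g) (grp k V h) = f (xGen k (i := 2) (j := 0) rfl ![g, h] ![]) := by
  rw [bil_apply, ← C.phi_20, psi_phi_apply]

theorem bil_grp_vec (f : X k G V 2 →ₗ[k] Skew k G V) (g : G) (v : V) :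
    C.bil f (grp k V g) (vec k G v) - C.bil f (vec k G (g • v)) (grp k V g)
      = f (xGen k (i := 1) (j := 1) rfl ![g] ![v]) := by
  rw [bil_apply, bil_apply, ← map_sub, ← map_sub, ← C.phi_11, psi_phi_apply]

theorem bil_vec_vec (f : X k G V 2 →ₗ[k] Skew k G V) (v w : V) :
    C.bil f (vec k G v) (vec k G w) - C.bil f (vec k G w) (vec k G v)
      = f (xGen k (i := 0) (j := 2) rfl ![] ![v, w]) := by
  rw [bil_apply, bil_apply, ← map_sub, ← map_sub, ← C.phi_02, psi_phi_apply]

theorem ofBar_apply (F : (⨂[k]^3 (Skew k G V)) →ₗ[k] Skew k G V) (x : X k G V 3) :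
    C.ofBar F x = biExtend (algAct k (Skew k G V)) F (C.phi 3 x) := rfl

theorem biExtend_circ (f f' : X k G V 2 →ₗ[k] Skew k G V) (a b c : Skew k G V) :
    biExtend (algAct k (Skew k G V)) (circ (C.toBar f) (C.toBar f')) (barGen k ![a, b, c])
      = C.bil f (C.bil f' a b) c - C.bil f a (C.bil f' b c) := by
  rw [biExtend_barGen, circ_tprod]; rfl

theorem ofBar_circ_three_zero (f f' : X k G V 2 →ₗ[k] Skew k G V) (g h l : G) :
    C.ofBar (circ (C.toBar f) (C.toBar f')) (xGen k (i := 3) (j := 0) rfl ![g, h, l] ![])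
      = C.bil f (f' (xGen k (i := 2) (j := 0) rfl ![g, h] ![])) (grp k V l)
        - C.bil f (grp k V g) (f' (xGen k (i := 2) (j := 0) rfl ![h, l] ![])) := by
  rw [ofBar_apply, C.phi_30, biExtend_circ, bil_grp_grp, bil_grp_grp]

theorem ofBar_circ_two_one (f f' : X k G V 2 →ₗ[k] Skew k G V) (g h : G) (v : V) :
    C.ofBar (circ (C.toBar f) (C.toBar f')) (xGen k (i := 2) (j := 1) rfl ![g, h] ![v])
      = C.bil f (f' (xGen k (i := 2) (j := 0) rfl ![g, h] ![])) (vec k G v)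
        - C.bil f (grp k V g) (f' (xGen k (i := 1) (j := 1) rfl ![h] ![v]))
        - C.bil f (f' (xGen k (i := 1) (j := 1) rfl ![g] ![h • v])) (grp k V h)
        - C.bil f (vec k G ((g * h) • v)) (f' (xGen k (i := 2) (j := 0) rfl ![g, h] ![])) := by
  rw [ofBar_apply, C.phi_21, map_add, map_sub, biExtend_circ, biExtend_circ, biExtend_circ,
    circ_combination_two_one, bil_grp_grp, bil_grp_vec, mul_smul, bil_grp_vec]

theorem ofBar_circ_one_two (f f' : X k G V 2 →ₗ[k] Skew k G V) (g : G) (v w : V) :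
    C.ofBar (circ (C.toBar f) (C.toBar f')) (xGen k (i := 1) (j := 2) rfl ![g] ![v, w])
      = C.bil f (f' (xGen k (i := 1) (j := 1) rfl ![g] ![v])) (vec k G w)
        - C.bil f (f' (xGen k (i := 1) (j := 1) rfl ![g] ![w])) (vec k G v)
        - C.bil f (grp k V g) (f' (xGen k (i := 0) (j := 2) rfl ![] ![v, w]))
        + C.bil f (f' (xGen k (i := 0) (j := 2) rfl ![] ![g • v, g • w])) (grp k V g)
        + C.bil f (vec k G (g • v)) (f' (xGen k (i := 1) (j := 1) rfl ![g] ![w]))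
        - C.bil f (vec k G (g • w)) (f' (xGen k (i := 1) (j := 1) rfl ![g] ![v])) := by
  rw [ofBar_apply, C.phi_12, map_add, map_sub, map_sub, map_add, map_sub, biExtend_circ,
    biExtend_circ, biExtend_circ, biExtend_circ, biExtend_circ, biExtend_circ,
    circ_combination_one_two, bil_grp_vec, bil_grp_vec, bil_vec_vec, bil_vec_vec]

theorem ofBar_circ_zero_three (f f' : X k G V 2 →ₗ[k] Skew k G V) (v : Fin 3 → V) :
    C.ofBar (circ (C.toBar f) (C.toBar f')) (xGen k (i := 0) (j := 3) rfl ![] v)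
      = C.bil f (f' (xGen k (i := 0) (j := 2) rfl ![] ![v 0, v 1])) (vec k G (v 2))
        - C.bil f (vec k G (v 2)) (f' (xGen k (i := 0) (j := 2) rfl ![] ![v 0, v 1]))
        + (C.bil f (f' (xGen k (i := 0) (j := 2) rfl ![] ![v 1, v 2])) (vec k G (v 0))
          - C.bil f (vec k G (v 0)) (f' (xGen k (i := 0) (j := 2) rfl ![] ![v 1, v 2])))
        + (C.bil f (f' (xGen k (i := 0) (j := 2) rfl ![] ![v 2, v 0])) (vec k G (v 1))
          - C.bil f (vec k G (v 1)) (f' (xGen k (i := 0) (j := 2) rfl ![] ![v 2, v 0]))) := by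
  have e (s : Equiv.Perm (Fin 3)) : barGen k (fun i => vec k G (v (s i)))
      = barGen k ![vec k G (v (s 0)), vec k G (v (s 1)), vec k G (v (s 2))] := by
    congr 1; ext1 i; fin_cases i <;> rfl
  rw [ofBar_apply, C.phi_03, map_sum]
  simp only [map_zsmul, e, biExtend_circ]
  rw [circ_combination_zero_three (C.bil f) (C.bil f') fun i => vec k G (v i)]
  simp only [bil_vec_vec]

end ChainMaps

end

noncomputable section

variable {k G V : Type*} [Field k] [Group G] [AddCommGroup V] [Module k V]
  [DistribMulAction G V] [SMulCommClass G k V]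

/-! ### The cochain conditions in terms of the parameters -/

theorem cochain_ext {f f' : X k G V 3 →ₗ[k] Skew k G V}
    (hf : ∀ a b x, f (xAct k G V 3 a b x) = a * (f x * b))
    (hf' : ∀ a b x, f' (xAct k G V 3 a b x) = a * (f' x * b))
    (h30 : ∀ g h l, f (xGen k (i := 3) (j := 0) rfl ![g, h, l] ![])
      = f' (xGen k (i := 3) (j := 0) rfl ![g, h, l] ![]))
    (h21 : ∀ g h v, f (xGen k (i := 2) (j := 1) rfl ![g, h] ![v])
      = f' (xGen k (i := 2) (j := 1) rfl ![g, h] ![v]))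
    (h12 : ∀ g v w, f (xGen k (i := 1) (j := 2) rfl ![g] ![v, w])
      = f' (xGen k (i := 1) (j := 2) rfl ![g] ![v, w]))
    (h03 : ∀ v, f (xGen k (i := 0) (j := 3) rfl ![] v) = f' (xGen k (i := 0) (j := 3) rfl ![] v)) :
    f = f' := by
  refine x_hom_ext fun a b i j hij g v => ?_
  rw [hf, hf']
  congr 2
  have hi : i ≤ 3 := by omega
  interval_cases i
  · obtain rfl : j = 3 := by omega
    rw [Subsingleton.elim g ![]]; exact h03 v
  · obtain rfl : j = 2 := by omega
    rw [show g = ![g 0] by ext i; fin_cases i; rfl,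
      show v = ![v 0, v 1] by ext i; fin_cases i <;> rfl]
    exact h12 _ _ _
  · obtain rfl : j = 1 := by omega
    rw [show v = ![v 0] by ext i; fin_cases i; rfl,
      show g = ![g 0, g 1] by ext i; fin_cases i <;> rfl]
    exact h21 _ _ _
  · obtain rfl : j = 0 := by omega
    rw [Subsingleton.elim v ![], show g = ![g 0, g 1, g 2] by ext i; fin_cases i <;> rfl]
    exact h30 _ _ _

namespace ChainMaps

variable (C : ChainMaps k G V)

theorem ofBar_xAct (F : (⨂[k]^3 (Skew k G V)) →ₗ[k] Skew k G V) (a b : Skew k G V) (x : X k G V 3) :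
    C.ofBar F (xAct k G V 3 a b x) = a * (C.ofBar F x * b) := by
  rw [ofBar_apply, C.phi_act, biExtend_algAct_freeAct]; rfl

/-- On kG ⊗ kG the pullback is determined by the values on X_{2,0}, where λ and κ vanish. -/
theorem bil_groupIncl_groupIncl (f : X k G V 2 →ₗ[k] Skew k G V)
    (hf : ∀ g h, f (xGen k (i := 2) (j := 0) rfl ![g, h] ![]) = 0) (r s : MonoidAlgebra k G) :
    C.bil f (groupIncl k G V r) (groupIncl k G V s) = 0 := by
  suffices h : (C.bil f).compl₁₂ (groupIncl k G V).toLinearMap (groupIncl k G V).toLinearMap = 0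
    from LinearMap.congr_fun₂ h r s
  refine groupAlgebra_linearMap_ext fun g => groupAlgebra_linearMap_ext fun h => ?_
  simp only [LinearMap.compl₁₂_apply, AlgHom.toLinearMap_apply, groupIncl_of, bil_grp_grp, hf,
    LinearMap.zero_apply]

/-- `∑_h u_h ⊗ h ↦ ∑_h (ψ^* f)(u_h ⊗ h)`. -/
def bilVecGrp (f : X k G V 2 →ₗ[k] Skew k G V) : (G →₀ V) →ₗ[k] Skew k G V :=
  Finsupp.lsum k fun h => (C.bil f).flip (grp k V h) ∘ₗ vec k G

theorem bilVecGrp_single (f : X k G V 2 →ₗ[k] Skew k G V) (h : G) (v : V) :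
    C.bilVecGrp f (Finsupp.single h v) = C.bil f (vec k G v) (grp k V h) := by
  simp [bilVecGrp]

theorem bil_vec_groupIncl (f : X k G V 2 →ₗ[k] Skew k G V) (r : MonoidAlgebra k G) (v : V) :
    C.bil f (vec k G v) (groupIncl k G V r) = C.bilVecGrp f (flat r v) := by
  suffices h : C.bil f (vec k G v) ∘ₗ (groupIncl k G V).toLinearMap
      = C.bilVecGrp f ∘ₗ flat.flip v from LinearMap.congr_fun h r
  refine groupAlgebra_linearMap_ext fun g => ?_
  simp only [LinearMap.comp_apply, LinearMap.flip_apply, flat_of, bilVecGrp_single,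
    AlgHom.toLinearMap_apply, groupIncl_of]

/-- Since φ_2 sends g ⊗ v to g ⊗ v - ᵍv ⊗ g, the value at g ⊗ v is f(g ⊗ v) plus the unknown value
at ᵍv ⊗ g. All dependence on ψ is thereby pushed into `bilVecGrp`. -/
theorem bil_groupIncl_vec (f : X k G V 2 →ₗ[k] Skew k G V)
    (F : MonoidAlgebra k G →ₗ[k] V →ₗ[k] MonoidAlgebra k G)
    (hF : ∀ g v, f (xGen k (i := 1) (j := 1) rfl ![g] ![v])
      = groupIncl k G V (F (MonoidAlgebra.of k G g) v))
    (r : MonoidAlgebra k G) (v : V) :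
    C.bil f (groupIncl k G V r) (vec k G v)
      = groupIncl k G V (F r v) + C.bilVecGrp f (twist r v) := by
  suffices h : (C.bil f).flip (vec k G v) ∘ₗ (groupIncl k G V).toLinearMap
      = (groupIncl k G V).toLinearMap ∘ₗ F.flip v + C.bilVecGrp f ∘ₗ twist.flip v
    from LinearMap.congr_fun h r
  refine groupAlgebra_linearMap_ext fun g => ?_
  simp only [LinearMap.comp_apply, LinearMap.flip_apply, twist_of, bilVecGrp_single,
    AlgHom.toLinearMap_apply, groupIncl_of, LinearMap.add_apply]
  rw [← hF, ← C.bil_grp_vec, sub_add_cancel]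

end ChainMaps

variable (lam : MonoidAlgebra k G →ₗ[k] V →ₗ[k] MonoidAlgebra k G)
  (kap : V [⋀^Fin 2]→ₗ[k] MonoidAlgebra k G)

theorem lamCochain_two_zero (g h : G) :
    lamCochain lam (xGen k (i := 2) (j := 0) rfl ![g, h] ![]) = 0 :=
  lamCochain_xGen_of_ne lam _ (by decide) _ _

theorem lamCochain_one_one (g : G) (v : V) :
    lamCochain lam (xGen k (i := 1) (j := 1) rfl ![g] ![v])
      = groupIncl k G V (lam (MonoidAlgebra.of k G g) v) :=
  lamCochain_xGen_one_one lam _ _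

theorem lamCochain_zero_two (v w : V) :
    lamCochain lam (xGen k (i := 0) (j := 2) rfl ![] ![v, w]) = 0 :=
  lamCochain_xGen_of_ne lam _ (by decide) _ _

theorem kapCochain_two_zero (g h : G) :
    kapCochain kap (xGen k (i := 2) (j := 0) rfl ![g, h] ![]) = 0 :=
  kapCochain_xGen_of_ne kap _ (by decide) _ _

theorem kapCochain_one_one (g : G) (v : V) :
    kapCochain kap (xGen k (i := 1) (j := 1) rfl ![g] ![v]) = 0 :=
  kapCochain_xGen_of_ne kap _ (by decide) _ _

theorem dStar_xAct (f : X k G V 2 →ₗ[k] Skew k G V)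
    (hf : ∀ a b x, f (xAct k G V 2 a b x) = a * (f x * b)) (a b : Skew k G V) (x : X k G V 3) :
    dStar f (xAct k G V 3 a b x) = a * (dStar f x * b) := by
  rw [dStar, LinearMap.comp_apply, xD_xAct, hf]; rfl

theorem dStar_apply (f : X k G V 2 →ₗ[k] Skew k G V) (x : X k G V 3) :
    dStar f x = f (xD k G V 2 x) := rfl

theorem dStar_lamCochain_two_one (g h : G) (v : V) :
    dStar (lamCochain lam) (xGen k (i := 2) (j := 1) rfl ![g, h] ![v])
      = groupIncl k G V (MonoidAlgebra.of k G g * lam (MonoidAlgebra.of k G h) v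
          + lam (MonoidAlgebra.of k G g) (h • v) * MonoidAlgebra.of k G h
          - lam (MonoidAlgebra.of k G (g * h)) v) := by
  rw [dStar_apply, xD_two_two_one]
  simp only [map_sub, map_add, lamCochain_xAct, map_mul, groupIncl_of]
  simp only [Matrix.cons_val_zero, Matrix.cons_val_one, lamCochain_two_zero, lamCochain_one_one,
    map_mul, groupIncl_of]
  simp only [mul_one, one_mul, mul_zero, zero_mul, sub_zero, add_zero]
  abel

theorem dStar_lamCochain_one_two (g : G) (v w : V) :
    dStar (lamCochain lam) (xGen k (i := 1) (j := 2) rfl ![g] ![v, w])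
      = vecGrp k G V ((twist (lam (MonoidAlgebra.of k G g) w) v
          - flat (lam (MonoidAlgebra.of k G g) w) (g • v))
        - (twist (lam (MonoidAlgebra.of k G g) v) w
          - flat (lam (MonoidAlgebra.of k G g) v) (g • w))) := by
  rw [dStar_apply, xD_two_one_two]
  simp only [map_sub, map_add, lamCochain_xAct, ← groupIncl_mul_vec, ← vec_mul_groupIncl]
  simp only [Matrix.cons_val_zero, Matrix.cons_val_one, lamCochain_zero_two, lamCochain_one_one]
  simp only [mul_one, one_mul, mul_zero, zero_mul, sub_zero, add_zero]
  abel

theorem dStar_lamCochain_three_zero (g : Fin 3 → G) (v : Fin 0 → V) :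
    dStar (lamCochain lam) (xGen k (i := 3) (j := 0) rfl g v) = 0 := by
  rw [dStar_apply, xD_two_three_zero, Subsingleton.elim v ![]]
  simp only [map_sub, map_add, lamCochain_xAct, lamCochain_two_zero, mul_zero, zero_mul, sub_zero,
    add_zero]

theorem dStar_lamCochain_zero_three (v : Fin 3 → V) :
    dStar (lamCochain lam) (xGen k (i := 0) (j := 3) rfl ![] v) = 0 := by
  rw [dStar_apply, xD_two_zero_three]
  simp only [map_sub, map_add, lamCochain_xAct, lamCochain_zero_two, mul_zero, zero_mul, sub_zero,
    add_zero]

theorem dStar_kapCochain_three_zero (g : Fin 3 → G) (v : Fin 0 → V) :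
    dStar (kapCochain kap) (xGen k (i := 3) (j := 0) rfl g v) = 0 := by
  rw [dStar_apply, xD_two_three_zero, Subsingleton.elim v ![]]
  simp only [map_sub, map_add, kapCochain_xAct, kapCochain_two_zero, mul_zero, zero_mul, sub_zero,
    add_zero]

theorem dStar_kapCochain_two_one (g h : G) (v : V) :
    dStar (kapCochain kap) (xGen k (i := 2) (j := 1) rfl ![g, h] ![v]) = 0 := by
  rw [dStar_apply, xD_two_two_one]
  simp only [map_sub, map_add, kapCochain_xAct]
  simp only [Matrix.cons_val_zero, Matrix.cons_val_one, kapCochain_two_zero, kapCochain_one_one]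
  simp only [mul_zero, zero_mul, sub_zero, add_zero]

theorem dStar_kapCochain_one_two (g : G) (v w : V) :
    dStar (kapCochain kap) (xGen k (i := 1) (j := 2) rfl ![g] ![v, w])
      = groupIncl k G V (MonoidAlgebra.of k G g * kap ![v, w]
        - kap ![g • v, g • w] * MonoidAlgebra.of k G g) := by
  rw [dStar_apply, xD_two_one_two]
  simp only [map_sub, map_add, kapCochain_xAct, map_mul, groupIncl_of]
  simp only [Matrix.cons_val_zero, Matrix.cons_val_one, kapCochain_xGen_zero_two,
    kapCochain_one_one]
  simp only [mul_one, one_mul, mul_zero, zero_mul, sub_zero, add_zero]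

theorem dStar_kapCochain_zero_three (v : Fin 3 → V) :
    dStar (kapCochain kap) (xGen k (i := 0) (j := 3) rfl ![] v)
      = -vecGrp k G V (twist (kap ![v 0, v 1]) (v 2) - flat (kap ![v 0, v 1]) (v 2)
        + (twist (kap ![v 1, v 2]) (v 0) - flat (kap ![v 1, v 2]) (v 0))
        + (twist (kap ![v 2, v 0]) (v 1) - flat (kap ![v 2, v 0]) (v 1))) := by
  -- The differential orders this pair as v_0 ∧ v_2, the cyclic sum as v_2 ∧ v_0.
  rw [dStar_apply, xD_two_zero_three, alternating_swap kap (v 0) (v 2)]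
  simp only [map_sub, map_add, map_neg, LinearMap.neg_apply, kapCochain_xAct, ← groupIncl_mul_vec,
    ← vec_mul_groupIncl]
  simp only [kapCochain_xGen_zero_two]
  simp only [mul_one, one_mul]
  abel

end

/-! ### The square of λ and the bracket of λ and κ on generators -/

noncomputable section

variable {k G V : Type*} [Field k] [Group G] [AddCommGroup V] [Module k V]
  [DistribMulAction G V] [SMulCommClass G k V]

variable (lam : MonoidAlgebra k G →ₗ[k] V →ₗ[k] MonoidAlgebra k G)
  (kap : V [⋀^Fin 2]→ₗ[k] MonoidAlgebra k G)

namespace ChainMaps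

variable (C : ChainMaps k G V)

theorem ofBar_add (F F' : (⨂[k]^3 (Skew k G V)) →ₗ[k] Skew k G V) (x : X k G V 3) :
    C.ofBar (F + F') x = C.ofBar F x + C.ofBar F' x := by
  have h : biExtend (algAct k (Skew k G V)) (F + F')
      = biExtend (algAct k (Skew k G V)) F + biExtend (algAct k (Skew k G V)) F' := by
    refine free_hom_ext fun a b m => ?_
    rw [biExtend_algAct_freeAct, LinearMap.add_apply, biExtend_algAct_freeAct,
      biExtend_algAct_freeAct, biExtend_algAct_freeIncl, biExtend_algAct_freeIncl,
      biExtend_algAct_freeIncl, LinearMap.add_apply, add_mul, mul_add]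
  rw [ofBar_apply, h]; rfl

theorem bracket_apply (f f' : X k G V 2 →ₗ[k] Skew k G V) (x : X k G V 3) :
    C.bracket f f' x = C.ofBar (circ (C.toBar f) (C.toBar f')) x
      + C.ofBar (circ (C.toBar f') (C.toBar f)) x :=
  C.ofBar_add _ _ x

theorem bil_lam_grp_groupIncl (g : G) (r : MonoidAlgebra k G) :
    C.bil (lamCochain lam) (grp k V g) (groupIncl k G V r) = 0 := by
  rw [← groupIncl_of]; exact C.bil_groupIncl_groupIncl _ (lamCochain_two_zero lam) _ _

theorem bil_lam_groupIncl_grp (g : G) (r : MonoidAlgebra k G) :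
    C.bil (lamCochain lam) (groupIncl k G V r) (grp k V g) = 0 := by
  rw [← groupIncl_of]; exact C.bil_groupIncl_groupIncl _ (lamCochain_two_zero lam) _ _

theorem bil_kap_grp_groupIncl (g : G) (r : MonoidAlgebra k G) :
    C.bil (kapCochain kap) (grp k V g) (groupIncl k G V r) = 0 := by
  rw [← groupIncl_of]; exact C.bil_groupIncl_groupIncl _ (kapCochain_two_zero kap) _ _

theorem bil_kap_groupIncl_grp (g : G) (r : MonoidAlgebra k G) :
    C.bil (kapCochain kap) (groupIncl k G V r) (grp k V g) = 0 := by
  rw [← groupIncl_of]; exact C.bil_groupIncl_groupIncl _ (kapCochain_two_zero kap) _ _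

theorem bil_lam_groupIncl_vec (r : MonoidAlgebra k G) (v : V) :
    C.bil (lamCochain lam) (groupIncl k G V r) (vec k G v)
      = groupIncl k G V (lam r v) + C.bilVecGrp (lamCochain lam) (twist r v) :=
  C.bil_groupIncl_vec _ lam (lamCochain_one_one lam) r v

theorem bil_kap_groupIncl_vec (r : MonoidAlgebra k G) (v : V) :
    C.bil (kapCochain kap) (groupIncl k G V r) (vec k G v)
      = C.bilVecGrp (kapCochain kap) (twist r v) := by
  rw [C.bil_groupIncl_vec _ 0 (fun g v => by
    rw [kapCochain_one_one, LinearMap.zero_apply, LinearMap.zero_apply, map_zero]),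
    LinearMap.zero_apply, LinearMap.zero_apply, map_zero, zero_add]

theorem halfSquare_lam_three_zero (g h l : G) :
    C.halfSquare (lamCochain lam) (xGen k (i := 3) (j := 0) rfl ![g, h, l] ![]) = 0 := by
  rw [halfSquare, ofBar_circ_three_zero, lamCochain_two_zero, lamCochain_two_zero, map_zero,
    LinearMap.zero_apply, map_zero, sub_zero]

theorem halfSquare_lam_two_one (g h : G) (v : V) :
    C.halfSquare (lamCochain lam) (xGen k (i := 2) (j := 1) rfl ![g, h] ![v]) = 0 := by
  rw [halfSquare, ofBar_circ_two_one, lamCochain_two_zero, map_zero,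
    LinearMap.zero_apply, map_zero, sub_zero, lamCochain_one_one, lamCochain_one_one,
    bil_lam_grp_groupIncl, bil_lam_groupIncl_grp, sub_zero, sub_zero]

/-- The argument of the undetermined term is the component of d^*λ on X_{1,2}, up to sign, so the
term disappears once d^*λ = 0. -/
theorem halfSquare_lam_one_two (g : G) (v w : V) :
    C.halfSquare (lamCochain lam) (xGen k (i := 1) (j := 2) rfl ![g] ![v, w])
      = groupIncl k G V (lam (lam (MonoidAlgebra.of k G g) v) w
          - lam (lam (MonoidAlgebra.of k G g) w) v)
        + C.bilVecGrp (lamCochain lam) ((twist (lam (MonoidAlgebra.of k G g) v) w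
          - flat (lam (MonoidAlgebra.of k G g) v) (g • w))
        - (twist (lam (MonoidAlgebra.of k G g) w) v
          - flat (lam (MonoidAlgebra.of k G g) w) (g • v))) := by
  rw [halfSquare, ofBar_circ_one_two]
  simp only [lamCochain_zero_two, lamCochain_one_one, map_zero, LinearMap.zero_apply, sub_zero,
    add_zero, bil_lam_groupIncl_vec, bil_vec_groupIncl, map_sub]
  abel

theorem halfSquare_lam_zero_three (v : Fin 3 → V) :
    C.halfSquare (lamCochain lam) (xGen k (i := 0) (j := 3) rfl ![] v) = 0 := by
  rw [halfSquare, ofBar_circ_zero_three]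
  simp only [lamCochain_zero_two, map_zero, LinearMap.zero_apply, sub_zero, add_zero]

theorem bracket_three_zero (g h l : G) :
    C.bracket (lamCochain lam) (kapCochain kap) (xGen k (i := 3) (j := 0) rfl ![g, h, l] ![])
      = 0 := by
  rw [bracket_apply, ofBar_circ_three_zero, ofBar_circ_three_zero]
  simp only [lamCochain_two_zero, kapCochain_two_zero, map_zero, LinearMap.zero_apply, sub_zero,
    add_zero]

theorem bracket_two_one (g h : G) (v : V) :
    C.bracket (lamCochain lam) (kapCochain kap) (xGen k (i := 2) (j := 1) rfl ![g, h] ![v])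
      = 0 := by
  rw [bracket_apply, ofBar_circ_two_one, ofBar_circ_two_one]
  simp only [lamCochain_two_zero, kapCochain_two_zero, kapCochain_one_one, lamCochain_one_one,
    map_zero, LinearMap.zero_apply, sub_zero, add_zero, bil_kap_grp_groupIncl,
    bil_kap_groupIncl_grp]

/-- The circle product with κ inside takes values of λ on kG ⊗ kG, which are zero. Only the
undetermined term survives, evaluated at the expression that d^*λ = 0 makes vanish. -/
theorem bracket_one_two (g : G) (v w : V) :
    C.bracket (lamCochain lam) (kapCochain kap) (xGen k (i := 1) (j := 2) rfl ![g] ![v, w])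
      = C.bilVecGrp (kapCochain kap) ((twist (lam (MonoidAlgebra.of k G g) v) w
          - flat (lam (MonoidAlgebra.of k G g) v) (g • w))
        - (twist (lam (MonoidAlgebra.of k G g) w) v
          - flat (lam (MonoidAlgebra.of k G g) w) (g • v))) := by
  rw [bracket_apply, ofBar_circ_one_two, ofBar_circ_one_two]
  simp only [kapCochain_one_one, kapCochain_xGen_zero_two, lamCochain_one_one, lamCochain_zero_two,
    map_zero, LinearMap.zero_apply, sub_zero, zero_sub, neg_zero, add_zero, zero_add,
    bil_lam_grp_groupIncl, bil_lam_groupIncl_grp, bil_kap_groupIncl_vec, bil_vec_groupIncl, map_sub]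
  abel

/-- Since λ vanishes on v ∧ w, only the circle product with κ inside contributes. The argument of
the undetermined term is, up to sign, the component of d^*κ on X_{0,3}, where the square of λ is
zero. -/
theorem bracket_zero_three (v : Fin 3 → V) :
    C.bracket (lamCochain lam) (kapCochain kap) (xGen k (i := 0) (j := 3) rfl ![] v)
      = groupIncl k G V (lam (kap ![v 0, v 1]) (v 2) + lam (kap ![v 1, v 2]) (v 0)
          + lam (kap ![v 2, v 0]) (v 1))
        + C.bilVecGrp (lamCochain lam) (twist (kap ![v 0, v 1]) (v 2) - flat (kap ![v 0, v 1]) (v 2)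
        + (twist (kap ![v 1, v 2]) (v 0) - flat (kap ![v 1, v 2]) (v 0))
        + (twist (kap ![v 2, v 0]) (v 1) - flat (kap ![v 2, v 0]) (v 1))) := by
  rw [bracket_apply, ofBar_circ_zero_three, ofBar_circ_zero_three]
  simp only [kapCochain_xGen_zero_two, lamCochain_zero_two,
    map_zero, LinearMap.zero_apply, sub_zero, add_zero,
    bil_lam_groupIncl_vec, bil_vec_groupIncl, map_sub, map_add]
  abel

/-- The identities match the conditions one bidegree at a time. For d^*λ = 0, bidegree (2,1) is
`lam_mul` and (1,2) is `lam_swap`. For the square of λ, (0,3) is `kap_swap`, and (1,2) is `lam_lam`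
once `lam_swap` is known. For the bracket, (0,3) is `lam_kap` once `kap_swap` is known, and (1,2)
follows from `lam_swap`. Every other component is zero on both sides. -/
theorem compatible_iff : Compatible lam kap ↔
    dStar (lamCochain lam) = 0 ∧ C.halfSquare (lamCochain lam) = dStar (kapCochain kap) ∧
      C.bracket (lamCochain lam) (kapCochain kap) = 0 := by
  have hd := dStar_xAct (lamCochain lam) (lamCochain_xAct lam)
  have hk := dStar_xAct (kapCochain kap) (kapCochain_xAct kap)
  have h0 (a b : Skew k G V) (x : X k G V 3) : (0 : X k G V 3 →ₗ[k] Skew k G V)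
      (xAct k G V 3 a b x) = a * ((0 : X k G V 3 →ₗ[k] Skew k G V) x * b) := by
    rw [LinearMap.zero_apply, LinearMap.zero_apply, zero_mul, mul_zero]
  constructor
  · intro h
    refine ⟨cochain_ext hd h0 ?_ ?_ ?_ ?_, cochain_ext (C.ofBar_xAct _) hk ?_ ?_ ?_ ?_,
      cochain_ext (C.ofBar_xAct _) h0 ?_ ?_ ?_ ?_⟩
    · intro g h l; exact dStar_lamCochain_three_zero lam _ _
    · intro g g' v
      rw [dStar_lamCochain_two_one, h.lam_mul, sub_self, map_zero]; rfl
    · intro g v w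
      rw [dStar_lamCochain_one_two, h.lam_swap g v w, sub_self, map_zero]; rfl
    · intro v; exact dStar_lamCochain_zero_three lam v
    · intro g h l; rw [dStar_kapCochain_three_zero]; exact C.halfSquare_lam_three_zero lam _ _ _
    · intro g h v; rw [dStar_kapCochain_two_one]; exact C.halfSquare_lam_two_one lam _ _ _
    · intro g v w
      rw [dStar_kapCochain_one_two, ← h.lam_lam]
      refine (C.halfSquare_lam_one_two lam g v w).trans ?_
      rw [h.lam_swap g v w, sub_self, map_zero, add_zero]
    · intro v
      rw [dStar_kapCochain_zero_three, h.kap_swap, map_zero, neg_zero]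
      exact C.halfSquare_lam_zero_three lam v
    · intro g h l; exact C.bracket_three_zero lam kap g h l
    · intro g h v; exact C.bracket_two_one lam kap g h v
    · intro g v w
      refine (C.bracket_one_two lam kap g v w).trans ?_
      rw [h.lam_swap g v w, sub_self, map_zero]; rfl
    · intro v
      refine (C.bracket_zero_three lam kap v).trans ?_
      rw [h.kap_swap, h.lam_kap, map_zero, map_zero, add_zero]; rfl
  · rintro ⟨h1, h2, h3⟩
    -- The two degree one identities come first, because they remove the terms that depend on ψ from
    -- the remaining components.
    have swap : ∀ (g : G) (v w : V),
        twist (lam (MonoidAlgebra.of k G g) v) w - flat (lam (MonoidAlgebra.of k G g) v) (g • w) =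
        twist (lam (MonoidAlgebra.of k G g) w) v
          - flat (lam (MonoidAlgebra.of k G g) w) (g • v) := by
      intro g v w
      have := dStar_lamCochain_one_two lam g v w
      rw [h1, LinearMap.zero_apply, eq_comm, map_eq_zero_iff _ vecGrp_injective] at this
      exact (sub_eq_zero.1 this).symm
    have cyc : ∀ v : Fin 3 → V, twist (kap ![v 0, v 1]) (v 2) - flat (kap ![v 0, v 1]) (v 2)
        + (twist (kap ![v 1, v 2]) (v 0) - flat (kap ![v 1, v 2]) (v 0))
        + (twist (kap ![v 2, v 0]) (v 1) - flat (kap ![v 2, v 0]) (v 1)) = 0 := by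
      intro v
      have := dStar_kapCochain_zero_three kap v
      rwa [← h2, C.halfSquare_lam_zero_three, eq_comm, neg_eq_zero,
        map_eq_zero_iff _ vecGrp_injective] at this
    refine ⟨fun g h v => ?_, swap, fun g v w => ?_, fun u v w => cyc ![u, v, w], fun u v w => ?_⟩
    · have := dStar_lamCochain_two_one lam g h v
      rw [h1, LinearMap.zero_apply, eq_comm, map_eq_zero_iff _ groupIncl_injective] at this
      exact (sub_eq_zero.1 this).symm
    · have := C.halfSquare_lam_one_two lam g v w
      rw [h2, dStar_kapCochain_one_two, swap g v w, sub_self, map_zero, add_zero] at this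
      exact (groupIncl_injective this).symm
    · have := C.bracket_zero_three lam kap ![u, v, w]
      rw [h3, cyc, map_zero, add_zero, LinearMap.zero_apply, eq_comm,
        map_eq_zero_iff _ groupIncl_injective] at this
      exact this

theorem bracket_self (f : X k G V 2 →ₗ[k] Skew k G V) :
    C.bracket f f = (2 : k) • C.halfSquare f := by
  refine LinearMap.ext fun x => ?_
  rw [bracket_apply, LinearMap.smul_apply, two_smul]; rfl

theorem compatible_iff_of_two_ne_zero (h2 : (2 : k) ≠ 0) : Compatible lam kap ↔
    dStar (lamCochain lam) = 0 ∧
      C.bracket (lamCochain lam) (lamCochain lam) = (2 : k) • dStar (kapCochain kap) ∧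
      C.bracket (lamCochain lam) (kapCochain kap) = 0 := by
  rw [C.compatible_iff, bracket_self, (smul_right_injective _ h2).eq_iff]

end ChainMaps

end

noncomputable section

/-! ### Weighted confluence -/

section Confluence

variable {α M : Type*} [AddCommGroup M]

/-- Paths of a weighted rewriting system, with their total weights. -/
inductive Path (step : α → α → M → Prop) : α → α → M → Prop
  | refl (a : α) : Path step a a 0
  | head {a b c : α} {m p : M} : step a b m → Path step b c p → Path step a c (m + p)

/-- Newman's lemma with weights. The value at `a` is that of `f` at the end of any maximal path from
`a`, plus the weight of the path; weighted local confluence makes this independent of the path. The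
last clause bounds the values, since they are sums of values of `f` and of weights of steps. -/
theorem exists_weighted_normal_form (step : α → α → M → Prop) (μ : α → ℕ)
    (hμ : ∀ a b m, step a b m → μ b < μ a)
    (hconf : ∀ a b c m m', step a b m → step a c m' →
      ∃ d p q, Path step b d p ∧ Path step c d q ∧ m + p = m' + q) (f : α → M) :
    ∃ N : α → M, (∀ a b m, step a b m → N a = N b + m) ∧
      (∀ a, (∀ b m, ¬ step a b m) → N a = f a) ∧
      ∀ S : AddSubgroup M, (∀ a, f a ∈ S) → (∀ a b m, step a b m → m ∈ S) → ∀ a, N a ∈ S := by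
  classical
  -- The function is first defined along arbitrarily chosen steps, with the value of `f` where no
  -- step is possible.
  have hwf : WellFounded fun a b => μ a < μ b := (measure μ).wf
  let F : (a : α) → ((b : α) → μ b < μ a → M) → M := fun a rec =>
    if h : ∃ b m, step a b m then
      rec h.choose (hμ _ _ _ h.choose_spec.choose_spec) + h.choose_spec.choose
    else f a
  let N : α → M := hwf.fix F
  have hN (a : α) : N a = F a fun b _ => N b := hwf.fix_eq F a
  have hpath : ∀ n, (∀ a, μ a < n → ∀ b m, step a b m → N a = N b + m) →
      ∀ a b m, Path step a b m → μ a < n → N a = N b + m := by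
    intro n ih a b m h
    induction h with
    | refl a => intro _; rw [add_zero]
    | head hs _ ih' =>
      intro ha
      rw [ih _ ha _ _ hs, ih' ((hμ _ _ _ hs).trans ha)]
      abel
  have key : ∀ n a, μ a < n → ∀ b m, step a b m → N a = N b + m := by
    intro n
    induction n with
    | zero => intro a ha; omega
    | succ n ih =>
      intro a ha b m hs
      have hex : ∃ b m, step a b m := ⟨b, m, hs⟩
      have hc := hex.choose_spec.choose_spec
      have hNa : N a = N hex.choose + hex.choose_spec.choose := by
        rw [hN a]; simp only [F, dif_pos hex]
      -- The chosen step and the given one are continued to a common end. Both continuations start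
      -- at a smaller measure, where the induction hypothesis makes the values additive along paths.
      obtain ⟨d, p, q, hp, hq, hpq⟩ := hconf _ _ _ _ _ hc hs
      have h1 := hμ _ _ _ hc
      have h2 := hμ _ _ _ hs
      rw [hNa, hpath n ih _ _ _ hp (by omega), hpath n ih _ _ _ hq (by omega), add_assoc,
        add_assoc, add_comm p, hpq, add_comm q]
  refine ⟨N, fun a b m hs => key _ a (Nat.lt_succ_self _) b m hs, ?_, ?_⟩
  · intro a ha
    rw [hN a]
    simp only [F]
    rw [dif_neg]
    rintro ⟨b, m, h⟩
    exact ha b m h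
  · intro S hf hm a
    induction a using hwf.induction with
    | _ a ih =>
      rw [hN a]
      simp only [F]
      split_ifs with h
      · exact add_mem (ih _ (hμ _ _ _ h.choose_spec.choose_spec))
          (hm _ _ _ h.choose_spec.choose_spec)
      · exact hf a

end Confluence

/-! ### Inversions of words -/

section Inversions

variable {I : Type*} [LinearOrder I]

/-- The number of inversions of a word. -/
def inversions : List I → ℕ
  | [] => 0
  | i :: w => w.countP (· < i) + inversions w

/-- Exchanging a descent removes one inversion and creates none, so the sorting process terminates.
-/
theorem inversions_swap_lt (a c : List I) {i j : I} (h : j < i) :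
    inversions (a ++ j :: i :: c) < inversions (a ++ i :: j :: c) := by
  induction a with
  | nil =>
    simp only [List.nil_append, inversions, List.countP_cons, decide_eq_true_eq, h, if_true,
      if_neg (not_lt.2 h.le)]
    omega
  | cons l a ih =>
    simp only [List.cons_append, inversions]
    have : (a ++ j :: i :: c).Perm (a ++ i :: j :: c) :=
      List.Perm.append_left a (List.Perm.swap i j c)
    rw [this.countP_eq]
    omega

end Inversions

variable {k G V : Type*} [Field k] [Group G] [AddCommGroup V] [Module k V]
  [DistribMulAction G V] [SMulCommClass G k V]

/-! ### Operators on words -/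

variable {I : Type*}

/-- Linear combinations of the words `x_{i_1} ⋯ x_{i_n} g`. -/
abbrev Words (k G I : Type*) [Field k] : Type _ := (List I × G) →₀ k

/-- Left multiplication of words by a letter. -/
def consWord (i : I) : Module.End k (Words k G I) :=
  Finsupp.lmapDomain k k fun p => (i :: p.1, p.2)

theorem consWord_single (i : I) (w : List I) (h : G) :
    consWord i (Finsupp.single (w, h) (1 : k)) = Finsupp.single (i :: w, h) 1 := by
  simp [consWord]

variable (b : Module.Basis I k V)

/-- Left multiplication of words by a vector. -/
def opVec : V →ₗ[k] Module.End k (Words k G I) := b.constr k consWord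

theorem opVec_basis (i : I) : opVec (G := G) b (b i) = consWord i := b.constr_basis k _ i

/-- Left multiplication of words by a word of basis vectors. -/
def opWord (a : List I) : Module.End k (Words k G I) := (a.map fun i => opVec b (b i)).prod

theorem opWord_nil : opWord (G := G) b [] = 1 := rfl

theorem opWord_cons (i : I) (a : List I) :
    opWord (G := G) b (i :: a) = opVec b (b i) * opWord b a := by simp [opWord]

theorem opWord_append (a c : List I) :
    opWord (G := G) b (a ++ c) = opWord b a * opWord b c := by simp [opWord]

theorem opWord_single (a w : List I) (h : G) :
    opWord b a (Finsupp.single (w, h) (1 : k)) = Finsupp.single (a ++ w, h) 1 := by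
  induction a with
  | nil => rfl
  | cons i a ih =>
    rw [opWord_cons, Module.End.mul_apply, ih, opVec_basis, consWord_single, List.cons_append]

/-- The linear map on `kG` with given values on `G`. -/
def groupLinear {P : Type*} [AddCommMonoid P] [Module k P] (f : G → P) :
    MonoidAlgebra k G →ₗ[k] P :=
  Finsupp.linearCombination k f ∘ₗ (MonoidAlgebra.coeffLinearEquiv k).toLinearMap

theorem groupLinear_of {P : Type*} [AddCommMonoid P] [Module k P] (f : G → P) (g : G) :
    groupLinear (k := k) f (MonoidAlgebra.of k G g) = f g := by simp [groupLinear]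

variable (lam : MonoidAlgebra k G →ₗ[k] V →ₗ[k] MonoidAlgebra k G)
  (kap : V [⋀^Fin 2]→ₗ[k] MonoidAlgebra k G)

/-- `r ↦ r x_{i_1} ⋯ x_{i_n} h`, with all group elements moved to the right. -/
def actWord (h : G) : List I → MonoidAlgebra k G →ₗ[k] Words k G I
  | [] => groupLinear fun g => Finsupp.single ([], g * h) 1
  | i :: w => groupLinear fun g => opVec b (g • b i) (actWord h w (MonoidAlgebra.of k G g))
      + actWord h w (lam (MonoidAlgebra.of k G g) (b i))

/-- Left multiplication of words by elements of `kG`. -/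
def opGrp : MonoidAlgebra k G →ₗ[k] Module.End k (Words k G I) :=
  (Finsupp.linearCombination k fun p : List I × G => actWord b lam p.2 p.1).flip

theorem opGrp_single (r : MonoidAlgebra k G) (w : List I) (h : G) :
    opGrp b lam r (Finsupp.single (w, h) 1) = actWord b lam h w r := by
  simp [opGrp]

theorem words_end_ext {f f' : Module.End k (Words k G I)}
    (h : ∀ w h, f (Finsupp.single (w, h) 1) = f' (Finsupp.single (w, h) 1)) : f = f' :=
  Finsupp.lhom_ext' fun p => LinearMap.ext_ring (h p.1 p.2)

/-- True by the recursion that defines `actWord`, for every λ. Conditions on λ enter only in showing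
that `opGrp` is multiplicative. -/
theorem opGrp_mul_opVec (g : G) (v : V) :
    opGrp b lam (MonoidAlgebra.of k G g) * opVec b v =
      opVec b (g • v) * opGrp b lam (MonoidAlgebra.of k G g)
        + opGrp b lam (lam (MonoidAlgebra.of k G g) v) := by
  suffices h : LinearMap.mulLeft k (opGrp b lam (MonoidAlgebra.of k G g)) ∘ₗ opVec b =
      LinearMap.mulRight k (opGrp b lam (MonoidAlgebra.of k G g)) ∘ₗ opVec b ∘ₗ
        DistribSMul.toLinearMap k V g + opGrp b lam ∘ₗ lam (MonoidAlgebra.of k G g) from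
    LinearMap.congr_fun h v
  refine b.ext fun i => words_end_ext fun w h => ?_
  simp only [LinearMap.comp_apply, LinearMap.add_apply, LinearMap.mulLeft_apply,
    LinearMap.mulRight_apply, Module.End.mul_apply, DistribSMul.toLinearMap_apply, opGrp_single,
    opVec_basis, consWord_single, actWord, groupLinear_of]

/-- `∑_h u_h ⊗ h ↦ ∑_h u_h h`, as operators on words. -/
def opVecGrp : (G →₀ V) →ₗ[k] Module.End k (Words k G I) :=
  Finsupp.lsum k fun h => LinearMap.mulRight k (opGrp b lam (MonoidAlgebra.of k G h)) ∘ₗ opVec b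

theorem opVecGrp_single (h : G) (v : V) :
    opVecGrp b lam (Finsupp.single h v) = opVec b v * opGrp b lam (MonoidAlgebra.of k G h) := by
  simp [opVecGrp]

theorem opGrp_mul_opVec' (r : MonoidAlgebra k G) (v : V) :
    opGrp b lam r * opVec b v = opVecGrp b lam (twist r v) + opGrp b lam (lam r v) := by
  suffices h : LinearMap.mulRight k (opVec b v) ∘ₗ opGrp b lam =
      opVecGrp b lam ∘ₗ twist.flip v + opGrp b lam ∘ₗ lam.flip v from LinearMap.congr_fun h r
  refine groupAlgebra_linearMap_ext fun g => ?_
  simp only [LinearMap.comp_apply, LinearMap.add_apply, LinearMap.mulRight_apply,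
    LinearMap.flip_apply, twist_of, opVecGrp_single]
  exact opGrp_mul_opVec b lam g v

theorem opVec_mul_opGrp (r : MonoidAlgebra k G) (v : V) :
    opVec b v * opGrp b lam r = opVecGrp b lam (flat r v) := by
  suffices h : LinearMap.mulLeft k (opVec b v) ∘ₗ opGrp b lam =
      opVecGrp b lam ∘ₗ flat.flip v from LinearMap.congr_fun h r
  refine groupAlgebra_linearMap_ext fun g => ?_
  simp only [LinearMap.comp_apply, LinearMap.mulLeft_apply,
    LinearMap.flip_apply, flat_of, opVecGrp_single]

variable {lam kap}

theorem Compatible.lam_one (H : Compatible lam kap) (v : V) :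
    lam (MonoidAlgebra.of k G 1) v = 0 := by
  have := H.lam_mul 1 1 v
  rw [mul_one, map_one, one_mul, mul_one, one_smul, left_eq_add] at this
  rw [map_one]
  exact this

/-- The inductive step for multiplicativity. Both (gh)(vy) and g(h(vy)) are expanded with the cross
relation; they agree by `lam_mul`, once products in kG are known to act correctly on y. -/
theorem Compatible.opGrp_mul_opVec_apply (H : Compatible lam kap) (y : Words k G I)
    (hy : ∀ r s, opGrp b lam (r * s) y = opGrp b lam r (opGrp b lam s y)) (v : V)
    (r s : MonoidAlgebra k G) : opGrp b lam (r * s) (opVec b v y) =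
      opGrp b lam r (opGrp b lam s (opVec b v y)) := by
  suffices e : (LinearMap.mul k (MonoidAlgebra k G)).compr₂ ((opGrp b lam).flip (opVec b v y)) =
      (opGrp b lam).compl₁₂ LinearMap.id ((opGrp b lam).flip (opVec b v y)) from
    LinearMap.congr_fun₂ e r s
  refine groupAlgebra_linearMap_ext fun g => groupAlgebra_linearMap_ext fun h => ?_
  have e (g : G) (v : V) (y : Words k G I) : opGrp b lam (MonoidAlgebra.of k G g) (opVec b v y) =
      opVec b (g • v) (opGrp b lam (MonoidAlgebra.of k G g) y)
        + opGrp b lam (lam (MonoidAlgebra.of k G g) v) y :=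
    LinearMap.congr_fun (opGrp_mul_opVec b lam g v) y
  change opGrp b lam (MonoidAlgebra.of k G g * MonoidAlgebra.of k G h) (opVec b v y) =
    opGrp b lam (MonoidAlgebra.of k G g) (opGrp b lam (MonoidAlgebra.of k G h) (opVec b v y))
  rw [← map_mul, e, e, map_add, e, H.lam_mul, ← hy, ← hy, map_add, LinearMap.add_apply, ← hy,
    mul_smul, map_mul, add_assoc]
  congr 1
  exact add_comm _ _

theorem Compatible.opGrp_mul (H : Compatible lam kap) (r s : MonoidAlgebra k G) :
    opGrp (I := I) b lam (r * s) = opGrp b lam r * opGrp b lam s := by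
  have key : ∀ (w : List I) (l : G) (r s : MonoidAlgebra k G),
      opGrp b lam (r * s) (Finsupp.single (w, l) 1)
        = opGrp b lam r (opGrp b lam s (Finsupp.single (w, l) 1)) := by
    intro w l
    induction w with
    | nil =>
      intro r s
      suffices e : (LinearMap.mul k (MonoidAlgebra k G)).compr₂
          ((opGrp b lam).flip (Finsupp.single ([], l) 1)) =
          (opGrp b lam).compl₁₂ LinearMap.id ((opGrp b lam).flip (Finsupp.single ([], l) 1)) from
        LinearMap.congr_fun₂ e r s
      refine groupAlgebra_linearMap_ext fun g => groupAlgebra_linearMap_ext fun h => ?_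
      change opGrp b lam (MonoidAlgebra.of k G g * MonoidAlgebra.of k G h) _ = _
      rw [← map_mul]
      simp only [opGrp_single, actWord, groupLinear_of, mul_assoc, LinearMap.compl₁₂_apply,
        LinearMap.flip_apply, LinearMap.id_apply]
    | cons i w ih =>
      have := H.opGrp_mul_opVec_apply b _ ih (b i)
      rwa [opVec_basis, consWord_single] at this
  exact words_end_ext fun w l => key w l r s

variable (lam kap) in
/-- The operator `v w - w v - κ(v, w)` on words. -/
def opRel (v w : V) : Module.End k (Words k G I) :=
  opVec b v * opVec b w - opVec b w * opVec b v - opGrp b lam (kap ![v, w])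

/-- In the application, t is a group element acting on words, the fᵢ and tᵢ are the terms of degree
one left behind when it passes through vw and wv, and the lᵢ are those of degree zero. -/
theorem mul_commutator_sub {R : Type*} [Ring R] {t a c a' c' κ κ' f₁ f₂ t₁ t₂ l₁ l₂ : R}
    (e₁ : t * (a * c) = a' * c' * t + f₂ + t₁ + l₁) (e₂ : t * (c * a) = c' * a' * t + f₁ + t₂ + l₂)
    (h : t₁ - f₁ = t₂ - f₂) (h' : l₁ - l₂ = t * κ - κ' * t) :
    t * (a * c - c * a - κ) = (a' * c' - c' * a' - κ') * t := by
  have h2 : t₁ = t₂ - f₂ + f₁ := by rw [← h]; abel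
  have h3 : l₁ = t * κ - κ' * t + l₂ := by rw [← h']; abel
  simp only [mul_sub, sub_mul, e₁, e₂, h2, h3]
  abel

/-- A group element carries the relation for (v, w) to the relation for (ᵍv, ᵍw). The surplus terms
of degree one cancel by `lam_swap` and those of degree zero by `lam_lam`. -/
theorem Compatible.opGrp_mul_opRel (H : Compatible lam kap) (g : G) (v w : V) :
    opGrp (I := I) b lam (MonoidAlgebra.of k G g) * opRel b lam kap v w =
      opRel b lam kap (g • v) (g • w) * opGrp b lam (MonoidAlgebra.of k G g) := by
  have e (v w : V) : opGrp (I := I) b lam (MonoidAlgebra.of k G g) * (opVec b v * opVec b w) =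
      opVec b (g • v) * opVec b (g • w) * opGrp b lam (MonoidAlgebra.of k G g)
      + opVecGrp b lam (flat (lam (MonoidAlgebra.of k G g) w) (g • v))
      + opVecGrp b lam (twist (lam (MonoidAlgebra.of k G g) v) w)
      + opGrp b lam (lam (lam (MonoidAlgebra.of k G g) v) w) := by
    rw [← mul_assoc, opGrp_mul_opVec, add_mul, mul_assoc, opGrp_mul_opVec, mul_add,
      opVec_mul_opGrp b lam (lam (MonoidAlgebra.of k G g) w), opGrp_mul_opVec', ← mul_assoc,
      ← add_assoc]
  have h1 := congrArg (opVecGrp b lam) (H.lam_swap g v w)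
  have h2 := congrArg (opGrp (I := I) b lam) (H.lam_lam g v w)
  simp only [map_sub, H.opGrp_mul] at h1 h2
  exact mul_commutator_sub (R := Module.End k (Words k G I)) (e v w) (e w v) h1 h2

/-- The Jacobi identity as an operator identity. It combines `kap_swap` in degree one with `lam_kap`
in degree zero, and it resolves overlapping descents. -/
theorem Compatible.opGrp_commutator (H : Compatible lam kap) (u v w : V) :
    opGrp (I := I) b lam (kap ![u, v]) * opVec b w - opVec b w * opGrp b lam (kap ![u, v])
    + (opGrp b lam (kap ![v, w]) * opVec b u - opVec b u * opGrp b lam (kap ![v, w]))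
    + (opGrp b lam (kap ![w, u]) * opVec b v - opVec b v * opGrp b lam (kap ![w, u])) = 0 := by
  have h1 := congrArg (opVecGrp b lam) (H.kap_swap u v w)
  have h2 := congrArg (opGrp (I := I) b lam) (H.lam_kap u v w)
  simp only [map_sub, map_add, map_zero] at h1 h2
  simp only [opGrp_mul_opVec', opVec_mul_opGrp]
  rw [← add_zero (0 : Module.End k (Words k G I))]
  nth_rw 1 [← h1]
  rw [← h2]
  abel

end

noncomputable section

variable {k G V : Type*} [Field k] [Group G] [AddCommGroup V] [Module k V]
  [DistribMulAction G V] [SMulCommClass G k V]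

variable {I : Type*} (b : Module.Basis I k V)
  (lam : MonoidAlgebra k G →ₗ[k] V →ₗ[k] MonoidAlgebra k G)
  (kap : V [⋀^Fin 2]→ₗ[k] MonoidAlgebra k G)

/-! ### Relations between words -/

variable (k G I) in
/-- Linear combinations of words of length at most `n`. -/
def wordFil (n : ℕ) : Submodule k (Words k G I) :=
  Submodule.span k {y | ∃ (w : List I) (h : G), w.length ≤ n ∧ y = Finsupp.single (w, h) 1}

theorem single_mem_wordFil {n : ℕ} {w : List I} (h : G) (hw : w.length ≤ n) :
    Finsupp.single (w, h) (1 : k) ∈ wordFil k G I n := Submodule.subset_span ⟨w, h, hw, rfl⟩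

theorem wordFil_mono {m n : ℕ} (h : m ≤ n) : wordFil k G I m ≤ wordFil k G I n :=
  Submodule.span_mono fun _ ⟨w, l, hw, hy⟩ => ⟨w, l, hw.trans h, hy⟩

theorem mem_comap_of_basis {P : Type*} [AddCommGroup P] [Module k P] (f : V →ₗ[k] P)
    (S : Submodule k P) (h : ∀ i, f (b i) ∈ S) (v : V) : f v ∈ S := by
  have : (⊤ : Submodule k V) ≤ S.comap f := by
    rw [← b.span_eq, Submodule.span_le]
    rintro _ ⟨i, rfl⟩
    exact h i
  exact this trivial

theorem mem_comap_of_group {P : Type*} [AddCommGroup P] [Module k P]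
    (f : MonoidAlgebra k G →ₗ[k] P) (S : Submodule k P)
    (h : ∀ g, f (MonoidAlgebra.of k G g) ∈ S) (r : MonoidAlgebra k G) : f r ∈ S := by
  have e : S.mkQ ∘ₗ f = 0 :=
    groupAlgebra_linearMap_ext fun g => (Submodule.Quotient.mk_eq_zero _).2 (h g)
  exact (Submodule.Quotient.mk_eq_zero _).1 (LinearMap.congr_fun e r)

theorem opVec_mem_wordFil {n : ℕ} {y : Words k G I} (hy : y ∈ wordFil k G I n) (v : V) :
    opVec b v y ∈ wordFil k G I (n + 1) := by
  refine mem_comap_of_basis b ((opVec b).flip y) _ (fun i => ?_) v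
  rw [LinearMap.flip_apply, opVec_basis]
  refine (Submodule.span_le (p := (wordFil k G I (n + 1)).comap (consWord i))).2 ?_ hy
  rintro _ ⟨w, h, hw, rfl⟩
  rw [SetLike.mem_coe, Submodule.mem_comap, consWord_single]
  exact single_mem_wordFil _ (Nat.succ_le_succ hw)

theorem opGrp_mem_wordFil {n : ℕ} {y : Words k G I} (hy : y ∈ wordFil k G I n)
    (r : MonoidAlgebra k G) : opGrp b lam r y ∈ wordFil k G I n := by
  refine (Submodule.span_le (p := (wordFil k G I n).comap (opGrp b lam r))).2 ?_ hy
  rintro _ ⟨w, h, hw, rfl⟩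
  rw [SetLike.mem_coe, Submodule.mem_comap]
  refine wordFil_mono hw ?_
  clear hw
  -- The element of kG must vary, because passing a letter replaces g by λ(g, b_i).
  induction w generalizing r with
  | nil =>
    refine mem_comap_of_group ((opGrp b lam).flip _) _ (fun g => ?_) r
    rw [LinearMap.flip_apply, opGrp_single, actWord, groupLinear_of]
    exact single_mem_wordFil _ le_rfl
  | cons i w ih =>
    refine mem_comap_of_group ((opGrp b lam).flip _) _ (fun g => ?_) r
    rw [LinearMap.flip_apply, opGrp_single, actWord, groupLinear_of, ← opGrp_single,
      ← opGrp_single]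
    exact add_mem (opVec_mem_wordFil b (ih _) _) (wordFil_mono (Nat.le_succ _) (ih _))

theorem opWord_mem_wordFil {n : ℕ} {y : Words k G I} (hy : y ∈ wordFil k G I n) (a : List I) :
    opWord b a y ∈ wordFil k G I (a.length + n) := by
  induction a with
  | nil => simpa [opWord_nil] using hy
  | cons i a ih =>
    rw [opWord_cons]
    exact wordFil_mono (by rw [List.length_cons]; omega) (opVec_mem_wordFil b ih (b i))

/-- The relations of length at most `n`. -/
def wordRel (n : ℕ) : Submodule k (Words k G I) :=
  Submodule.span k {y | ∃ (a : List I) (i j : I) (c : List I) (h : G), a.length + 2 + c.length ≤ n ∧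
    y = opWord b a (opRel b lam kap (b i) (b j) (Finsupp.single (c, h) 1))}

variable {lam kap}

theorem wordRel_mono {m n : ℕ} (h : m ≤ n) : wordRel b lam kap m ≤ wordRel b lam kap n :=
  Submodule.span_mono fun _ ⟨a, i, j, c, l, hl, hy⟩ => ⟨a, i, j, c, l, hl.trans h, hy⟩

/-- An alternating map of two arguments, as a bilinear map. -/
def alternatingBilin {P : Type*} [AddCommGroup P] [Module k P] (f : V [⋀^Fin 2]→ₗ[k] P) :
    V →ₗ[k] V →ₗ[k] P :=
  LinearMap.mk₂ k (fun v w => f ![v, w])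
    (fun v v' w => by
      have e (x : V) : ![x, w] = Function.update ![0, w] 0 x := by ext i; fin_cases i <;> rfl
      rw [e v, e v', e (v + v'), AlternatingMap.map_update_add])
    (fun c v w => by
      have e (x : V) : ![x, w] = Function.update ![0, w] 0 x := by ext i; fin_cases i <;> rfl
      rw [e v, e (c • v), AlternatingMap.map_update_smul])
    (fun v w w' => by
      have e (x : V) : ![v, x] = Function.update ![v, 0] 1 x := by ext i; fin_cases i <;> rfl
      rw [e w, e w', e (w + w'), AlternatingMap.map_update_add])
    (fun c v w => by
      have e (x : V) : ![v, x] = Function.update ![v, 0] 1 x := by ext i; fin_cases i <;> rfl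
      rw [e w, e (c • w), AlternatingMap.map_update_smul])

theorem alternatingBilin_apply {P : Type*} [AddCommGroup P] [Module k P]
    (f : V [⋀^Fin 2]→ₗ[k] P) (v w : V) : alternatingBilin f v w = f ![v, w] := rfl

variable (lam kap) in
/-- `v ↦ w ↦ R(v, w) y`. -/
def opRelApply (y : Words k G I) : V →ₗ[k] V →ₗ[k] Words k G I :=
  LinearMap.mk₂ k (fun v w => opRel b lam kap v w y)
    (fun v v' w => by
      simp only [opRel, map_add, ← alternatingBilin_apply kap, LinearMap.sub_apply,
        LinearMap.add_apply, Module.End.mul_apply]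
      abel)
    (fun c v w => by
      simp only [opRel, map_smul, ← alternatingBilin_apply kap, LinearMap.sub_apply,
        LinearMap.smul_apply, Module.End.mul_apply, smul_sub])
    (fun v w w' => by
      simp only [opRel, map_add, ← alternatingBilin_apply kap, LinearMap.sub_apply,
        LinearMap.add_apply, Module.End.mul_apply]
      abel)
    (fun c v w => by
      simp only [opRel, map_smul, ← alternatingBilin_apply kap, LinearMap.sub_apply,
        LinearMap.smul_apply, Module.End.mul_apply, smul_sub])

theorem opRel_mem_wordRel {n : ℕ} {y : Words k G I} (hy : y ∈ wordFil k G I n) (v w : V) :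
    opRel b lam kap v w y ∈ wordRel b lam kap (n + 2) := by
  refine mem_comap_of_basis b ((opRelApply b lam kap y).flip w) _ (fun i => ?_) v
  refine mem_comap_of_basis b (opRelApply b lam kap y (b i)) _ (fun j => ?_) w
  refine (Submodule.span_le
    (p := (wordRel b lam kap (n + 2)).comap (opRel b lam kap (b i) (b j)))).2 ?_ hy
  rintro _ ⟨c, h, hc, rfl⟩
  exact Submodule.subset_span ⟨[], i, j, c, h, by simp; omega, rfl⟩

theorem opVec_mem_wordRel {n : ℕ} {y : Words k G I} (hy : y ∈ wordRel b lam kap n) (v : V) :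
    opVec b v y ∈ wordRel b lam kap (n + 1) := by
  refine mem_comap_of_basis b ((opVec b).flip y) _ (fun i => ?_) v
  refine (Submodule.span_le
    (p := (wordRel b lam kap (n + 1)).comap (opVec b (b i)))).2 ?_ hy
  rintro _ ⟨a, i', j, c, h, hc, rfl⟩
  refine Submodule.subset_span ⟨i :: a, i', j, c, h, by simp; omega, ?_⟩
  rw [opWord_cons, Module.End.mul_apply]

theorem opWord_mem_wordRel {n : ℕ} {y : Words k G I} (hy : y ∈ wordRel b lam kap n) (a : List I) :
    opWord b a y ∈ wordRel b lam kap (a.length + n) := by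
  induction a with
  | nil => simpa [opWord_nil] using hy
  | cons i a ih =>
    rw [opWord_cons]
    exact wordRel_mono b (by rw [List.length_cons]; omega) (opVec_mem_wordRel b ih (b i))

/-- The group element passes the letters in front of the relation by the cross relation and the
relation itself by `Compatible.opGrp_mul_opRel`. As ᵍb_i is no basis vector, the span has to be
closed under relations between arbitrary vectors, which bilinearity provides. -/
theorem Compatible.opGrp_mem_wordRel (H : Compatible lam kap) {n : ℕ} {y : Words k G I}
    (hy : y ∈ wordRel b lam kap n) (r : MonoidAlgebra k G) :
    opGrp b lam r y ∈ wordRel b lam kap n := by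
  refine (Submodule.span_le (p := (wordRel b lam kap n).comap (opGrp b lam r))).2 ?_ hy
  rintro _ ⟨a, i, j, c, h, hc, rfl⟩
  rw [SetLike.mem_coe, Submodule.mem_comap]
  refine wordRel_mono b hc ?_
  clear hc
  induction a generalizing r with
  | nil =>
    refine mem_comap_of_group ((opGrp b lam).flip _) _ (fun g => ?_) r
    have e : opGrp b lam (MonoidAlgebra.of k G g) (opRel b lam kap (b i) (b j)
        (Finsupp.single (c, h) 1)) = opRel b lam kap (g • b i) (g • b j)
          (opGrp b lam (MonoidAlgebra.of k G g) (Finsupp.single (c, h) 1)) :=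
      LinearMap.congr_fun (H.opGrp_mul_opRel b g (b i) (b j)) _
    rw [LinearMap.flip_apply, opWord_nil, Module.End.one_apply, e]
    exact wordRel_mono b (by rw [List.length_nil]; omega)
      (opRel_mem_wordRel b (opGrp_mem_wordFil b lam (single_mem_wordFil _ le_rfl) _) _ _)
  | cons l a ih =>
    refine mem_comap_of_group ((opGrp b lam).flip _) _ (fun g => ?_) r
    have e (y : Words k G I) : opGrp b lam (MonoidAlgebra.of k G g) (opVec b (b l) y) =
        opVec b (g • b l) (opGrp b lam (MonoidAlgebra.of k G g) y)
          + opGrp b lam (lam (MonoidAlgebra.of k G g) (b l)) y :=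
      LinearMap.congr_fun (opGrp_mul_opVec b lam g (b l)) y
    rw [LinearMap.flip_apply, opWord_cons, Module.End.mul_apply, e]
    refine add_mem (wordRel_mono b ?_ (opVec_mem_wordRel b (ih _) _))
      (wordRel_mono b ?_ (ih _)) <;> rw [List.length_cons] <;> omega

end

noncomputable section

variable {k G V : Type*} [Field k] [Group G] [AddCommGroup V] [Module k V]
  [DistribMulAction G V] [SMulCommClass G k V]

variable {I : Type*} [LinearOrder I] (b : Module.Basis I k V)
  {lam : MonoidAlgebra k G →ₗ[k] V →ₗ[k] MonoidAlgebra k G}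
  {kap : V [⋀^Fin 2]→ₗ[k] MonoidAlgebra k G}

/-! ### Normal forms of words -/

theorem opVec_opVec (v w : V) (y : Words k G I) : opVec b v (opVec b w y) =
    opVec b w (opVec b v y) + opGrp b lam (kap ![v, w]) y + opRel b lam kap v w y := by
  simp only [opRel, LinearMap.sub_apply, Module.End.mul_apply]
  abel

variable (lam kap) in
/-- The replacement of a descent `x_i x_j` by `x_j x_i` in a word of length `n + 1`, with the
normal form of the resulting correction term as its weight. -/
def wordStep (n : ℕ) (N : Module.End k (Words k G I)) (h : G) (w w' : List I)
    (m : Words k G I) : Prop :=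
  ∃ a i j c, j < i ∧ w = a ++ i :: j :: c ∧ w' = a ++ j :: i :: c ∧ w.length = n + 1 ∧
    m = N (opWord b a (opGrp b lam (kap ![b i, b j]) (Finsupp.single (c, h) 1)))

theorem Path.two {α M : Type*} [AddCommGroup M] {step : α → α → M → Prop} {x y z : α} {m p : M}
    (h : step x y m) (h' : step y z p) : Path step x z (m + p) := by
  simpa using Path.head h (Path.head h' (Path.refl z))

theorem Path.one {α M : Type*} [AddCommGroup M] {step : α → α → M → Prop} {x y : α} {m : M}
    (h : step x y m) : Path step x y m := by
  simpa using Path.head h (Path.refl y)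

theorem single_cons (i : I) (w : List I) (h : G) :
    Finsupp.single (i :: w, h) (1 : k) = opVec b (b i) (Finsupp.single (w, h) 1) := by
  rw [opVec_basis, consWord_single]

/-- Critical pair analysis. Two descents of a word coincide, overlap in one letter, or are disjoint,
according to whether their positions differ by 0, 1 or more. The order of the positions is fixed by
symmetry. -/
theorem Compatible.wordStep_confluent_of_le (H : Compatible lam kap) {n : ℕ}
    {N : Module.End k (Words k G I)} (hN : ∀ y ∈ wordRel b lam kap n, N y = 0) {h : G}
    {a i j c a' i' j' c'} (hji : j < i) (hji' : j' < i')
    (hw : a ++ i :: j :: c = a' ++ i' :: j' :: c') (hn : (a ++ i :: j :: c).length = n + 1)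
    (hle : a.length ≤ a'.length) :
    ∃ d p q, Path (wordStep b lam kap n N h) (a ++ j :: i :: c) d p ∧
      Path (wordStep b lam kap n N h) (a' ++ j' :: i' :: c') d q ∧
      N (opWord b a (opGrp b lam (kap ![b i, b j]) (Finsupp.single (c, h) 1))) + p =
        N (opWord b a' (opGrp b lam (kap ![b i', b j']) (Finsupp.single (c', h) 1))) + q := by
  obtain ⟨t, rfl, ht⟩ : ∃ t, a' = a ++ t ∧ i :: j :: c = t ++ i' :: j' :: c' := by
    rcases List.append_eq_append_iff.1 hw with h | ⟨t, h1, h2⟩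
    · exact h
    · have : t = [] := List.eq_nil_of_length_eq_zero (by
        have := congrArg List.length h1
        rw [List.length_append] at this
        omega)
      subst this
      exact ⟨[], by simpa using h1.symm, by simpa using h2.symm⟩
  clear hw hle
  match t, ht with
  | [], ht =>
    obtain ⟨rfl, rfl, rfl⟩ : i = i' ∧ j = j' ∧ c = c' := by simpa using ht
    rw [List.append_nil]
    exact ⟨_, 0, 0, .refl _, .refl _, rfl⟩
  -- Overlap x_i x_j x_{j'} with j' < j < i. Both ways of sorting end in x_{j'} x_j x_i, and the
  -- difference of their weights is the normal form of a cyclic sum of commutators, zero by the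
  -- Jacobi identity.
  | [_], ht =>
    obtain ⟨rfl, rfl, rfl⟩ : i = _ ∧ j = i' ∧ c = j' :: c' := by simpa using ht
    have hn' : a.length + c'.length + 3 = n + 1 := by simpa [add_assoc] using hn
    refine ⟨a ++ j' :: j :: i :: c',
      N (opWord b a (opVec b (b j) (opGrp b lam (kap ![b i, b j']) (Finsupp.single (c', h) 1))))
        + N (opWord b a (opGrp b lam (kap ![b j, b j']) (opVec b (b i) (Finsupp.single (c', h) 1)))),
      N (opWord b a (opGrp b lam (kap ![b i, b j']) (opVec b (b j) (Finsupp.single (c', h) 1))))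
        + N (opWord b a (opVec b (b j') (opGrp b lam (kap ![b i, b j])
          (Finsupp.single (c', h) 1)))), ?_, ?_, ?_⟩
    · refine Path.two (y := a ++ j :: j' :: i :: c')
        ⟨a ++ [j], i, j', c', hji'.trans hji, by simp, by simp, by simp; omega, ?_⟩
        ⟨a, j, j', i :: c', hji', by simp, by simp, by simp; omega, ?_⟩
      · rw [opWord_append, opWord_cons, opWord_nil]; rfl
      · rw [single_cons b]
    · refine Path.two (y := a ++ j' :: i :: j :: c')
        ⟨a, i, j', j :: c', hji'.trans hji, by simp, by simp, by simp; omega, ?_⟩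
        ⟨a ++ [j'], i, j, c', hji, by simp, by simp, by simp; omega, ?_⟩
      · rw [single_cons b]
      · rw [opWord_append, opWord_cons, opWord_nil]; rfl
    · have e := LinearMap.congr_fun (H.opGrp_commutator b (b i) (b j) (b j'))
        (Finsupp.single (c', h) 1)
      rw [alternating_swap kap (b i) (b j'), map_neg] at e
      have e' := congrArg (fun y => N (opWord b a y)) e
      simp only [LinearMap.add_apply, LinearMap.sub_apply, Module.End.mul_apply, map_add, map_sub,
        LinearMap.neg_apply, map_neg, LinearMap.zero_apply, map_zero] at e'
      rw [single_cons b, opWord_append, opWord_cons, opWord_nil, mul_one, Module.End.mul_apply,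
        ← sub_eq_zero, ← e']
      abel
  -- Disjoint descents: each order of the two exchanges gives the same word. The weights differ in
  -- the order of the letters of the other descent beside a correction term.
  | _ :: _ :: e, ht =>
    obtain ⟨rfl, rfl, rfl⟩ : i = _ ∧ j = _ ∧ c = e ++ i' :: j' :: c' := by simpa using ht
    have hn' : a.length + e.length + c'.length + 4 = n + 1 := by
      simpa [add_assoc, add_left_comm, add_comm] using hn
    refine ⟨a ++ j :: i :: e ++ j' :: i' :: c', _, _,
      Path.one ⟨a ++ j :: i :: e, i', j', c', hji', by simp, rfl, by simp; omega, rfl⟩,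
      Path.one ⟨a, i, j, e ++ j' :: i' :: c', hji, by simp, by simp, by simp; omega, rfl⟩, ?_⟩
    have e1 (w : List I) : Finsupp.single (e ++ w, h) (1 : k) =
        opWord b e (Finsupp.single (w, h) 1) := (opWord_single b e w h).symm
    rw [e1, e1, single_cons b, single_cons b, single_cons b, single_cons b,
      opVec_opVec b (lam := lam) (kap := kap)]
    simp only [opWord_append, opWord_cons, Module.End.mul_apply]
    rw [opVec_opVec b (lam := lam) (kap := kap) (b i) (b j)]
    simp only [map_add]
    -- A correction term next to a relation has length at most n, as the correction shortens the
    -- word by two; `N` kills such elements.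
    rw [hN (opWord b a (opGrp b lam _ (opWord b e (opRel b lam kap _ _ _)))),
      hN (opWord b a (opRel b lam kap _ _ _))]
    · abel
    · refine wordRel_mono b ?_ (opWord_mem_wordRel b (opRel_mem_wordRel b (opWord_mem_wordFil b
        (opGrp_mem_wordFil b lam (single_mem_wordFil h le_rfl) _) _) _ _) _)
      omega
    · refine wordRel_mono b ?_ (opWord_mem_wordRel b (H.opGrp_mem_wordRel b
        (opWord_mem_wordRel b (opRel_mem_wordRel b (single_mem_wordFil h le_rfl) _ _) _) _) _)
      omega

/-- The diamond lemma, by induction on the length n. On words of length at most n the map is the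
previous one. On words of length n + 1 it is the weighted normal form for the exchange of descents,
where the weight of an exchange is the previous map applied to the correction term of length n - 1.
-/
theorem Compatible.exists_reduction (H : Compatible lam kap) (n : ℕ) :
    ∃ N : Module.End k (Words k G I), (∀ y ∈ wordRel b lam kap n, N y = 0) ∧
      (∀ w h, w.length ≤ n → w.Pairwise (· ≤ ·) →
        N (Finsupp.single (w, h) 1) = Finsupp.single (w, h) 1) ∧
      ∀ w h, N (Finsupp.single (w, h) 1) ∈ wordFil k G I w.length := by
  induction n with
  | zero =>
    refine ⟨1, fun y hy => ?_, fun _ _ _ _ => rfl, fun w h => single_mem_wordFil h le_rfl⟩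
    have : wordRel b lam kap 0 ≤ ⊥ := by
      rw [wordRel, Submodule.span_le]
      rintro _ ⟨a, i, j, c, h, hl, -⟩
      omega
    exact (Submodule.mem_bot k).1 (this hy)
  | succ n ih =>
    obtain ⟨N, hN, hsort, hfil⟩ := ih
    have hfil' (m : ℕ) (y : Words k G I) (hy : y ∈ wordFil k G I m) : N y ∈ wordFil k G I m := by
      refine (Submodule.span_le (p := (wordFil k G I m).comap N)).2 ?_ hy
      rintro _ ⟨w, h, hw, rfl⟩
      exact wordFil_mono hw (hfil w h)
    have hconf (h : G) (x y z : List I) (m m' : Words k G I) (h1 : wordStep b lam kap n N h x y m)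
        (h2 : wordStep b lam kap n N h x z m') :
        ∃ d p q, Path (wordStep b lam kap n N h) y d p ∧ Path (wordStep b lam kap n N h) z d q ∧
          m + p = m' + q := by
      obtain ⟨a, i, j, c, hji, rfl, rfl, hn, rfl⟩ := h1
      obtain ⟨a', i', j', c', hji', hw, rfl, -, rfl⟩ := h2
      rcases le_total a.length a'.length with hle | hle
      · exact H.wordStep_confluent_of_le b hN hji hji' hw hn hle
      · obtain ⟨d, p, q, hp, hq, hpq⟩ :=
          H.wordStep_confluent_of_le b hN (h := h) hji' hji hw.symm (hw ▸ hn) hle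
        exact ⟨d, q, p, hq, hp, hpq.symm⟩
    -- The group element at the right end takes no part in the sorting, so each h is treated
    -- separately.
    choose F hF hF' hF'' using fun h => exists_weighted_normal_form (wordStep b lam kap n N h)
      inversions (by
        rintro _ _ _ ⟨a, i, j, c, hji, rfl, rfl, -⟩
        exact inversions_swap_lt a c hji) (hconf h)
      (fun w => if w.length = n + 1 then Finsupp.single (w, h) (1 : k) else 0)
    let N' : Module.End k (Words k G I) := Finsupp.linearCombination k fun p : List I × G =>
      if p.1.length ≤ n then N (Finsupp.single p 1) else F p.2 p.1
    have hN'low (w : List I) (h : G) (hw : w.length ≤ n) :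
        N' (Finsupp.single (w, h) 1) = N (Finsupp.single (w, h) 1) := by
      simp [N', hw]
    have hN'high (w : List I) (h : G) (hw : n < w.length) :
        N' (Finsupp.single (w, h) 1) = F h w := by
      simp [N', not_le.2 hw]
    have hN'fil (y : Words k G I) (hy : y ∈ wordFil k G I n) : N' y = N y := by
      refine LinearMap.eqOn_span ?_ hy
      rintro _ ⟨w, h, hw, rfl⟩
      exact hN'low w h hw
    refine ⟨N', fun y hy => ?_, fun w h hw hs => ?_, fun w h => ?_⟩
    · refine (Submodule.span_le (p := LinearMap.ker N')).2 ?_ hy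
      rintro _ ⟨a, i, j, c, h, hl, rfl⟩
      rw [SetLike.mem_coe, LinearMap.mem_ker]
      by_cases hl' : a.length + 2 + c.length ≤ n
      · have hm := opWord_mem_wordRel b (opRel_mem_wordRel (lam := lam) (kap := kap) b
          (single_mem_wordFil (k := k) h (le_refl c.length)) (b i) (b j)) a
        rw [hN'fil, hN]
        · exact wordRel_mono b (by omega) hm
        · rw [opRel]
          refine wordFil_mono hl' ?_
          have e (y) (hy : y ∈ wordFil k G I (2 + c.length)) := opWord_mem_wordFil b hy a
          refine wordFil_mono (by omega) (e _ (sub_mem (sub_mem ?_ ?_) ?_))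
          · exact wordFil_mono (by omega)
              (opVec_mem_wordFil b (opVec_mem_wordFil b (single_mem_wordFil h le_rfl) _) _)
          · exact wordFil_mono (by omega)
              (opVec_mem_wordFil b (opVec_mem_wordFil b (single_mem_wordFil h le_rfl) _) _)
          · exact wordFil_mono (by omega)
              (opGrp_mem_wordFil b lam (single_mem_wordFil h le_rfl) _)
      -- The relation has length exactly n + 1, and for a descent it expresses one step of the
      -- rewriting system.
      · have key (i j : I) (hji : j < i) :
            N' (opWord b a (opRel b lam kap (b i) (b j) (Finsupp.single (c, h) 1))) = 0 := by
          simp only [opRel, LinearMap.sub_apply, Module.End.mul_apply, ← single_cons, map_sub]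
          rw [opWord_single, opWord_single, hN'high _ _ (by simp; omega),
            hN'high _ _ (by simp; omega), hN'fil, hF h _ _ _ ⟨a, i, j, c, hji, rfl, rfl, ?_, rfl⟩]
          · abel
          · simp; omega
          · exact wordFil_mono (by omega) (opWord_mem_wordFil b
              (opGrp_mem_wordFil b lam (single_mem_wordFil h (le_refl c.length)) _) a)
        rcases lt_trichotomy j i with hji | rfl | hji
        · exact key i j hji
        -- For equal letters antisymmetry of κ would not suffice in characteristic two; κ is
        -- alternating.
        · have : opRel b lam kap (b j) (b j) = 0 := by
            have e := kap.map_eq_zero_of_eq ![b j, b j] (i := 0) (j := 1) rfl (by decide)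
            refine LinearMap.ext fun y => ?_
            simp [opRel, e]
          rw [this, LinearMap.zero_apply, map_zero, map_zero]
        · have : opRel b lam kap (b i) (b j) = - opRel b lam kap (b j) (b i) := by
            rw [opRel, opRel, alternating_swap kap (b i) (b j), map_neg]
            abel
          rw [this, LinearMap.neg_apply, map_neg, map_neg, key j i hji, neg_zero]
    · rcases Nat.lt_or_ge n w.length with hw' | hw'
      · rw [hN'high w h hw', hF' h w]
        · rw [if_pos (by omega)]
        · rintro _ _ ⟨a, i, j, c, hji, rfl, -⟩
          have := (List.pairwise_append.1 hs).2.1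
          have := (List.pairwise_cons.1 this).1 j (by simp)
          exact absurd hji (not_lt.2 this)
      · rw [hN'low w h hw', hsort w h hw' hs]
    · rcases Nat.lt_or_ge n w.length with hw' | hw'
      · rw [hN'high w h hw']
        refine wordFil_mono (m := n + 1) hw' (hF'' h (wordFil k G I (n + 1)).toAddSubgroup
          (fun u => ?_) ?_ w)
        · split_ifs with hu
          · exact single_mem_wordFil h hu.le
          · exact zero_mem _
        · rintro _ _ _ ⟨a, i, j, c, hji, rfl, rfl, hn, rfl⟩
          refine hfil' _ _ (wordFil_mono ?_ (opWord_mem_wordFil b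
            (opGrp_mem_wordFil b lam (single_mem_wordFil h (le_refl c.length)) _) a))
          simp at hn
          omega
      · rw [hN'low w h hw']
        exact hfil w h

end

noncomputable section

variable {k G V : Type*} [Field k] [Group G] [AddCommGroup V] [Module k V]
  [DistribMulAction G V] [SMulCommClass G k V]

/-! ### Generators of `H_{λ,κ}` and its universal property -/

section Hecke

variable (lam : MonoidAlgebra k G →ₗ[k] V →ₗ[k] MonoidAlgebra k G)
  (kap : V [⋀^Fin 2]→ₗ[k] MonoidAlgebra k G)

theorem heckeMk_rel {x y : FreeAlgebra k (V ⊕ G)} (h : HeckeRel lam kap x y) :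
    heckeMk lam kap x = heckeMk lam kap y := RingQuot.mkAlgHom_rel k h

/-- The map `V → H_{λ,κ}`. -/
def heckeVec : V →ₗ[k] Hecke lam kap where
  toFun v := heckeGen lam kap (.inl v)
  map_add' v w := by
    rw [heckeGen, heckeMk_rel lam kap (HeckeRel.vec_add v w), map_add]; rfl
  map_smul' c v := by
    rw [heckeGen, heckeMk_rel lam kap (HeckeRel.vec_smul c v), map_smul]; rfl

/-- The map `G → H_{λ,κ}`. -/
def heckeOf : G →* Hecke lam kap where
  toFun g := heckeGen lam kap (.inr g)
  map_one' := by rw [heckeGen, heckeMk_rel lam kap HeckeRel.grp_one, map_one]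
  map_mul' g h := by
    rw [heckeGen, heckeMk_rel lam kap (HeckeRel.grp_mul g h), map_mul]; rfl

/-- The map `kG → H_{λ,κ}`. -/
def heckeGrp : MonoidAlgebra k G →ₐ[k] Hecke lam kap :=
  MonoidAlgebra.lift k (Hecke lam kap) G (heckeOf lam kap)

theorem heckeGrp_of (g : G) : heckeGrp lam kap (MonoidAlgebra.of k G g) = heckeOf lam kap g := by
  simp [heckeGrp]

theorem freeGroupPart_eq : (freeGroupPart k : MonoidAlgebra k G →ₗ[k] FreeAlgebra k (V ⊕ G)) =
    groupLinear fun g => FreeAlgebra.ι k (Sum.inr g) := rfl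

theorem heckeMk_freeGroupPart (r : MonoidAlgebra k G) :
    heckeMk lam kap (freeGroupPart k r) = heckeGrp lam kap r := by
  suffices h : (heckeMk lam kap).toLinearMap ∘ₗ freeGroupPart k = (heckeGrp lam kap).toLinearMap from
    LinearMap.congr_fun h r
  refine groupAlgebra_linearMap_ext fun g => ?_
  rw [LinearMap.comp_apply, freeGroupPart_eq, groupLinear_of]
  exact (heckeGrp_of lam kap g).symm

theorem heckeVec_mul_heckeVec (v w : V) : heckeVec lam kap v * heckeVec lam kap w =
    heckeVec lam kap w * heckeVec lam kap v + heckeGrp lam kap (kap ![v, w]) := by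
  have h := heckeMk_rel lam kap (HeckeRel.comm v w)
  rw [heckeMk_freeGroupPart, map_sub, map_mul, map_mul] at h
  exact eq_add_of_sub_eq' h

theorem heckeOf_mul_heckeVec (g : G) (v : V) : heckeOf lam kap g * heckeVec lam kap v =
    heckeVec lam kap (g • v) * heckeOf lam kap g
      + heckeGrp lam kap (lam (MonoidAlgebra.of k G g) v) := by
  have h := heckeMk_rel lam kap (HeckeRel.cross g v)
  rw [heckeMk_freeGroupPart, map_sub, map_mul, map_mul] at h
  exact eq_add_of_sub_eq' h

theorem exists_hecke_lift {B : Type*} [Ring B] [Algebra k B] (f : V →ₗ[k] B)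
    (ρ : MonoidAlgebra k G →ₗ[k] B) (h1 : ρ (MonoidAlgebra.of k G 1) = 1)
    (hmul : ∀ g h, ρ (MonoidAlgebra.of k G (g * h)) =
      ρ (MonoidAlgebra.of k G g) * ρ (MonoidAlgebra.of k G h))
    (hcomm : ∀ v w, f v * f w - f w * f v = ρ (kap ![v, w]))
    (hcross : ∀ g v, ρ (MonoidAlgebra.of k G g) * f v - f (g • v) * ρ (MonoidAlgebra.of k G g) =
      ρ (lam (MonoidAlgebra.of k G g) v)) :
    ∃ F : Hecke lam kap →ₐ[k] B, (∀ v, F (heckeVec lam kap v) = f v) ∧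
      ∀ g, F (heckeOf lam kap g) = ρ (MonoidAlgebra.of k G g) := by
  let E : FreeAlgebra k (V ⊕ G) →ₐ[k] B :=
    FreeAlgebra.lift k (Sum.elim f fun g => ρ (MonoidAlgebra.of k G g))
  have hl (v : V) : E (FreeAlgebra.ι k (.inl v)) = f v := FreeAlgebra.lift_ι_apply _ _
  have hr (g : G) : E (FreeAlgebra.ι k (.inr g)) = ρ (MonoidAlgebra.of k G g) :=
    FreeAlgebra.lift_ι_apply _ _
  have hp (r : MonoidAlgebra k G) : E (freeGroupPart k r) = ρ r := by
    suffices h : E.toLinearMap ∘ₗ freeGroupPart k = ρ from LinearMap.congr_fun h r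
    refine groupAlgebra_linearMap_ext fun g => ?_
    rw [LinearMap.comp_apply, freeGroupPart_eq, groupLinear_of]
    exact hr g
  have hE : ∀ ⦃x y⦄, HeckeRel lam kap x y → E x = E y := by
    rintro _ _ (⟨v, w⟩ | ⟨c, v⟩ | _ | ⟨g, h⟩ | ⟨v, w⟩ | ⟨g, v⟩)
    · rw [map_add, hl, hl, hl, map_add]
    · rw [map_smul, hl, hl, map_smul]
    · rw [hr, h1, map_one]
    · rw [map_mul, hr, hr, hr, hmul]
    · rw [map_sub, map_mul, map_mul, hl, hl, hp, hcomm]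
    · rw [map_sub, map_mul, map_mul, hl, hl, hr, hp, hcross]
  refine ⟨RingQuot.liftAlgHom k ⟨E, hE⟩, fun v => ?_, fun g => ?_⟩
  · exact (RingQuot.liftAlgHom_mkAlgHom_apply k E hE _).trans (hl v)
  · exact (RingQuot.liftAlgHom_mkAlgHom_apply k E hE _).trans (hr g)

theorem hecke_list_induction {P : List (V ⊕ G) → Prop} (nil : P [])
    (vec : ∀ v l, P l → P (.inl v :: l)) (grp : ∀ g l, P l → P (.inr g :: l)) : ∀ l, P l
  | [] => nil
  | .inl v :: l => vec v l (hecke_list_induction nil vec grp l)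
  | .inr g :: l => grp g l (hecke_list_induction nil vec grp l)

theorem heckeVec_mem (v : V) : heckeVec lam kap v ∈ heckeFil lam kap 1 :=
  Submodule.subset_span ⟨[.inl v], by simp, by simp; rfl⟩

theorem heckeOf_mem (g : G) : heckeOf lam kap g ∈ heckeFil lam kap 0 :=
  Submodule.subset_span ⟨[.inr g], by simp, by simp; rfl⟩

theorem heckeGrp_mem (r : MonoidAlgebra k G) : heckeGrp lam kap r ∈ heckeFil lam kap 0 :=
  mem_comap_of_group (heckeGrp lam kap).toLinearMap _
    (fun g => by
      rw [AlgHom.toLinearMap_apply, heckeGrp_of]; exact heckeOf_mem lam kap g) r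

end Hecke

/-! ### The action of `H_{λ,κ}` on words -/

section Action

variable {I : Type*} (b : Module.Basis I k V)
  (lam : MonoidAlgebra k G →ₗ[k] V →ₗ[k] MonoidAlgebra k G)
  (kap : V [⋀^Fin 2]→ₗ[k] MonoidAlgebra k G)

/-- The span of all relations between words. -/
def wordRelSup : Submodule k (Words k G I) := ⨆ n, wordRel b lam kap n

variable {lam kap}

theorem mem_wordRelSup {y : Words k G I} :
    y ∈ wordRelSup b lam kap ↔ ∃ n, y ∈ wordRel b lam kap n :=
  Submodule.mem_iSup_of_directed _ (monotone_nat_of_le_succ fun n =>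
    wordRel_mono b (Nat.le_succ n)).directed_le

theorem words_hom_ext {P : Type*} [AddCommMonoid P] [Module k P] {f f' : Words k G I →ₗ[k] P}
    (h : ∀ w h, f (Finsupp.single (w, h) 1) = f' (Finsupp.single (w, h) 1)) : f = f' :=
  Finsupp.lhom_ext' fun p => LinearMap.ext_ring (h p.1 p.2)

theorem Compatible.opGrp_one (H : Compatible lam kap) :
    opGrp (I := I) b lam (MonoidAlgebra.of k G 1) = 1 := by
  refine words_end_ext fun w h => ?_
  rw [Module.End.one_apply]
  induction w with
  | nil => rw [opGrp_single, actWord, groupLinear_of, one_mul]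
  | cons i w ih =>
    have e := LinearMap.congr_fun (opGrp_mul_opVec b lam 1 (b i)) (Finsupp.single (w, h) 1)
    rw [H.lam_one, map_zero, one_smul, LinearMap.add_apply, Module.End.mul_apply,
      Module.End.mul_apply, ih, LinearMap.zero_apply, add_zero, opVec_basis, consWord_single] at e
    exact e

/-- The quotient by all relations is needed only for vw - wv = κ(v,w). The relations of kG and the
cross relation hold already on words, and both kinds of operators preserve the span of the
relations. -/
theorem Compatible.exists_hecke_action (H : Compatible lam kap) :
    ∃ F : Hecke lam kap →ₐ[k] Module.End k (Words k G I ⧸ wordRelSup b lam kap),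
      (∀ v y, F (heckeVec lam kap v) ((wordRelSup b lam kap).mkQ y) =
        (wordRelSup b lam kap).mkQ (opVec b v y)) ∧
      ∀ g y, F (heckeOf lam kap g) ((wordRelSup b lam kap).mkQ y) =
        (wordRelSup b lam kap).mkQ (opGrp b lam (MonoidAlgebra.of k G g) y) := by
  set S := wordRelSup b lam kap with hS
  have hv (v : V) : S ≤ S.comap (opVec b v) := fun y hy => by
    obtain ⟨n, hn⟩ := (mem_wordRelSup b).1 hy
    exact (mem_wordRelSup b).2 ⟨_, opVec_mem_wordRel b hn v⟩
  have hr (r : MonoidAlgebra k G) : S ≤ S.comap (opGrp b lam r) := fun y hy => by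
    obtain ⟨n, hn⟩ := (mem_wordRelSup b).1 hy
    exact (mem_wordRelSup b).2 ⟨_, H.opGrp_mem_wordRel b hn r⟩
  let f : V →ₗ[k] Module.End k (Words k G I ⧸ S) :=
    { toFun := fun v => S.mapQ S (opVec b v) (hv v)
      map_add' := fun v w => Submodule.linearMap_qext _ (LinearMap.ext fun y => by simp)
      map_smul' := fun c v => Submodule.linearMap_qext _ (LinearMap.ext fun y => by simp) }
  let ρ : MonoidAlgebra k G →ₗ[k] Module.End k (Words k G I ⧸ S) :=
    { toFun := fun r => S.mapQ S (opGrp b lam r) (hr r)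
      map_add' := fun v w => Submodule.linearMap_qext _ (LinearMap.ext fun y => by simp)
      map_smul' := fun c v => Submodule.linearMap_qext _ (LinearMap.ext fun y => by simp) }
  have hfa (v y) : f v (S.mkQ y) = S.mkQ (opVec b v y) := rfl
  have hρa (v y) : ρ v (S.mkQ y) = S.mkQ (opGrp b lam v y) := rfl
  obtain ⟨F, hF, hF'⟩ := exists_hecke_lift lam kap f ρ
    (Submodule.linearMap_qext _ (LinearMap.ext fun y => by
      rw [LinearMap.comp_apply, hρa, H.opGrp_one]; rfl))
    (fun g h => Submodule.linearMap_qext _ (LinearMap.ext fun y => by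
      rw [LinearMap.comp_apply, LinearMap.comp_apply, Module.End.mul_apply, hρa, hρa, hρa, map_mul,
        H.opGrp_mul]
      rfl))
    (fun v w => Submodule.linearMap_qext _ (words_hom_ext fun u h => by
      have e := (mem_wordRelSup b).2 ⟨_, opRel_mem_wordRel (lam := lam) (kap := kap) b
        (single_mem_wordFil (k := k) h (le_refl u.length)) v w⟩
      have e' := (Submodule.Quotient.mk_eq_zero _).2 e
      rw [← Submodule.mkQ_apply, opRel] at e'
      simp only [LinearMap.sub_apply, Module.End.mul_apply, map_sub] at e'
      rw [LinearMap.comp_apply, LinearMap.comp_apply, LinearMap.sub_apply, Module.End.mul_apply,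
        Module.End.mul_apply, hfa, hfa, hfa, hfa, hρa]
      exact sub_eq_zero.1 e'))
    (fun g v => Submodule.linearMap_qext _ (LinearMap.ext fun y => by
      have e := LinearMap.congr_fun (opGrp_mul_opVec b lam g v) y
      rw [LinearMap.add_apply, Module.End.mul_apply, Module.End.mul_apply] at e
      rw [LinearMap.comp_apply, LinearMap.comp_apply, LinearMap.sub_apply, Module.End.mul_apply,
        Module.End.mul_apply, hfa, hρa, hρa, hρa, hfa, ← map_sub]
      exact congrArg _ (sub_eq_of_eq_add' e)))
  exact ⟨F, fun v y => by rw [hF, hfa], fun g y => by rw [hF', hρa]⟩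

variable (lam kap) in
/-- The element of `H_{λ,κ}` defined by a combination of words. -/
def heckeWord : Words k G I →ₗ[k] Hecke lam kap :=
  Finsupp.linearCombination k fun p : List I × G =>
    (p.1.map fun i => heckeVec lam kap (b i)).prod * heckeOf lam kap p.2

theorem heckeWord_single (w : List I) (h : G) :
    heckeWord b lam kap (Finsupp.single (w, h) 1) =
      (w.map fun i => heckeVec lam kap (b i)).prod * heckeOf lam kap h := by
  simp [heckeWord]

/-- Combinations of sorted words of length `n`. -/
def sortedWords (k G I : Type*) [Field k] [LinearOrder I] (n : ℕ) : Submodule k (Words k G I) :=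
  Finsupp.supported k k {p | p.1.length = n ∧ p.1.Pairwise (· ≤ ·)}

theorem wordFil_apply_eq_zero {n : ℕ} {y : Words k G I} (hy : y ∈ wordFil k G I n) {w : List I}
    (h : G) (hw : n < w.length) : y (w, h) = 0 := by
  classical
  refine (Submodule.span_le (p := LinearMap.ker (Finsupp.lapply (w, h)))).2 ?_ hy
  rintro _ ⟨u, l, hu, rfl⟩
  rw [SetLike.mem_coe, LinearMap.mem_ker, Finsupp.lapply_apply, Finsupp.single_apply, if_neg]
  rintro e
  rw [← (Prod.mk.inj e).1] at hw
  omega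

/-- The linear independence behind PBW. Acting on the class of the empty word recovers a combination
of words from its image in H, up to relations. If the image has lower filtration, then y is
congruent to a combination z of shorter words; the reduction fixes y and keeps z short, so y = 0. -/
theorem Compatible.eq_zero_of_heckeWord_mem [LinearOrder I] (H : Compatible lam kap) {n : ℕ}
    {y : Words k G I} (hy : y ∈ sortedWords k G I n)
    (h : heckeWord b lam kap y ∈ ⨆ m : Fin n, heckeFil lam kap m) : y = 0 := by
  set S := wordRelSup b lam kap
  obtain ⟨F, hv, hg⟩ : ∃ F : Hecke lam kap →ₐ[k] Module.End k (Words k G I ⧸ S),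
      (∀ v y, F (heckeVec lam kap v) (S.mkQ y) = S.mkQ (opVec b v y)) ∧
      ∀ g y, F (heckeOf lam kap g) (S.mkQ y) =
        S.mkQ (opGrp b lam (MonoidAlgebra.of k G g) y) := H.exists_hecke_action b
  let Φ : Hecke lam kap →ₗ[k] Words k G I ⧸ S :=
    LinearMap.applyₗ (S.mkQ (Finsupp.single ([], 1) 1)) ∘ₗ F.toLinearMap
  have hΦ : Φ ∘ₗ heckeWord b lam kap = S.mkQ := words_hom_ext fun w h => by
    change F (heckeWord b lam kap (Finsupp.single (w, h) 1)) (S.mkQ (Finsupp.single ([], 1) 1)) = _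
    rw [heckeWord_single, map_mul, Module.End.mul_apply, hg, opGrp_single, actWord,
      groupLinear_of, mul_one]
    induction w with
    | nil => rw [List.map_nil, List.prod_nil, map_one]; rfl
    | cons i w ih =>
      rw [List.map_cons, List.prod_cons, map_mul, Module.End.mul_apply, ih, hv, opVec_basis,
        consWord_single]
  -- Vectors lengthen words by at most one letter and group elements do not lengthen them, so the
  -- action respects the filtrations.
  have hfil (m : ℕ) : (heckeFil lam kap m).map Φ ≤ (wordFil k G I m).map S.mkQ := by
    rw [heckeFil, Submodule.map_span_le]
    rintro _ ⟨l, hl, rfl⟩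
    refine Submodule.map_mono (wordFil_mono hl) ?_
    clear hl
    induction l using hecke_list_induction with
    | nil => exact ⟨_, single_mem_wordFil (w := []) 1 (by simp), by simp [Φ]⟩
    | vec v l ih =>
      obtain ⟨z, hz, e⟩ := ih
      refine ⟨opVec b v z, wordFil_mono (by simp [List.countP_cons]) (opVec_mem_wordFil b hz v), ?_⟩
      rw [← hv, e]
      change _ = F _ _
      rw [List.map_cons, List.prod_cons, map_mul]
      rfl
    | grp g l ih =>
      obtain ⟨z, hz, e⟩ := ih
      refine ⟨_, wordFil_mono (by simp) (opGrp_mem_wordFil b lam hz (MonoidAlgebra.of k G g)), ?_⟩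
      rw [← hg, e]
      change _ = F _ _
      rw [List.map_cons, List.prod_cons, map_mul]
      rfl
  have hle : (⨆ m : Fin n, heckeFil lam kap m).map Φ ≤
      (⨆ m : Fin n, wordFil k G I m).map S.mkQ := by
    rw [Submodule.map_iSup, Submodule.map_iSup]
    exact iSup_mono fun m => hfil m
  obtain ⟨z, hz, e⟩ := hle ⟨_, h, rfl⟩
  rw [← LinearMap.comp_apply, hΦ, Submodule.mkQ_apply, Submodule.mkQ_apply,
    Submodule.Quotient.eq] at e
  -- A single element involves relations of bounded length only, so one of the reductions
  -- constructed by induction is enough; its bound must also reach n, to fix y.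
  obtain ⟨N, hN⟩ := (mem_wordRelSup b).1 e
  obtain ⟨R, hR, hs, hf⟩ := H.exists_reduction b (max N n)
  have hRy : R y = y := by
    conv_rhs => rw [← Finsupp.sum_single y]
    conv_lhs => rw [← Finsupp.sum_single y]
    rw [Finsupp.sum, map_sum]
    refine Finset.sum_congr rfl fun p hp => ?_
    obtain ⟨h1, h2⟩ := hy hp
    rw [← mul_one (y p), ← smul_eq_mul, ← Finsupp.smul_single, map_smul, hs p.1 p.2 _ h2]
    exact h1.le.trans (le_max_right _ _)
  have hRz : R z ∈ ⨆ m : Fin n, wordFil k G I m := by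
    refine (iSup_le fun m => ?_ : _ ≤ (⨆ m : Fin n, wordFil k G I m).comap R) hz
    rw [wordFil, Submodule.span_le]
    rintro _ ⟨w, l, hw, rfl⟩
    exact Submodule.mem_iSup_of_mem m (wordFil_mono hw (hf w l))
  have hyz : y = R z := by
    have := hR _ (wordRel_mono b (le_max_left _ _) hN)
    rw [map_sub, sub_eq_zero] at this
    rw [this, hRy]
  ext p
  rw [Finsupp.zero_apply]
  by_contra hp
  obtain ⟨h1, -⟩ := hy (Finsupp.mem_support_iff.2 hp)
  refine hp ?_
  rw [hyz]
  refine (iSup_le fun m => ?_ : _ ≤ LinearMap.ker (Finsupp.lapply (R := k) p)) hRz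
  intro u hu
  exact wordFil_apply_eq_zero hu p.2 (h1 ▸ m.2)

end Action

end

noncomputable section

variable {k G V : Type*} [Field k] [Group G] [AddCommGroup V] [Module k V]
  [DistribMulAction G V] [SMulCommClass G k V]

/-! ### The associated graded algebra as a quotient of `S(V) # G` -/

section Graded

variable {k R : Type*} [Field k] [Ring R] [Algebra k R] (F : ℕ → Submodule k R)

theorem grMk_eq_iff {n : ℕ} (x y : F n) :
    Gr.mk F n x = Gr.mk F n y ↔ x.1 - y.1 ∈ ⨆ m : Fin n, F m :=
  Submodule.Quotient.eq _

theorem grMk_eq_zero_iff {n : ℕ} (x : F n) : Gr.mk F n x = 0 ↔ x.1 ∈ ⨆ m : Fin n, F m :=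
  Submodule.Quotient.mk_eq_zero _

variable [SetLike.GradedMonoid F]

theorem of_grMk_mul {m n : ℕ} (x : F m) (y : F n) :
    DirectSum.of (Gr F) m (Gr.mk F m x) * DirectSum.of (Gr F) n (Gr.mk F n y) =
      DirectSum.of (Gr F) (m + n) (Gr.mk F (m + n) ⟨x.1 * y.1, SetLike.mul_mem_graded x.2 y.2⟩) :=
  DirectSum.of_mul_of _ _

theorem of_grMk_eq {m n : ℕ} (h : m = n) (x : F m) (y : F n) (hxy : x.1 = y.1) :
    DirectSum.of (Gr F) m (Gr.mk F m x) = DirectSum.of (Gr F) n (Gr.mk F n y) :=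
  DirectSum.of_eq_of_gradedMonoid_eq (gradedMonoid_mk_eq F h x y hxy)

end Graded

/-- The generators of `S(V) # G`. -/
def skewGen : V ⊕ G → Skew k G V := Sum.elim (vec k G) (grp k V)

variable (lam : MonoidAlgebra k G →ₗ[k] V →ₗ[k] MonoidAlgebra k G)
  (kap : V [⋀^Fin 2]→ₗ[k] MonoidAlgebra k G)

theorem heckeList_mem (l : List (V ⊕ G)) :
    (l.map (heckeGen lam kap)).prod ∈ heckeFil lam kap (l.countP Sum.isLeft) :=
  Submodule.subset_span ⟨l, le_rfl, rfl⟩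

/-- The right-hand sides κ(v,w) and λ(g,v) have filtration zero and so disappear in degrees two and
one of the associated graded algebra, where the relations of A therefore hold. No condition on λ and
κ is needed. -/
theorem exists_graded_map : ∃ Θ : Skew k G V →ₐ[k] ⨁ n, Gr (heckeFil lam kap) n,
    ∀ l : List (V ⊕ G), Θ (l.map skewGen).prod = DirectSum.of (Gr (heckeFil lam kap)) _
      (Gr.mk (heckeFil lam kap) _ ⟨_, heckeList_mem lam kap l⟩) := by
  set F := heckeFil lam kap
  let f : V →ₗ[k] ⨁ n, Gr F n := DirectSum.lof k ℕ (Gr F) 1 ∘ₗ Gr.mk F 1 ∘ₗ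
    (heckeVec lam kap).codRestrict (F 1) (heckeVec_mem lam kap)
  have hf (v : V) : f v = DirectSum.of (Gr F) 1 (Gr.mk F 1 ⟨_, heckeVec_mem lam kap v⟩) := rfl
  let ρ : G →* ⨁ n, Gr F n :=
    { toFun := fun g => DirectSum.of (Gr F) 0 (Gr.mk F 0 ⟨_, heckeOf_mem lam kap g⟩)
      map_one' := of_grMk_eq F rfl _ ⟨1, SetLike.one_mem_graded F⟩ (map_one (heckeOf lam kap))
      map_mul' := fun g h => by
        rw [of_grMk_mul]
        exact of_grMk_eq F rfl _ _ (map_mul (heckeOf lam kap) g h) }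
  have hρ (g : G) : ρ g = DirectSum.of (Gr F) 0 (Gr.mk F 0 ⟨_, heckeOf_mem lam kap g⟩) := rfl
  have hlow {n : ℕ} (hn : 0 < n) (r : MonoidAlgebra k G) :
      heckeGrp lam kap r ∈ ⨆ m : Fin n, F m :=
    Submodule.mem_iSup_of_mem (p := fun m : Fin n => F m) ⟨0, hn⟩ (heckeGrp_mem lam kap r)
  obtain ⟨Θ, hv, hg⟩ := exists_skew_lift (k := k) (G := G) (V := V) (B := ⨁ n, Gr F n) f ρ
    (fun v w => by
      rw [hf, hf, of_grMk_mul, of_grMk_mul]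
      congr 1
      rw [grMk_eq_iff]
      change heckeVec lam kap v * heckeVec lam kap w - heckeVec lam kap w * heckeVec lam kap v ∈ _
      rw [heckeVec_mul_heckeVec, add_sub_cancel_left]
      exact hlow (by norm_num) _)
    (fun g v => by
      rw [hf, hf, hρ, of_grMk_mul, of_grMk_mul]
      -- The two products lie in degrees 0 + 1 and 1 + 0, which must be identified before the
      -- representatives can be subtracted.
      refine Eq.trans (of_grMk_eq F (n := 1 + 0) rfl _
        ⟨heckeOf lam kap g * heckeVec lam kap v, ?_⟩ rfl) (congrArg _ ?_)
      · exact SetLike.mul_mem_graded (A := F) (i := 0) (j := 1)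
          (heckeOf_mem lam kap g) (heckeVec_mem lam kap v)
      rw [grMk_eq_iff]
      change heckeOf lam kap g * heckeVec lam kap v -
        heckeVec lam kap (g • v) * heckeOf lam kap g ∈ _
      rw [heckeOf_mul_heckeVec, add_sub_cancel_left]
      exact hlow (by norm_num) _)
  refine ⟨Θ, fun l => ?_⟩
  induction l using hecke_list_induction with
  | nil =>
    rw [List.map_nil, List.prod_nil, map_one]
    rfl
  | vec v l ih =>
    rw [List.map_cons, List.prod_cons, map_mul, ih]
    change Θ (vec k G v) * _ = _
    rw [hv, hf, of_grMk_mul]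
    exact of_grMk_eq F (by simp [List.countP_cons, add_comm]) _ _ rfl
  | grp g l ih =>
    rw [List.map_cons, List.prod_cons, map_mul, ih]
    change Θ (grp k V g) * _ = _
    rw [hg, hρ, of_grMk_mul]
    exact of_grMk_eq F (by simp [List.countP_cons]) _ _ rfl

theorem skewList_mem (l : List (V ⊕ G)) :
    (l.map (skewGen (k := k))).prod ∈ skewDeg k G V (l.countP Sum.isLeft) := by
  induction l using hecke_list_induction with
  | nil => simpa using one_mem_skewDeg
  | vec v l ih =>
    rw [List.map_cons, List.prod_cons, List.countP_cons_of_pos rfl, add_comm]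
    exact mul_mem_skewDeg (vec_mem_skewDeg v) ih
  | grp g l ih =>
    rw [List.map_cons, List.prod_cons, List.countP_cons_of_neg (by simp)]
    have := mul_mem_skewDeg (grp_mem_skewDeg (k := k) (V := V) g) ih
    rwa [zero_add] at this

/-- A word in the generators with exactly n vectors is the image of the same word in A, and one with
fewer vectors is zero in degree n. This gives surjectivity together with the grading of the inverse.
-/
theorem exists_mem_skewDeg_of_graded {Θ : Skew k G V →ₐ[k] ⨁ n, Gr (heckeFil lam kap) n}
    (hΘ : ∀ l : List (V ⊕ G), Θ (l.map skewGen).prod = DirectSum.of (Gr (heckeFil lam kap)) _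
      (Gr.mk (heckeFil lam kap) _ ⟨_, heckeList_mem lam kap l⟩))
    (n : ℕ) (x : Gr (heckeFil lam kap) n) :
    ∃ a ∈ skewDeg k G V n, Θ a = DirectSum.of (Gr (heckeFil lam kap)) n x := by
  let F := heckeFil lam kap
  obtain ⟨x, rfl⟩ := Submodule.mkQ_surjective _ x
  suffices h : ∀ y ∈ F n, ∀ hy : y ∈ F n, ∃ a ∈ skewDeg k G V n,
      Θ a = DirectSum.of (Gr F) n (Gr.mk F n ⟨y, hy⟩) from h x.1 x.2 x.2
  intro y hy
  induction hy using Submodule.span_induction with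
  | mem y h =>
    obtain ⟨l, hl, rfl⟩ := h
    intro hy
    rcases hl.eq_or_lt with rfl | hl
    · exact ⟨_, skewList_mem l, hΘ l⟩
    · refine ⟨0, zero_mem _, ?_⟩
      rw [map_zero, (grMk_eq_zero_iff F _).2, map_zero]
      exact Submodule.mem_iSup_of_mem (p := fun m : Fin n => F m) ⟨_, hl⟩ (heckeList_mem lam kap l)
  | zero =>
    intro hy
    refine ⟨0, zero_mem _, ?_⟩
    rw [map_zero, (grMk_eq_zero_iff F _).2 (zero_mem _), map_zero]
  | add y z hy hz ihy ihz =>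
    intro h
    obtain ⟨a, ha, ea⟩ := ihy hy
    obtain ⟨c, hc, ec⟩ := ihz hz
    refine ⟨a + c, add_mem ha hc, ?_⟩
    rw [map_add, ea, ec, ← map_add, ← map_add]
    rfl
  | smul c y hy ih =>
    intro h
    obtain ⟨a, ha, ea⟩ := ih hy
    refine ⟨c • a, Submodule.smul_mem _ c ha, ?_⟩
    rw [map_smul, ea]
    exact (map_smul (DirectSum.lof k ℕ (Gr F) n ∘ₗ Gr.mk F n) c _).symm

/-! ### Sorted words span `S(V) # G` -/

section Sorted

variable {I : Type*} [LinearOrder I] (b : Module.Basis I k V)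

/-- The element of `S(V) # G` defined by a combination of words. -/
def skewWord : Words k G I →ₗ[k] Skew k G V :=
  Finsupp.linearCombination k fun p : List I × G => mono (p.1.map b) p.2

theorem skewWord_single (w : List I) (h : G) :
    skewWord b (Finsupp.single (w, h) 1) = mono (w.map b) h := by simp [skewWord]

theorem skewWord_opVec (v : V) (y : Words k G I) :
    skewWord b (opVec b v y) = vec k G v * skewWord b y := by
  suffices h : (opVec b).compr₂ (skewWord b) =
      (LinearMap.mul k (Skew k G V)).compl₁₂ (vec k G) (skewWord b) from LinearMap.congr_fun₂ h v y
  refine b.ext fun i => words_hom_ext fun w h => ?_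
  change skewWord b (opVec b (b i) _) = vec k G (b i) * skewWord b _
  rw [opVec_basis, consWord_single, skewWord_single, skewWord_single, List.map_cons, mono_cons]

/-- Vectors commute in S(V), so sorting the letters of a word does not change its value in A. -/
theorem skewWord_surjective (a : Skew k G V) : ∃ y : Words k G I,
    (∀ p ∈ y.support, p.1.Pairwise (· ≤ ·)) ∧ skewWord b y = a := by
  have h1 : LinearMap.range (skewWord (k := k) (G := G) b) = ⊤ := by
    rw [← top_le_iff, ← span_mono_eq_top, Submodule.span_le]
    rintro _ ⟨⟨l, g⟩, rfl⟩
    change mono l g ∈ LinearMap.range (skewWord b)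
    induction l with
    | nil => exact ⟨Finsupp.single ([], g) 1, skewWord_single b [] g⟩
    | cons v l ih =>
      obtain ⟨y, hy⟩ := ih
      exact ⟨opVec b v y, by rw [skewWord_opVec, hy, mono_cons]⟩
  have h2 : LinearMap.range (skewWord (k := k) (G := G) b) ≤
      (Finsupp.supported k k {p : List I × G | p.1.Pairwise (· ≤ ·)}).map (skewWord b) := by
    rintro _ ⟨y, rfl⟩
    induction y using Finsupp.induction_linear with
    | zero => rw [map_zero]; exact zero_mem _
    | add y z hy hz => rw [map_add]; exact add_mem hy hz
    | single p c =>
      rw [← mul_one c, ← smul_eq_mul, ← Finsupp.smul_single, map_smul]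
      refine Submodule.smul_mem _ c ⟨Finsupp.single (p.1.insertionSort (· ≤ ·), p.2) 1, ?_, ?_⟩
      · exact Finsupp.single_mem_supported k _ (List.pairwise_insertionSort _ _)
      · rw [skewWord_single, mono_eq_single, skewWord_single, mono_eq_single]
        congr 1
        exact (((List.perm_insertionSort (· ≤ ·) p.1).map b).map _).prod_eq
  obtain ⟨y, hy, e⟩ := h2 (h1 ▸ Submodule.mem_top : a ∈ _)
  exact ⟨y, fun p hp => hy hp, e⟩

variable {lam kap}

theorem heckeWord_single_mem (w : List I) (h : G) :
    heckeWord b lam kap (Finsupp.single (w, h) 1) ∈ heckeFil lam kap w.length := by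
  rw [heckeWord_single]
  refine Submodule.subset_span ⟨w.map (fun i => .inl (b i)) ++ [.inr h], ?_, ?_⟩
  · simp [List.countP_append, List.countP_map, Function.comp_def]
  · rw [List.map_append, List.prod_append, List.map_map]
    simp
    rfl

/-- Because the map from A is graded, each component sees only the words of one length. This is the
link between its kernel and the independence of sorted words in H. -/
theorem graded_component {Θ : Skew k G V →ₐ[k] ⨁ n, Gr (heckeFil lam kap) n}
    (hΘ : ∀ l : List (V ⊕ G), Θ (l.map skewGen).prod = DirectSum.of (Gr (heckeFil lam kap)) _
      (Gr.mk (heckeFil lam kap) _ ⟨_, heckeList_mem lam kap l⟩)) (n : ℕ) (y : Words k G I) :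
    ∃ hy : heckeWord b lam kap (y.filter fun p => p.1.length = n) ∈ heckeFil lam kap n,
      (Θ (skewWord b y)) n = Gr.mk (heckeFil lam kap) n ⟨_, hy⟩ := by
  classical
  let F := heckeFil lam kap
  have hmem (p : List I × G) (hp : p.1.length = n) :
      heckeWord b lam kap (Finsupp.single p 1) ∈ F n := hp ▸ heckeWord_single_mem b p.1 p.2
  -- Words of another length are sent to zero, so T selects the part of length n inside F_n.
  let T : Words k G I →ₗ[k] F n := Finsupp.linearCombination k fun p =>
    if hp : p.1.length = n then ⟨_, hmem p hp⟩ else 0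
  have hT : (F n).subtype (T y) = heckeWord b lam kap (y.filter fun p => p.1.length = n) := by
    induction y using Finsupp.induction_linear with
    | zero => rw [Finsupp.filter_zero, map_zero, map_zero, map_zero]
    | add y z hy hz => rw [Finsupp.filter_add, map_add, map_add, map_add, hy, hz]
    | single p c =>
      by_cases hp : p.1.length = n
      · rw [Finsupp.filter_single_of_pos (fun p : List I × G => p.1.length = n) hp,
          Finsupp.linearCombination_single, dif_pos hp,
          map_smul, Submodule.subtype_apply, ← map_smul, Finsupp.smul_single, smul_eq_mul, mul_one]
      · rw [Finsupp.filter_single_of_neg (fun p : List I × G => p.1.length = n) hp,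
          Finsupp.linearCombination_single, dif_neg hp,
          smul_zero, map_zero, map_zero]
  have key : DirectSum.component k ℕ (Gr F) n ∘ₗ Θ.toLinearMap ∘ₗ skewWord b = Gr.mk F n ∘ₗ T := by
    refine words_hom_ext fun w h => ?_
    have e1 : skewWord b (Finsupp.single (w, h) (1 : k)) =
        ((w.map (fun i => Sum.inl (b i)) ++ [Sum.inr h]).map (skewGen (k := k))).prod := by
      rw [skewWord_single, mono, List.map_append, List.prod_append, List.map_map, List.map_map]
      simp
      rfl
    have e2 : Θ (skewWord b (Finsupp.single (w, h) (1 : k))) =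
        DirectSum.of (Gr F) w.length (Gr.mk F _ ⟨_, heckeWord_single_mem b w h⟩) := by
      rw [e1, hΘ]
      refine of_grMk_eq F ?_ _ _ ?_
      · simp [List.countP_append, List.countP_map, Function.comp_def]
      · refine Eq.trans ?_ (heckeWord_single b w h).symm
        simp only [List.map_append, List.prod_append, List.map_map]
        simp
        rfl
    change DirectSum.component k ℕ (Gr F) n (Θ (skewWord b (Finsupp.single (w, h) (1 : k)))) =
      Gr.mk F n (T (Finsupp.single (w, h) 1))
    rw [e2, Finsupp.linearCombination_single, one_smul]
    by_cases hw : w.length = n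
    · subst hw
      rw [dif_pos rfl]
      exact DirectSum.component.lof_self k _ _
    · rw [dif_neg hw, map_zero]
      exact (DirectSum.component.of k _ _ _).trans (dif_neg hw)
  refine ⟨hT ▸ (T y).2, (LinearMap.congr_fun key y).trans ?_⟩
  exact congrArg (Gr.mk F n) (Subtype.ext hT)

/-- The graded map from A is surjective for every λ and κ. An element of its kernel is written with
sorted words; the part of each length has an image of lower filtration in H and hence is zero. -/
theorem hasPBW_of_basis {I : Type*} [LinearOrder I] (b : Module.Basis I k V)
    (H : Compatible lam kap) : HasPBW lam kap := by
  classical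
  obtain ⟨Θ, hΘ⟩ := exists_graded_map lam kap
  have hgr := exists_mem_skewDeg_of_graded lam kap hΘ
  have hsurj : Function.Surjective Θ := by
    intro x
    induction x using DirectSum.induction_on with
    | zero => exact ⟨0, map_zero Θ⟩
    | of n x => exact (hgr n x).imp fun _ h => h.2
    | add x y hx hy =>
      obtain ⟨a, rfl⟩ := hx
      obtain ⟨c, rfl⟩ := hy
      exact ⟨a + c, map_add Θ a c⟩
  have hinj : Function.Injective Θ := by
    refine (injective_iff_map_eq_zero Θ).2 fun a ha => ?_
    obtain ⟨y, hy, rfl⟩ := skewWord_surjective b a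
    suffices h : y = 0 by rw [h, map_zero]
    ext p
    have h0 : y.filter (fun q => q.1.length = p.1.length) = 0 := by
      refine H.eq_zero_of_heckeWord_mem b (n := p.1.length) ?_ ?_
      · intro q hq
        rw [Finset.mem_coe, Finsupp.support_filter, Finset.mem_filter] at hq
        exact ⟨hq.2, hy q hq.1⟩
      · obtain ⟨h, e⟩ := graded_component b hΘ p.1.length y
        rw [ha] at e
        exact (grMk_eq_zero_iff _ _).1 e.symm
    have := DFunLike.congr_fun h0 p
    rwa [Finsupp.filter_apply_pos (fun q : List I × G => q.1.length = p.1.length) _ rfl] at this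
  refine ⟨(AlgEquiv.ofBijective Θ ⟨hinj, hsurj⟩).symm, fun n x => ?_⟩
  obtain ⟨a, ha, e⟩ := hgr n x
  rw [← e]
  convert ha
  exact (AlgEquiv.ofBijective Θ ⟨hinj, hsurj⟩).symm_apply_apply a

end Sorted

theorem Compatible.hasPBW {lam : MonoidAlgebra k G →ₗ[k] V →ₗ[k] MonoidAlgebra k G}
    {kap : V [⋀^Fin 2]→ₗ[k] MonoidAlgebra k G} (H : Compatible lam kap) : HasPBW lam kap := by
  classical
  -- Any linear order of the basis serves, so V may have infinite dimension here.
  let _ : LinearOrder (Module.Basis.ofVectorSpaceIndex k V) := linearOrderOfSTO WellOrderingRel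
  exact hasPBW_of_basis (Module.Basis.ofVectorSpace k V) H

end

noncomputable section

variable {k G V : Type*} [Field k] [Group G] [AddCommGroup V] [Module k V]
  [DistribMulAction G V] [SMulCommClass G k V]

/-! ### Components of elements of `S(V) # G` -/

/-- The relations of A are homogeneous, so v ↦ vt, g ↦ g defines an algebra map A → A[t]. It sends a
homogeneous element a of degree m to a t^m, and the coefficient of t^n is the projection. -/
theorem exists_skew_projection (n : ℕ) : ∃ π : Skew k G V →ₗ[k] Skew k G V,
    (∀ a ∈ skewDeg k G V n, π a = a) ∧ ∀ m, m ≠ n → ∀ a ∈ skewDeg k G V m, π a = 0 := by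
  let f : V →ₗ[k] Polynomial (Skew k G V) :=
    { toFun := fun v => Polynomial.monomial 1 (vec k G v)
      map_add' := fun v w => by rw [map_add, map_add]
      map_smul' := fun c v => by
        rw [map_smul, RingHom.id_apply, Polynomial.smul_monomial] }
  let ρ : G →* Polynomial (Skew k G V) :=
    { toFun := fun g => Polynomial.monomial 0 (grp k V g)
      map_one' := by rw [grp_one, Polynomial.monomial_zero_one]
      map_mul' := fun g h => by rw [Polynomial.monomial_mul_monomial, grp_mul_grp] }
  obtain ⟨D, hv, hg⟩ := exists_skew_lift f ρ
    (fun v w => by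
      change Polynomial.monomial 1 _ * Polynomial.monomial 1 _ =
        Polynomial.monomial 1 _ * Polynomial.monomial 1 _
      rw [Polynomial.monomial_mul_monomial, Polynomial.monomial_mul_monomial, vec_mul_comm])
    (fun g v => by
      change Polynomial.monomial 0 _ * Polynomial.monomial 1 _ =
        Polynomial.monomial 1 _ * Polynomial.monomial 0 _
      rw [Polynomial.monomial_mul_monomial, Polynomial.monomial_mul_monomial, grp_mul_vec,
        add_comm])
  have hD (m : ℕ) (a : Skew k G V) (ha : a ∈ skewDeg k G V m) : D a = Polynomial.monomial m a := by
    rw [skewDeg_eq_span] at ha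
    induction ha using Submodule.span_induction with
    | mem a h =>
      obtain ⟨l, g, rfl, rfl⟩ := h
      induction l with
      | nil => rw [mono_nil]; exact hg g
      | cons v l ih =>
        rw [mono_cons, map_mul, ih, hv]
        change Polynomial.monomial 1 _ * _ = _
        rw [Polynomial.monomial_mul_monomial, List.length_cons, add_comm]
    | zero => rw [map_zero, map_zero]
    | add a c _ _ ha hc => rw [map_add, map_add, ha, hc]
    | smul c a _ ha => rw [map_smul, ha, Polynomial.smul_monomial]
  refine ⟨{ toFun := fun a => (D a).coeff n,
            map_add' := fun a c => ?_, map_smul' := fun c a => ?_ },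
    fun a ha => ?_, fun m hm a ha => ?_⟩
  · rw [map_add, Polynomial.coeff_add]
  · rw [map_smul, Polynomial.coeff_smul, RingHom.id_apply]
  · change (D a).coeff n = a
    rw [hD n a ha, Polynomial.coeff_monomial, if_pos rfl]
  · change (D a).coeff n = 0
    rw [hD m a ha, Polynomial.coeff_monomial, if_neg hm]

/-! ### Consequences of the PBW property -/

variable (lam : MonoidAlgebra k G →ₗ[k] V →ₗ[k] MonoidAlgebra k G)
  (kap : V [⋀^Fin 2]→ₗ[k] MonoidAlgebra k G)

/-- `∑_h u_h ⊗ h ↦ ∑_h u_h h`, with values in `H_{λ,κ}`. -/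
def heckeVecGrp : (G →₀ V) →ₗ[k] Hecke lam kap :=
  Finsupp.lsum k fun h => LinearMap.mulRight k (heckeOf lam kap h) ∘ₗ heckeVec lam kap

theorem heckeVecGrp_single (h : G) (v : V) : heckeVecGrp lam kap (Finsupp.single h v) =
    heckeVec lam kap v * heckeOf lam kap h := by simp [heckeVecGrp]

theorem heckeGrp_mul_heckeVec (r : MonoidAlgebra k G) (v : V) :
    heckeGrp lam kap r * heckeVec lam kap v =
      heckeVecGrp lam kap (twist r v) + heckeGrp lam kap (lam r v) := by
  suffices h : LinearMap.mulRight k (heckeVec lam kap v) ∘ₗ (heckeGrp lam kap).toLinearMap =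
      heckeVecGrp lam kap ∘ₗ twist.flip v + (heckeGrp lam kap).toLinearMap ∘ₗ lam.flip v from
    LinearMap.congr_fun h r
  refine groupAlgebra_linearMap_ext fun g => ?_
  simp only [LinearMap.comp_apply, LinearMap.add_apply, LinearMap.mulRight_apply,
    LinearMap.flip_apply, twist_of, heckeVecGrp_single, AlgHom.toLinearMap_apply, heckeGrp_of]
  exact heckeOf_mul_heckeVec lam kap g v

theorem heckeVec_mul_heckeGrp (r : MonoidAlgebra k G) (v : V) :
    heckeVec lam kap v * heckeGrp lam kap r = heckeVecGrp lam kap (flat r v) := by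
  suffices h : LinearMap.mulLeft k (heckeVec lam kap v) ∘ₗ (heckeGrp lam kap).toLinearMap =
      heckeVecGrp lam kap ∘ₗ flat.flip v from LinearMap.congr_fun h r
  refine groupAlgebra_linearMap_ext fun g => ?_
  simp only [LinearMap.comp_apply, LinearMap.mulLeft_apply,
    LinearMap.flip_apply, flat_of, heckeVecGrp_single, AlgHom.toLinearMap_apply, heckeGrp_of]

theorem heckeOf_mul_heckeVecGrp_mem (g : G) (x : G →₀ V) :
    heckeOf lam kap g * heckeVecGrp lam kap x ∈
      LinearMap.range (heckeVecGrp lam kap) ⊔ LinearMap.range (heckeGrp lam kap).toLinearMap := by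
  induction x using Finsupp.induction_linear with
  | zero => rw [map_zero, mul_zero]; exact zero_mem _
  | add x y hx hy => rw [map_add, mul_add]; exact add_mem hx hy
  | single h v =>
    rw [heckeVecGrp_single, ← mul_assoc, heckeOf_mul_heckeVec, add_mul, mul_assoc, ← map_mul,
      ← heckeVecGrp_single, ← heckeGrp_of lam kap h, ← map_mul]
    exact Submodule.add_mem_sup ⟨_, rfl⟩ ⟨_, rfl⟩

theorem heckeFil_zero_le :
    heckeFil lam kap 0 ≤ LinearMap.range (heckeGrp lam kap).toLinearMap := by
  rw [heckeFil, Submodule.span_le]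
  rintro _ ⟨l, hl, rfl⟩
  induction l using hecke_list_induction with
  | nil => exact ⟨1, by simp⟩
  | vec v l _ => simp [List.countP_cons] at hl
  | grp g l ih =>
    obtain ⟨r, hr⟩ := ih (by simpa [List.countP_cons] using hl)
    refine ⟨MonoidAlgebra.of k G g * r, ?_⟩
    rw [List.map_cons, List.prod_cons, ← hr, AlgHom.toLinearMap_apply, map_mul, heckeGrp_of]
    rfl

/-- Group elements are moved to the right of the vector by the cross relation, at the cost of a term
in kG. -/
theorem heckeFil_one_le : heckeFil lam kap 1 ≤
    LinearMap.range (heckeVecGrp lam kap) ⊔ LinearMap.range (heckeGrp lam kap).toLinearMap := by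
  rw [heckeFil, Submodule.span_le]
  rintro _ ⟨l, hl, rfl⟩
  induction l using hecke_list_induction with
  | nil => exact Submodule.mem_sup_right ⟨1, by simp⟩
  | vec v l _ =>
    rw [List.countP_cons_of_pos rfl] at hl
    have hl' : (l.map (heckeGen lam kap)).prod ∈ heckeFil lam kap 0 :=
      Submodule.subset_span ⟨l, by omega, rfl⟩
    obtain ⟨r, hr⟩ := heckeFil_zero_le lam kap hl'
    refine Submodule.mem_sup_left ⟨flat r v, ?_⟩
    rw [← heckeVec_mul_heckeGrp, List.map_cons, List.prod_cons, ← hr]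
    rfl
  | grp g l ih =>
    obtain ⟨_, ⟨x, rfl⟩, _, ⟨r, rfl⟩, e⟩ := Submodule.mem_sup.1
      (ih (by simpa [List.countP_cons] using hl))
    rw [List.map_cons, List.prod_cons, ← e]
    change heckeOf lam kap g * _ ∈ _
    rw [mul_add]
    refine add_mem (heckeOf_mul_heckeVecGrp_mem lam kap g x) (Submodule.mem_sup_right
      ⟨MonoidAlgebra.of k G g * r, ?_⟩)
    rw [AlgHom.toLinearMap_apply, map_mul, heckeGrp_of]
    rfl

theorem injective_of_surjective_of_injective {M N : Type*} [AddCommGroup M] [Module k M]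
    [AddCommGroup N] [Module k N] [Module.Finite k M] (f j : M →ₗ[k] N)
    (hf : Function.Surjective f) (hj : Function.Injective j) : Function.Injective f := by
  have : Module.Finite k N := Module.Finite.of_surjective f hf
  exact (LinearMap.injective_iff_surjective_of_finrank_eq_finrank
    (le_antisymm (LinearMap.finrank_le_finrank_of_injective hj)
      (LinearMap.finrank_le_finrank_of_surjective hf))).2 hf

variable {lam kap}

/-- The given isomorphism maps the degree n part into A_n. It maps onto A_n because, being graded,
it commutes with the projections to degree n. -/
theorem HasPBW.exists_gr_linear (H : HasPBW lam kap) (n : ℕ) :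
    ∃ E : Gr (heckeFil lam kap) n →ₗ[k] Skew k G V, Function.Injective E ∧
      skewDeg k G V n ≤ LinearMap.range E := by
  classical
  obtain ⟨e, he⟩ := H
  let F := heckeFil lam kap
  refine ⟨e.toLinearMap ∘ₗ DirectSum.lof k ℕ (Gr F) n,
    e.injective.comp (DirectSum.of_injective n), fun s hs => ?_⟩
  obtain ⟨π, h1, h2⟩ := exists_skew_projection (k := k) (G := G) (V := V) n
  have key (x : ⨁ n, Gr F n) : π (e x) = e (DirectSum.of (Gr F) n (x n)) := by
    induction x using DirectSum.induction_on with
    | zero => simp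
    | of m x =>
      by_cases hm : m = n
      · subst hm
        rw [h1 _ (he m x), DirectSum.of_eq_same]
      · rw [h2 m hm _ (he m x), DirectSum.of_eq_of_ne _ _ _ (Ne.symm hm), map_zero, map_zero]
    | add x y hx hy => rw [map_add, map_add, hx, hy, DirectSum.add_apply, map_add, map_add]
  refine ⟨e.symm s n, ?_⟩
  have := key (e.symm s)
  rw [e.apply_symm_apply, h1 s hs] at this
  exact this.symm

/-- The dimension count. The isomorphism of the PBW property need not be induced by the generators,
but through it M embeds into the degree n part of gr H. A surjection from the finite-dimensional
space M onto that part is then injective. -/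
theorem HasPBW.injective_of_surjective (H : HasPBW lam kap) (n : ℕ) {M : Type*} [AddCommGroup M]
    [Module k M] [Module.Finite k M] (f : M →ₗ[k] Gr (heckeFil lam kap) n)
    (hf : Function.Surjective f) (j : M →ₗ[k] Skew k G V) (hj : Function.Injective j)
    (hjn : ∀ x, j x ∈ skewDeg k G V n) : Function.Injective f := by
  obtain ⟨E, hE, hr⟩ := H.exists_gr_linear n
  let e := LinearEquiv.ofInjective E hE
  let j' : M →ₗ[k] Gr (heckeFil lam kap) n :=
    e.symm.toLinearMap ∘ₗ j.codRestrict (LinearMap.range E) fun x => hr (hjn x)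
  refine injective_of_surjective_of_injective f j' hf (e.symm.injective.comp fun x y h => hj ?_)
  exact congrArg Subtype.val h

theorem HasPBW.heckeGrp_injective [Finite G] (H : HasPBW lam kap) :
    Function.Injective (heckeGrp lam kap) := by
  let F := heckeFil lam kap
  have h := H.injective_of_surjective 0
    (Gr.mk F 0 ∘ₗ (heckeGrp lam kap).toLinearMap.codRestrict (F 0) (heckeGrp_mem lam kap))
    (fun x => by
      obtain ⟨x, rfl⟩ := Submodule.mkQ_surjective _ x
      obtain ⟨r, hr⟩ := heckeFil_zero_le lam kap x.2
      exact ⟨r, congrArg (Gr.mk F 0) (Subtype.ext hr)⟩)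
    (groupIncl k G V).toLinearMap groupIncl_injective groupIncl_mem_skewDeg
  exact fun r s e => h (congrArg (Gr.mk F 0) (Subtype.ext e))

/-- In F_1/F_0 only x remains, and V ⊗ kG embeds there; afterwards r vanishes because kG embeds in
H. -/
theorem HasPBW.eq_zero [Finite G] [Module.Finite k V] (H : HasPBW lam kap) {x : G →₀ V}
    {r : MonoidAlgebra k G} (h : heckeVecGrp lam kap x + heckeGrp lam kap r = 0) :
    x = 0 ∧ r = 0 := by
  let F := heckeFil lam kap
  have hmem (x : G →₀ V) : heckeVecGrp lam kap x ∈ F 1 := by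
    induction x using Finsupp.induction_linear with
    | zero => rw [map_zero]; exact zero_mem _
    | add x y hx hy => rw [map_add]; exact add_mem hx hy
    | single h v =>
      rw [heckeVecGrp_single]
      exact SetLike.mul_mem_graded (A := F) (i := 1) (j := 0) (heckeVec_mem lam kap v)
        (heckeOf_mem lam kap h)
  have hlow (r : MonoidAlgebra k G) : heckeGrp lam kap r ∈ ⨆ m : Fin 1, F m :=
    Submodule.mem_iSup_of_mem (p := fun m : Fin 1 => F m) 0 (heckeGrp_mem lam kap r)
  have hinj := H.injective_of_surjective 1
    (Gr.mk F 1 ∘ₗ (heckeVecGrp lam kap).codRestrict (F 1) hmem)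
    (fun y => by
      obtain ⟨y, rfl⟩ := Submodule.mkQ_surjective _ y
      obtain ⟨_, ⟨x, rfl⟩, _, ⟨r, rfl⟩, e⟩ := Submodule.mem_sup.1 (heckeFil_one_le lam kap y.2)
      refine ⟨x, (grMk_eq_iff F _ _).2 ?_⟩
      rw [← e]
      change heckeVecGrp lam kap x - (heckeVecGrp lam kap x + heckeGrp lam kap r) ∈ _
      rw [sub_add_cancel_left]
      exact neg_mem (hlow r))
    (vecGrp k G V) vecGrp_injective vecGrp_mem_skewDeg
  have hx : x = 0 := by
    refine (injective_iff_map_eq_zero _).1 hinj x ((grMk_eq_zero_iff F _).2 ?_)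
    change heckeVecGrp lam kap x ∈ _
    rw [eq_neg_of_add_eq_zero_left h]
    exact neg_mem (hlow r)
  refine ⟨hx, ?_⟩
  rw [hx, map_zero, zero_add] at h
  exact (injective_iff_map_eq_zero _).1 H.heckeGrp_injective r h

/-- Each overlap is computed in two ways in H, and the results are compared in V ⊗ kG ⊕ kG, which
embeds in H by `HasPBW.eq_zero`. -/
theorem HasPBW.compatible [Finite G] [Module.Finite k V] (H : HasPBW lam kap) :
    Compatible lam kap := by
  set γ := heckeGrp lam kap with hγ
  set ν := heckeVec lam kap with hν
  have hsep {x y : G →₀ V} {r s : MonoidAlgebra k G} (h : heckeVecGrp lam kap x + γ r =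
      heckeVecGrp lam kap y + γ s) : x = y ∧ r = s := by
    have := H.eq_zero (x := x - y) (r := r - s) (by
      rw [map_sub, map_sub, ← sub_eq_zero.2 h]; abel)
    exact ⟨sub_eq_zero.1 this.1, sub_eq_zero.1 this.2⟩
  have hrv (r v) : γ r * ν v = heckeVecGrp lam kap (twist r v) + γ (lam r v) :=
    heckeGrp_mul_heckeVec lam kap r v
  have hvr (r v) : ν v * γ r = heckeVecGrp lam kap (flat r v) := heckeVec_mul_heckeGrp lam kap r v
  have hgv (g : G) (v) : γ (MonoidAlgebra.of k G g) * ν v = ν (g • v) * γ (MonoidAlgebra.of k G g)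
      + γ (lam (MonoidAlgebra.of k G g) v) := by
    rw [hγ, heckeGrp_of]; exact heckeOf_mul_heckeVec lam kap g v
  have hvw (v w) : ν v * ν w = ν w * ν v + γ (kap ![v, w]) := heckeVec_mul_heckeVec lam kap v w
  -- The relation vw = wv + κ(v,w) is multiplied by g from the left, and g is moved to the right
  -- everywhere. After the terms of degree two are cancelled, the rest lies in the image of V ⊗ kG ⊕
  -- kG.
  have hswap (g : G) (v w : V) := by
    have e (v w : V) : γ (MonoidAlgebra.of k G g) * (ν v * ν w) =
        ν (g • v) * ν (g • w) * γ (MonoidAlgebra.of k G g)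
        + (heckeVecGrp lam kap (flat (lam (MonoidAlgebra.of k G g) w) (g • v))
        + heckeVecGrp lam kap (twist (lam (MonoidAlgebra.of k G g) v) w)
        + γ (lam (lam (MonoidAlgebra.of k G g) v) w)) := by
      rw [← mul_assoc, hgv,
      add_mul, mul_assoc, hgv, mul_add,
        hvr (lam (MonoidAlgebra.of k G g) w), hrv, ← mul_assoc]
      abel
    have e' := e v w
    rw [hvw v w, mul_add, e w v, hvw (g • v), add_mul,
      ← map_mul γ, ← map_mul γ, add_assoc, add_assoc (ν (g • w) * ν (g • v) * _)] at e'
    have e'' := add_left_cancel e'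
    exact hsep (x := flat (lam (MonoidAlgebra.of k G g) v) (g • w)
      + twist (lam (MonoidAlgebra.of k G g) w) v) (y := flat (lam (MonoidAlgebra.of k G g) w) (g • v)
      + twist (lam (MonoidAlgebra.of k G g) v) w)
      (r := lam (lam (MonoidAlgebra.of k G g) w) v + MonoidAlgebra.of k G g * kap ![v, w])
      (s := lam (lam (MonoidAlgebra.of k G g) v) w + kap ![g • v, g • w] * MonoidAlgebra.of k G g) (by
        simp only [map_add]
        rw [← add_assoc, e'']
        abel)
  -- The Jacobi identity for commutators in the associative algebra H, with each inner commutator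
  -- replaced by a value of κ.
  have hcyc (u v w : V) := by
    have e (u v w : V) : heckeVecGrp lam kap (twist (kap ![u, v]) w - flat (kap ![u, v]) w)
        + γ (lam (kap ![u, v]) w) = (ν u * ν v - ν v * ν u) * ν w - ν w * (ν u * ν v - ν v * ν u) := by
      rw [hvw u v, add_sub_cancel_left, hrv, hvr, map_sub]
      abel
    exact H.eq_zero (x := twist (kap ![u, v]) w - flat (kap ![u, v]) w
      + (twist (kap ![v, w]) u - flat (kap ![v, w]) u)
      + (twist (kap ![w, u]) v - flat (kap ![w, u]) v))
      (r := lam (kap ![u, v]) w + lam (kap ![v, w]) u + lam (kap ![w, u]) v) (by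
        have := congrArg₂ (· + ·) (congrArg₂ (· + ·) (e u v w) (e v w u)) (e w u v)
        simp only [map_add] at this ⊢
        refine Eq.trans (Eq.trans ?_ this) ?_
        · abel
        · noncomm_ring)
  constructor
  · intro g h v
    refine H.heckeGrp_injective ?_
    -- Here (gh)v is compared with g(hv); injectivity of kG → H suffices.
    have e := hgv (g * h) v
    rw [map_mul (MonoidAlgebra.of k G), map_mul γ, mul_assoc, hgv, mul_add, ← mul_assoc, hgv, add_mul, mul_assoc,
      ← map_mul, mul_smul, add_assoc] at e
    have e' := add_left_cancel e
    rw [map_mul (MonoidAlgebra.of k G), ← e', ← map_mul γ, ← map_mul γ, ← map_add, add_comm]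
  · intro g v w
    have := (hswap g v w).1
    rw [sub_eq_sub_iff_add_eq_add, add_comm, ← this, add_comm]
  · intro g v w
    have := (hswap g v w).2
    rw [sub_eq_sub_iff_add_eq_add, ← this, add_comm]
  · exact fun u v w => (hcyc u v w).1
  · exact fun u v w => (hcyc u v w).2

theorem hasPBW_iff_compatible [Finite G] [Module.Finite k V] :
    HasPBW lam kap ↔ Compatible lam kap := ⟨HasPBW.compatible, Compatible.hasPBW⟩

end

noncomputable section

variable {k G V : Type*} [Field k] [Group G] [AddCommGroup V] [Module k V]
  [DistribMulAction G V] [SMulCommClass G k V]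

/-! ### Graded maps between the terms of the resolutions -/

variable (k G V) in
/-- The degree `d` part of `A^{⊗n}`. -/
def tensorDeg (n d : ℕ) : Submodule k (⨂[k]^n (Skew k G V)) :=
  Submodule.span k {z | ∃ (x : Fin n → Skew k G V) (c : Fin n → ℕ),
    (∀ i, x i ∈ skewDeg k G V (c i)) ∧ ∑ i, c i = d ∧ z = PiTensorProduct.tprod k x}

/-- `g_1 ⊗ ⋯ ⊗ g_i ⊗ x`, as a linear function of `x ∈ ⋀^j V`. -/
def genIncl {n i j : ℕ} (h : i + j = n) (g : Fin i → G) : ⋀[k]^j V →ₗ[k] XGenTot k G V n :=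
  DirectSum.lof k _ (fun p : {p : ℕ × ℕ // p.1 + p.2 = n} => XGen k G V p.1.1 p.1.2)
      ⟨(i, j), h⟩ ∘ₗ Finsupp.lsingle g

variable (k) in
/-- `g_1 ⊗ ⋯ ⊗ g_i ⊗ v_1 ∧ ⋯ ∧ v_j`. -/
def gen {n i j : ℕ} (h : i + j = n) (g : Fin i → G) (v : Fin j → V) : XGenTot k G V n :=
  genIncl h g (exteriorPower.ιMulti k j v)

theorem xGen_eq {n i j : ℕ} (h : i + j = n) (g : Fin i → G) (v : Fin j → V) :
    xGen k h g v = freeIncl k (Skew k G V) (gen k h g v) := rfl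

variable (k G V) in
/-- The degree `d` part of the space of generators of `X_n`. -/
def genDeg (n d : ℕ) : Submodule k (XGenTot k G V n) :=
  Submodule.span k {m | ∃ (i : ℕ) (h : i + d = n) (g : Fin i → G) (v : Fin d → V), m = gen k h g v}

theorem gen_hom_ext {n : ℕ} {P : Type*} [AddCommGroup P] [Module k P]
    {f f' : XGenTot k G V n →ₗ[k] P}
    (h : ∀ (i j : ℕ) (hij : i + j = n) (g : Fin i → G) (v : Fin j → V),
      f (gen k hij g v) = f' (gen k hij g v)) : f = f' := by
  refine DirectSum.linearMap_ext k ?_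
  rintro ⟨⟨i, j⟩, hij⟩
  refine Finsupp.lhom_ext' fun g => ?_
  apply exteriorPower.linearMap_ext
  ext v
  exact h i j hij g v

theorem gen_mem_genDeg {n i j : ℕ} (h : i + j = n) (g : Fin i → G) (v : Fin j → V) :
    gen k h g v ∈ genDeg k G V n j := Submodule.subset_span ⟨i, h, g, v, rfl⟩

theorem tprod_mem_tensorDeg {n d : ℕ} {x : Fin n → Skew k G V} (c : Fin n → ℕ)
    (hx : ∀ i, x i ∈ skewDeg k G V (c i)) (hd : ∑ i, c i = d) :
    PiTensorProduct.tprod k x ∈ tensorDeg k G V n d := Submodule.subset_span ⟨x, c, hx, hd, rfl⟩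

theorem xAct_mem_xDeg {n d p q : ℕ} {a b : Skew k G V} {y : X k G V n} (ha : a ∈ skewDeg k G V p)
    (hb : b ∈ skewDeg k G V q) (hy : y ∈ xDeg k G V n d) :
    xAct k G V n a b y ∈ xDeg k G V n (p + d + q) := by
  refine (Submodule.span_le (p := (xDeg k G V n (p + d + q)).comap (xAct k G V n a b))).2 ?_ hy
  rintro _ ⟨i, j, h, g, v, p', q', a', ha', b', hb', rfl, rfl⟩
  rw [SetLike.mem_coe, Submodule.mem_comap, freeAct_freeAct]
  exact Submodule.subset_span ⟨i, j, h, g, v, p + p', q' + q, a * a', mul_mem_skewDeg ha ha',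
    b' * b, mul_mem_skewDeg hb' hb, by omega, rfl⟩

theorem xGen_mem_xDeg {n i j : ℕ} (h : i + j = n) (g : Fin i → G) (v : Fin j → V) :
    xGen k h g v ∈ xDeg k G V n j :=
  Submodule.subset_span ⟨i, j, h, g, v, 0, 0, 1, one_mem_skewDeg, 1, one_mem_skewDeg, by omega,
    (freeAct_one _).symm⟩

theorem freeIncl_mem_xDeg {n d : ℕ} {m : XGenTot k G V n} (hm : m ∈ genDeg k G V n d) :
    freeIncl k (Skew k G V) m ∈ xDeg k G V n d := by
  refine (Submodule.span_le (p := (xDeg k G V n d).comap (freeIncl k (Skew k G V)))).2 ?_ hm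
  rintro _ ⟨i, h, g, v, rfl⟩
  exact xGen_mem_xDeg h g v

theorem biExtend_mem_xDeg {n : ℕ} (f : (⨂[k]^n (Skew k G V)) →ₗ[k] X k G V n)
    (hf : ∀ d, ∀ z ∈ tensorDeg k G V n d, f z ∈ xDeg k G V n d) {d : ℕ}
    {y : Bar k (Skew k G V) n} (hy : y ∈ barDeg k G V n d) :
    biExtend (xAct k G V n) f y ∈ xDeg k G V n d := by
  refine (Submodule.span_le (p := (xDeg k G V n d).comap (biExtend (xAct k G V n) f))).2 ?_ hy
  rintro _ ⟨x, c, p, q, hx, a, ha, b, hb, rfl, rfl⟩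
  rw [SetLike.mem_coe, Submodule.mem_comap, biExtend_freeAct _ freeAct_freeAct, barGen,
    biExtend_freeIncl _ freeAct_one]
  exact xAct_mem_xDeg ha hb (hf _ _ (tprod_mem_tensorDeg c hx rfl))

variable (k G V) in
-- A basis can be extracted from the spanning set of monomials. A coordinate belonging to a basis
-- vector of degree other than d vanishes after projection to degree d, as is checked on the basis.
theorem exists_homogeneous_basis : ∃ (s : Set (Skew k G V)) (B : Module.Basis s k (Skew k G V))
    (deg : s → ℕ), (∀ i, B i ∈ skewDeg k G V (deg i)) ∧
      ∀ d, ∀ a ∈ skewDeg k G V d, ∀ i, B.repr a i ≠ 0 → deg i = d := by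
  classical
  obtain ⟨s, hs, hspan, hli⟩ := exists_linearIndependent k
    (Set.range fun p : List V × G => mono (k := k) p.1 p.2)
  let B := Module.Basis.mk hli (by rw [Subtype.range_coe, hspan, span_mono_eq_top])
  have hB (i : s) : ∃ d, B i ∈ skewDeg k G V d := by
    obtain ⟨p, hp⟩ := hs i.2
    refine ⟨p.1.length, ?_⟩
    rw [Module.Basis.mk_apply, ← hp]
    exact mono_mem_skewDeg _ _
  choose deg hdeg using hB
  refine ⟨s, B, deg, hdeg, fun d a ha i hi => ?_⟩
  obtain ⟨π, h1, h2⟩ := exists_skew_projection (k := k) (G := G) (V := V) d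
  by_contra hne
  refine hi ?_
  let T : Skew k G V →ₗ[k] k := Finsupp.lapply i ∘ₗ B.repr.toLinearMap
  have key : T ∘ₗ π = 0 := B.ext fun j => by
    by_cases hj : deg j = d
    · have hij : j ≠ i := fun e => hne (e ▸ hj)
      rw [LinearMap.comp_apply, h1 _ (hj ▸ hdeg j)]
      simp [T, Finsupp.single_apply, hij]
    · rw [LinearMap.comp_apply, h2 _ hj _ (hdeg j), map_zero, LinearMap.zero_apply]
  have := LinearMap.congr_fun key a
  rwa [LinearMap.comp_apply, h1 a ha] at this

/-- Bar cochains are merely k-linear on the middle factors, so a lift may be chosen freely on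
tensors of homogeneous basis vectors, each lift in its own degree. -/
theorem exists_graded_lift (n : ℕ) {P : Type*} [AddCommGroup P] [Module k P] (T : X k G V n →ₗ[k] P)
    (τ : (⨂[k]^n (Skew k G V)) →ₗ[k] P)
    (h : ∀ (x : Fin n → Skew k G V) (c : Fin n → ℕ), (∀ i, x i ∈ skewDeg k G V (c i)) →
      ∃ y ∈ xDeg k G V n (∑ i, c i), T y = τ (PiTensorProduct.tprod k x)) :
    ∃ f : (⨂[k]^n (Skew k G V)) →ₗ[k] X k G V n, T ∘ₗ f = τ ∧
      ∀ d, ∀ z ∈ tensorDeg k G V n d, f z ∈ xDeg k G V n d := by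
  obtain ⟨s, B, deg, hB, hdeg⟩ := exists_homogeneous_basis k G V
  choose y hy hT using fun p : Fin n → s => h (fun i => B (p i)) (fun i => deg (p i))
    fun i => hB (p i)
  let Bn := Basis.piTensorProduct fun _ : Fin n => B
  refine ⟨Bn.constr k y, Bn.ext fun p => ?_, fun d z hz => ?_⟩
  · rw [LinearMap.comp_apply, Module.Basis.constr_basis, hT, Basis.piTensorProduct_apply]
  · refine (Submodule.span_le (p := (xDeg k G V n d).comap (Bn.constr k y))).2 ?_ hz
    rintro _ ⟨x, c, hx, rfl, rfl⟩
    rw [SetLike.mem_coe, Submodule.mem_comap, Module.Basis.constr_apply]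
    refine Submodule.sum_mem _ fun p hp => Submodule.smul_mem _ _ ?_
    -- A coordinate of a pure tensor is a product of coordinates. If it is nonzero, every factor is,
    -- and then the degrees of the basis vectors are those of the tensor factors.
    rw [Finsupp.mem_support_iff, Basis.piTensorProduct_repr_tprod_apply,
      Finset.prod_ne_zero_iff] at hp
    have : ∑ i, c i = ∑ i, deg (p i) :=
      Finset.sum_congr rfl fun i hi => (hdeg _ _ (hx i) _ (hp i hi)).symm
    rw [this]
    exact hy p

/-! ### Components of elements of `X` -/

theorem exists_gen_projection (n d : ℕ) : ∃ π : XGenTot k G V n →ₗ[k] XGenTot k G V n,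
    ∀ (i j : ℕ) (h : i + j = n) (g : Fin i → G) (v : Fin j → V),
      π (gen k h g v) = if j = d then gen k h g v else 0 := by
  refine ⟨DirectSum.toModule k _ _ fun p => if p.1.2 = d then
    DirectSum.lof k _ (fun p : {p : ℕ × ℕ // p.1 + p.2 = n} => XGen k G V p.1.1 p.1.2) p else 0,
    fun i j h g v => ?_⟩
  rw [gen, genIncl, LinearMap.comp_apply, DirectSum.toModule_lof]
  split_ifs <;> rfl

/-- X_n is a tensor product of three graded spaces. The projection to degree d is the sum of the
products of projections over all triples of degrees with sum d, each of which is at most d. -/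
theorem exists_x_projection (n d : ℕ) : ∃ π : X k G V n →ₗ[k] X k G V n,
    (∀ y ∈ xDeg k G V n d, π y = y) ∧ ∀ e, e ≠ d → ∀ y ∈ xDeg k G V n e, π y = 0 := by
  choose π h1 h2 using exists_skew_projection (k := k) (G := G) (V := V)
  choose ϖ hϖ using exists_gen_projection (k := k) (G := G) (V := V) n
  let S := (Finset.range (d + 1) ×ˢ Finset.range (d + 1) ×ˢ Finset.range (d + 1)).filter
    fun t => t.1 + t.2.1 + t.2.2 = d
  let T : X k G V n →ₗ[k] X k G V n := ∑ t ∈ S, TensorProduct.map (π t.1)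
    (TensorProduct.map (ϖ t.2.1) (π t.2.2))
  have hterm (p q i j : ℕ) (h : i + j = n) (g : Fin i → G) (v : Fin j → V) (a b : Skew k G V)
      (ha : a ∈ skewDeg k G V p) (hb : b ∈ skewDeg k G V q) (t : ℕ × ℕ × ℕ) :
      TensorProduct.map (π t.1) (TensorProduct.map (ϖ t.2.1) (π t.2.2))
        (xAct k G V n a b (xGen k h g v)) = if (p, j, q) = t then xAct k G V n a b (xGen k h g v)
          else 0 := by
    obtain ⟨p', j', q'⟩ := t
    rw [xGen_eq, freeAct_freeIncl, TensorProduct.map_tmul, TensorProduct.map_tmul, hϖ]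
    by_cases hp : p = p'
    · subst hp
      by_cases hj : j = j'
      · subst hj
        by_cases hq : q = q'
        · subst hq
          rw [h1 _ _ ha, h1 _ _ hb, if_pos rfl, if_pos rfl]
        · have e : (p, j, q) ≠ (p, j, q') := by simp [hq]
          rw [h2 _ _ hq _ hb, if_neg e, TensorProduct.tmul_zero, TensorProduct.tmul_zero]
      · have e : (p, j, q) ≠ (p, j', q') := by simp [hj]
        rw [if_neg hj, if_neg e, TensorProduct.zero_tmul, TensorProduct.tmul_zero]
    · have e : (p, j, q) ≠ (p', j', q') := by simp [hp]
      rw [h2 _ _ hp _ ha, if_neg e, TensorProduct.zero_tmul]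
  have hT (p q i j : ℕ) (h : i + j = n) (g : Fin i → G) (v : Fin j → V) (a b : Skew k G V)
      (ha : a ∈ skewDeg k G V p) (hb : b ∈ skewDeg k G V q) :
      T (xAct k G V n a b (xGen k h g v)) =
        if p + j + q = d then xAct k G V n a b (xGen k h g v) else 0 := by
    simp only [T, LinearMap.sum_apply, hterm p q i j h g v a b ha hb]
    rw [Finset.sum_ite_eq]
    refine if_congr ?_ rfl rfl
    simp only [S, Finset.mem_filter, Finset.mem_product, Finset.mem_range]
    omega
  refine ⟨T, fun y hy => ?_, fun e he y hy => ?_⟩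
  · refine LinearMap.eqOn_span (f := T) (g := LinearMap.id) ?_ hy
    rintro _ ⟨i, j, h, g, v, p, q, a, ha, b, hb, rfl, rfl⟩
    rw [hT p q i j h g v a b ha hb, if_pos rfl, LinearMap.id_apply]
  · refine LinearMap.eqOn_span (f := T) (g := 0) ?_ hy
    rintro _ ⟨i, j, h, g, v, p, q, a, ha, b, hb, rfl, rfl⟩
    rw [hT p q i j h g v a b ha hb, if_neg he, LinearMap.zero_apply]

theorem mem_iSup_xDeg (n : ℕ) (y : X k G V n) : y ∈ ⨆ d, xDeg k G V n d := by
  suffices h : (⨆ d, xDeg k G V n d).mkQ = 0 from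
    (Submodule.Quotient.mk_eq_zero _).1 (LinearMap.congr_fun h y)
  refine x_hom_ext fun a b i j h g v => ?_
  suffices e : (xAct k G V n).compr₂ ((⨆ d, xDeg k G V n d).mkQ ∘ₗ
      LinearMap.applyₗ (xGen k h g v)) = 0 from LinearMap.congr_fun₂ e a b
  refine skew_linearMap_ext fun l s => skew_linearMap_ext fun l' s' => ?_
  exact (Submodule.Quotient.mk_eq_zero _).2 (Submodule.mem_iSup_of_mem _ (xAct_mem_xDeg
    (mono_mem_skewDeg l s) (mono_mem_skewDeg l' s') (xGen_mem_xDeg h g v)))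

/-- Any preimage is a sum of homogeneous elements; the component of degree d alone already maps to
z, since the others map to elements of other degrees. -/
theorem exists_homogeneous_preimage {m n : ℕ} (T : X k G V m →ₗ[k] X k G V n)
    (hT : ∀ d, ∀ y ∈ xDeg k G V m d, T y ∈ xDeg k G V n d) {d : ℕ} {z : X k G V n}
    (hz : z ∈ xDeg k G V n d) (h : z ∈ LinearMap.range T) : ∃ y ∈ xDeg k G V m d, T y = z := by
  obtain ⟨y, rfl⟩ := h
  obtain ⟨π, h1, h2⟩ := exists_x_projection (k := k) (G := G) (V := V) n d
  rw [← h1 _ hz]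
  clear hz
  have hy := mem_iSup_xDeg m y
  induction hy using Submodule.iSup_induction' with
  | mem e y hy =>
    by_cases he : e = d
    · subst he
      exact ⟨y, hy, (h1 _ (hT _ _ hy)).symm⟩
    · exact ⟨0, zero_mem _, by rw [h2 e he _ (hT _ _ hy), map_zero]⟩
  | zero => exact ⟨0, zero_mem _, by simp⟩
  | add y z _ _ hy hz =>
    obtain ⟨u, hu, e⟩ := hy
    obtain ⟨w, hw, e'⟩ := hz
    exact ⟨u + w, add_mem hu hw, by rw [map_add, map_add, map_add, e, e']⟩

end

noncomputable section

/-! ### The bar resolution in low degrees -/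

section Bar

variable {k A : Type*} [Field k] [Ring A] [Algebra k A]

variable (k A) in
/-- The linear map `a ↦ a`, with values in `⨂[k]^1 A`. -/
def one : A →ₗ[k] ⨂[k]^1 A where
  toFun a := PiTensorProduct.tprod k ![a]
  map_add' a b := by
    have e (x : A) : ![x] = Function.update ![0] 0 x := by ext i; fin_cases i; rfl
    rw [e a, e b, e (a + b), MultilinearMap.map_update_add]
  map_smul' c a := by
    have e (x : A) : ![x] = Function.update ![0] 0 x := by ext i; fin_cases i; rfl
    rw [e a, e (c • a), MultilinearMap.map_update_smul, RingHom.id_apply]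

variable (k) in
/-- The linear map `c ↦ a ⊗ b ⊗ c`. -/
def tripleAux (a b : A) : A →ₗ[k] ⨂[k]^3 A where
  toFun c := PiTensorProduct.tprod k ![a, b, c]
  map_add' c d := by
    have e (x : A) : ![a, b, x] = Function.update ![a, b, 0] 2 x := by ext i; fin_cases i <;> rfl
    rw [e c, e d, e (c + d), MultilinearMap.map_update_add]
  map_smul' s c := by
    have e (x : A) : ![a, b, x] = Function.update ![a, b, 0] 2 x := by ext i; fin_cases i <;> rfl
    rw [e c, e (s • c), MultilinearMap.map_update_smul, RingHom.id_apply]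

variable (k A) in
/-- The trilinear map `(a, b, c) ↦ a ⊗ b ⊗ c`, with values in `⨂[k]^3 A`. -/
def triple : A →ₗ[k] A →ₗ[k] A →ₗ[k] ⨂[k]^3 A :=
  LinearMap.mk₂ k (tripleAux k)
    (fun a a' b => LinearMap.ext fun c => by
      have e (x : A) : ![x, b, c] = Function.update ![0, b, c] 0 x := by
        ext i; fin_cases i <;> rfl
      change PiTensorProduct.tprod k ![a + a', b, c] =
        PiTensorProduct.tprod k ![a, b, c] + PiTensorProduct.tprod k ![a', b, c]
      rw [e a, e a', e (a + a'), MultilinearMap.map_update_add])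
    (fun s a b => LinearMap.ext fun c => by
      have e (x : A) : ![x, b, c] = Function.update ![0, b, c] 0 x := by
        ext i; fin_cases i <;> rfl
      change PiTensorProduct.tprod k ![s • a, b, c] = s • PiTensorProduct.tprod k ![a, b, c]
      rw [e a, e (s • a), MultilinearMap.map_update_smul])
    (fun a b b' => LinearMap.ext fun c => by
      have e (x : A) : ![a, x, c] = Function.update ![a, 0, c] 1 x := by
        ext i; fin_cases i <;> rfl
      change PiTensorProduct.tprod k ![a, b + b', c] =
        PiTensorProduct.tprod k ![a, b, c] + PiTensorProduct.tprod k ![a, b', c]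
      rw [e b, e b', e (b + b'), MultilinearMap.map_update_add])
    (fun s a b => LinearMap.ext fun c => by
      have e (x : A) : ![a, x, c] = Function.update ![a, 0, c] 1 x := by
        ext i; fin_cases i <;> rfl
      change PiTensorProduct.tprod k ![a, s • b, c] = s • PiTensorProduct.tprod k ![a, b, c]
      rw [e b, e (s • b), MultilinearMap.map_update_smul])

theorem triple_apply (a b c : A) : triple k A a b c = PiTensorProduct.tprod k ![a, b, c] := rfl

theorem barD_freeAct (n : ℕ) (a b : A) (x : Bar k A (n + 1)) :
    barD k A n (freeAct k A _ a b x) = freeAct k A _ a b (barD k A n x) :=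
  biExtend_freeAct _ (fun a b c d x => freeAct_freeAct a b c d x) _ a b x

theorem barFirst_apply (n : ℕ) (a : Fin (n + 1) → A) :
    barFirst k A n a = freeAct k A _ (a 0) 1 (barGen k (Fin.tail a)) := rfl

theorem barLast_apply (n : ℕ) (a : Fin (n + 1) → A) :
    barLast k A n a = freeAct k A _ 1 (a (Fin.last n)) (barGen k (Fin.init a)) := rfl

theorem barD_barGen (n : ℕ) (a : Fin (n + 1) → A) :
    barD k A n (barGen k a) = freeAct k A _ (a 0) 1 (barGen k (Fin.tail a))
      + ∑ j : Fin n, (-1 : k) ^ (j.val + 1) • barGen k (Fin.contractNth j.castSucc (· * ·) a)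
      + (-1 : k) ^ (n + 1) • freeAct k A _ 1 (a (Fin.last n)) (barGen k (Fin.init a)) := by
  rw [barD, barGen, biExtend_freeIncl _ freeAct_one, PiTensorProduct.lift.tprod,
    MultilinearMap.add_apply, MultilinearMap.add_apply, MultilinearMap.sum_apply,
    MultilinearMap.smul_apply, barFirst_apply, barLast_apply]
  rfl

theorem sum_signs_two {R M : Type*} [CommRing R] [AddCommGroup M] [Module R M] (a r : M)
    (c : Fin 1 → M) : a + ∑ l : Fin 1, (-1 : R) ^ (l.val + 1) • c l + (-1 : R) ^ (1 + 1) • r =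
      a - c 0 + r := by
  simp; abel

theorem sum_signs_one {R M : Type*} [CommRing R] [AddCommGroup M] [Module R M] (a r : M)
    (c : Fin 0 → M) : a + ∑ l : Fin 0, (-1 : R) ^ (l.val + 1) • c l + (-1 : R) ^ (0 + 1) • r =
      a - r := by
  simp; abel

theorem barD_zero (a : A) : barD k A 0 (barGen k ![a]) =
    freeAct k A _ a 1 (barGen k ![]) - freeAct k A _ 1 a (barGen k ![]) := by
  refine (barD_barGen 0 _).trans ((sum_signs_one _ _ _).trans ?_)
  rw [Subsingleton.elim (Fin.tail ![a]) ![], Subsingleton.elim (Fin.init ![a]) ![]]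
  rfl

theorem barD_one (a b : A) : barD k A 1 (barGen k ![a, b]) =
    freeAct k A _ a 1 (barGen k ![b]) - barGen k ![a * b] + freeAct k A _ 1 b (barGen k ![a]) := by
  have e1 : Fin.tail ![a, b] = ![b] := by ext i; fin_cases i; rfl
  have e2 : Fin.contractNth (Fin.castSucc 0) (· * ·) ![a, b] = ![a * b] := by
    ext i; fin_cases i; rfl
  have e3 : Fin.init ![a, b] = ![a] := by ext i; fin_cases i; rfl
  refine (barD_barGen 1 _).trans ((sum_signs_two _ _ _).trans ?_)
  rw [e1, e2, e3]
  rfl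

theorem barD_two (a b c : A) : barD k A 2 (barGen k ![a, b, c]) =
    freeAct k A _ a 1 (barGen k ![b, c]) - barGen k ![a * b, c] + barGen k ![a, b * c]
      - freeAct k A _ 1 c (barGen k ![a, b]) := by
  have e1 : Fin.tail ![a, b, c] = ![b, c] := by ext i; fin_cases i <;> rfl
  have e2 : Fin.contractNth (Fin.castSucc 0) (· * ·) ![a, b, c] = ![a * b, c] := by
    ext i; fin_cases i <;> rfl
  have e4 : Fin.contractNth (Fin.castSucc 1) (· * ·) ![a, b, c] = ![a, b * c] := by
    ext i; fin_cases i <;> rfl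
  have e3 : Fin.init ![a, b, c] = ![a, b] := by ext i; fin_cases i <;> rfl
  refine (barD_barGen 2 _).trans ((sum_signs_three_zero _ _ _).trans ?_)
  rw [e1, e2, e3, e4]
  rfl

end Bar

/-! ### Alternating maps from bilinear maps -/

section Alternating

variable {k V P : Type*} [Field k] [AddCommGroup V] [Module k V] [AddCommGroup P] [Module k P]

/-- The alternating map `(v, w) ↦ B(v, w) - B(w, v)`. -/
def antisymmetrize (B : V →ₗ[k] V →ₗ[k] P) : V [⋀^Fin 2]→ₗ[k] P :=
  MultilinearMap.alternatization (MultilinearMap.mk' (fun v => B (v 0) (v 1))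
    (by intro a i x y; fin_cases i <;> simp) (by intro a i x y; fin_cases i <;> simp))

theorem antisymmetrize_apply (B : V →ₗ[k] V →ₗ[k] P) (v : Fin 2 → V) :
    antisymmetrize B v = B (v 0) (v 1) - B (v 1) (v 0) := by
  have hu : (Finset.univ : Finset (Equiv.Perm (Fin 2))) = {1, Equiv.swap 0 1} := by decide
  rw [antisymmetrize, MultilinearMap.alternatization_apply, hu, Finset.sum_insert (by decide),
    Finset.sum_singleton]
  simp [sub_eq_add_neg]

variable {A : Type*} [Ring A] [Algebra k A]

/-- `v ↦ g ⊗ v - ᵍv ⊗ g` -/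
def shuffleOneOne (g : A) (ν μ : V →ₗ[k] A) : V →ₗ[k] ⨂[k]^2 A :=
  pair k A g ∘ₗ ν - (pair k A).flip g ∘ₗ μ

/-- `v ↦ g ⊗ h ⊗ v - g ⊗ ʰv ⊗ h + ᵍʰv ⊗ g ⊗ h` -/
def shuffleTwoOne (g h : A) (ν μ ξ : V →ₗ[k] A) : V →ₗ[k] ⨂[k]^3 A :=
  triple k A g h ∘ₗ ν - (triple k A g).flip h ∘ₗ μ
    + LinearMap.applyₗ h ∘ₗ (triple k A).flip g ∘ₗ ξ

/-- `(v, w) ↦ g ⊗ v ⊗ w + ᵍv ⊗ ᵍw ⊗ g - ᵍv ⊗ g ⊗ w` -/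
def shuffleOneTwo (g : A) (ν μ : V →ₗ[k] A) : V →ₗ[k] V →ₗ[k] ⨂[k]^3 A :=
  (triple k A g).compl₁₂ ν ν + ((triple k A).compr₂ (LinearMap.applyₗ g)).compl₁₂ μ μ
    - ((triple k A).flip g).compl₁₂ μ ν

/-- `(v_1, …, v_n) ↦ ∑_σ sgn(σ) v_{σ(1)} ⊗ ⋯ ⊗ v_{σ(n)}` -/
def shuffleZero (n : ℕ) (ν : V →ₗ[k] A) : V [⋀^Fin n]→ₗ[k] ⨂[k]^n A :=
  MultilinearMap.alternatization ((PiTensorProduct.tprod k).compLinearMap fun _ => ν)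

/-- The signed sums of the shuffles of `g_1 ⊗ ⋯ ⊗ g_i` and `v_1 ∧ ⋯ ∧ v_j` in `A^{⊗n}` for
`n = i + j ≤ 3`, with `γ` and `ν` for the inclusions of group elements and vectors, and with `μ g v`
for the vector `ᵍv`. -/
def shuffle {G : Type*} [Mul G] (γ : G → A) (ν : V →ₗ[k] A) (μ : G → V →ₗ[k] A) :
    (n i j : ℕ) → (Fin i → G) → V [⋀^Fin j]→ₗ[k] ⨂[k]^n A
  | 0, 0, 0, _ => AlternatingMap.constOfIsEmpty k V (Fin 0) (PiTensorProduct.tprod k ![])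
  | 1, 1, 0, g => AlternatingMap.constOfIsEmpty k V (Fin 0) (one k A (γ (g 0)))
  | 1, 0, 1, _ => AlternatingMap.ofSubsingleton k V _ 0 (one k A ∘ₗ ν)
  | 2, 2, 0, g => AlternatingMap.constOfIsEmpty k V (Fin 0) (pair k A (γ (g 0)) (γ (g 1)))
  | 2, 1, 1, g => AlternatingMap.ofSubsingleton k V _ 0 (shuffleOneOne (γ (g 0)) ν (μ (g 0)))
  | 2, 0, 2, _ => antisymmetrize ((pair k A).compl₁₂ ν ν)
  | 3, 3, 0, g => AlternatingMap.constOfIsEmpty k V (Fin 0)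
      (triple k A (γ (g 0)) (γ (g 1)) (γ (g 2)))
  | 3, 2, 1, g => AlternatingMap.ofSubsingleton k V _ 0
      (shuffleTwoOne (γ (g 0)) (γ (g 1)) ν (μ (g 1)) (μ (g 0 * g 1)))
  | 3, 1, 2, g => antisymmetrize (shuffleOneTwo (γ (g 0)) ν (μ (g 0)))
  | 3, 0, 3, _ => shuffleZero 3 ν
  | _, _, _, _ => 0

section Values

variable {G : Type*} [Mul G] (γ : G → A) (ν : V →ₗ[k] A) (μ : G → V →ₗ[k] A)

theorem shuffle_zero : freeIncl k A (shuffle γ ν μ 0 0 0 ![] ![]) = barGen k ![] := rfl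

theorem shuffle_one_zero (g : G) :
    freeIncl k A (shuffle γ ν μ 1 1 0 ![g] ![]) = barGen k ![γ g] := rfl

theorem shuffle_zero_one (v : V) :
    freeIncl k A (shuffle γ ν μ 1 0 1 ![] ![v]) = barGen k ![ν v] := rfl

theorem shuffle_two_zero (g h : G) :
    freeIncl k A (shuffle γ ν μ 2 2 0 ![g, h] ![]) = barGen k ![γ g, γ h] := rfl

theorem shuffle_one_one (g : G) (v : V) : freeIncl k A (shuffle γ ν μ 2 1 1 ![g] ![v]) =
    barGen k ![γ g, ν v] - barGen k ![μ g v, γ g] := by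
  change freeIncl k A (pair k A (γ g) (ν v) - pair k A (μ g v) (γ g)) = _
  rw [map_sub]
  rfl

theorem shuffle_zero_two (v w : V) : freeIncl k A (shuffle γ ν μ 2 0 2 ![] ![v, w]) =
    barGen k ![ν v, ν w] - barGen k ![ν w, ν v] :=
  (congrArg _ (antisymmetrize_apply _ _)).trans (map_sub _ _ _)

theorem shuffle_three_zero (g h l : G) :
    freeIncl k A (shuffle γ ν μ 3 3 0 ![g, h, l] ![]) = barGen k ![γ g, γ h, γ l] := rfl

theorem shuffle_two_one (g h : G) (v : V) : freeIncl k A (shuffle γ ν μ 3 2 1 ![g, h] ![v]) =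
    barGen k ![γ g, γ h, ν v] - barGen k ![γ g, μ h v, γ h]
      + barGen k ![μ (g * h) v, γ g, γ h] := by
  change freeIncl k A (triple k A (γ g) (γ h) (ν v) - triple k A (γ g) (μ h v) (γ h)
    + triple k A (μ (g * h) v) (γ g) (γ h)) = _
  rw [map_add, map_sub]
  rfl

theorem shuffle_one_two (g : G) (v w : V) : freeIncl k A (shuffle γ ν μ 3 1 2 ![g] ![v, w]) =
    barGen k ![γ g, ν v, ν w] - barGen k ![γ g, ν w, ν v] + barGen k ![μ g v, μ g w, γ g]
      - barGen k ![μ g w, μ g v, γ g] - barGen k ![μ g v, γ g, ν w]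
      + barGen k ![μ g w, γ g, ν v] := by
  refine (congrArg (freeIncl k A) (antisymmetrize_apply
    (shuffleOneTwo (γ g) ν (μ g)) ![v, w])).trans ?_
  change freeIncl k A (triple k A (γ g) (ν v) (ν w) + triple k A (μ g v) (μ g w) (γ g)
    - triple k A (μ g v) (γ g) (ν w) - (triple k A (γ g) (ν w) (ν v)
    + triple k A (μ g w) (μ g v) (γ g) - triple k A (μ g w) (γ g) (ν v))) = _
  simp only [map_add, map_sub, barGen, triple_apply]
  abel

theorem shuffle_zero_three (v : Fin 3 → V) : freeIncl k A (shuffle γ ν μ 3 0 3 ![] v) =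
    ∑ s : Equiv.Perm (Fin 3), (Equiv.Perm.sign s : ℤ) • barGen k (fun i => ν (v (s i))) := by
  refine (congrArg _ (MultilinearMap.alternatization_apply _ _)).trans ?_
  rw [map_sum]
  refine Finset.sum_congr rfl fun s _ => ?_
  rw [Units.smul_def, map_zsmul]
  rfl

end Values

end Alternating

variable {k G V : Type*} [Field k] [Group G] [AddCommGroup V] [Module k V]
  [DistribMulAction G V] [SMulCommClass G k V]

/-! ### The map from `X` to the bar resolution -/

/-- A linear map on the generators of `X_n`, from its components. -/
def genLift {n : ℕ} {P : Type*} [AddCommGroup P] [Module k P]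
    (F : (i j : ℕ) → i + j = n → (Fin i → G) → V [⋀^Fin j]→ₗ[k] P) : XGenTot k G V n →ₗ[k] P :=
  DirectSum.toModule k _ _ fun p => Finsupp.lsum k fun g =>
    exteriorPower.alternatingMapLinearEquiv (F p.1.1 p.1.2 p.2 g)

theorem genLift_gen {n : ℕ} {P : Type*} [AddCommGroup P] [Module k P]
    (F : (i j : ℕ) → i + j = n → (Fin i → G) → V [⋀^Fin j]→ₗ[k] P) {i j : ℕ} (h : i + j = n)
    (g : Fin i → G) (v : Fin j → V) : genLift F (gen k h g v) = F i j h g v := by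
  rw [genLift, gen, genIncl, LinearMap.comp_apply, DirectSum.toModule_lof]
  simp

variable (k V) in
/-- The composition of the action of `g` and the inclusion `V ⊆ A`. -/
def vecSMul (g : G) : V →ₗ[k] Skew k G V := vec k G ∘ₗ DistribSMul.toLinearMap k V g

variable (k G V) in
/-- The map from `X_n` to the bar resolution on generators. -/
def phiGen (n : ℕ) : XGenTot k G V n →ₗ[k] ⨂[k]^n (Skew k G V) :=
  genLift fun i j _ => shuffle (grp k V) (vec k G) (vecSMul k V) n i j

variable (k G V) in
/-- The map from `X_n` to the bar resolution. -/
def phiMap (n : ℕ) : X k G V n →ₗ[k] Bar k (Skew k G V) n :=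
  biExtend (freeAct k (Skew k G V) _) (freeIncl k (Skew k G V) ∘ₗ phiGen k G V n)

theorem phiMap_xAct (n : ℕ) (a b : Skew k G V) (x : X k G V n) :
    phiMap k G V n (xAct k G V n a b x) = freeAct k _ _ a b (phiMap k G V n x) :=
  biExtend_freeAct _ (fun a b c d x => freeAct_freeAct a b c d x) _ a b x

theorem phiMap_xGen {n i j : ℕ} (h : i + j = n) (g : Fin i → G) (v : Fin j → V) :
    phiMap k G V n (xGen k h g v) =
      freeIncl k (Skew k G V) (shuffle (grp k V) (vec k G) (vecSMul k V) n i j g v) := by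
  rw [phiMap, xGen_eq, biExtend_freeIncl _ freeAct_one, LinearMap.comp_apply, phiGen, genLift_gen]

theorem phiMap_zero : phiMap k G V 0 (xGen (i := 0) (j := 0) k rfl ![] ![]) = barGen k ![] :=
  (phiMap_xGen _ _ _).trans (shuffle_zero _ _ _)

theorem phiMap_one_zero (g : G) :
    phiMap k G V 1 (xGen (i := 1) (j := 0) k rfl ![g] ![]) = barGen k ![grp k V g] :=
  (phiMap_xGen _ _ _).trans (shuffle_one_zero _ _ _ g)

theorem phiMap_zero_one (v : V) :
    phiMap k G V 1 (xGen (i := 0) (j := 1) k rfl ![] ![v]) = barGen k ![vec k G v] :=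
  (phiMap_xGen _ _ _).trans (shuffle_zero_one _ _ _ v)

theorem phiMap_two_zero (g h : G) : phiMap k G V 2 (xGen (i := 2) (j := 0) k rfl ![g, h] ![]) =
    barGen k ![grp k V g, grp k V h] :=
  (phiMap_xGen _ _ _).trans (shuffle_two_zero _ _ _ g h)

theorem phiMap_one_one (g : G) (v : V) :
    phiMap k G V 2 (xGen (i := 1) (j := 1) k rfl ![g] ![v]) =
    barGen k ![grp k V g, vec k G v] - barGen k ![vec k G (g • v), grp k V g] :=
  (phiMap_xGen _ _ _).trans (shuffle_one_one _ _ _ g v)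

theorem phiMap_zero_two (v w : V) : phiMap k G V 2 (xGen (i := 0) (j := 2) k rfl ![] ![v, w]) =
    barGen k ![vec k G v, vec k G w] - barGen k ![vec k G w, vec k G v] :=
  (phiMap_xGen _ _ _).trans (shuffle_zero_two _ _ _ v w)

theorem phiMap_three_zero (g h l : G) :
    phiMap k G V 3 (xGen (i := 3) (j := 0) k rfl ![g, h, l] ![]) =
    barGen k ![grp k V g, grp k V h, grp k V l] :=
  (phiMap_xGen _ _ _).trans (shuffle_three_zero _ _ _ g h l)

theorem phiMap_two_one (g h : G) (v : V) :
    phiMap k G V 3 (xGen (i := 2) (j := 1) k rfl ![g, h] ![v]) =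
    barGen k ![grp k V g, grp k V h, vec k G v] - barGen k ![grp k V g, vec k G (h • v), grp k V h]
      + barGen k ![vec k G ((g * h) • v), grp k V g, grp k V h] :=
  (phiMap_xGen _ _ _).trans (shuffle_two_one _ _ _ g h v)

theorem phiMap_one_two (g : G) (v w : V) :
    phiMap k G V 3 (xGen (i := 1) (j := 2) k rfl ![g] ![v, w]) =
    barGen k ![grp k V g, vec k G v, vec k G w] - barGen k ![grp k V g, vec k G w, vec k G v]
      + barGen k ![vec k G (g • v), vec k G (g • w), grp k V g]
      - barGen k ![vec k G (g • w), vec k G (g • v), grp k V g]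
      - barGen k ![vec k G (g • v), grp k V g, vec k G w]
      + barGen k ![vec k G (g • w), grp k V g, vec k G v] :=
  (phiMap_xGen _ _ _).trans (shuffle_one_two _ _ _ g v w)

theorem phiMap_zero_three (v : Fin 3 → V) :
    phiMap k G V 3 (xGen (i := 0) (j := 3) k rfl ![] v) =
    ∑ s : Equiv.Perm (Fin 3), (Equiv.Perm.sign s : ℤ) • barGen k (fun i => vec k G (v (s i))) :=
  (phiMap_xGen _ _ _).trans (shuffle_zero_three _ _ _ v)

end

noncomputable section

/-! ### The differential on generators in low degrees -/

section Signs

variable {R M : Type*} [CommRing R] [AddCommGroup M] [Module R M]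

theorem sum_signs_one_one (a r : M) (c : Fin 0 → M) (f : Fin 1 → M) :
    a + ∑ l : Fin 0, (-1 : R) ^ (l.val + 1) • c l + (-1 : R) ^ (0 + 1) • r
      + (-1 : R) ^ (0 + 1) • ∑ l : Fin 1, (-1 : ℤ) ^ l.val • f l = a - r - f 0 := by
  simp; abel

theorem sum_signs_zero_two (f : Fin 2 → M) :
    (-1 : R) ^ 0 • ∑ l : Fin 2, (-1 : ℤ) ^ l.val • f l = f 0 - f 1 := by
  rw [Fin.sum_univ_two]; simp; abel

theorem sum_signs_zero_one (f : Fin 1 → M) :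
    (-1 : R) ^ 0 • ∑ l : Fin 1, (-1 : ℤ) ^ l.val • f l = f 0 := by
  simp

end Signs

section Combinations

variable {k P Q : Type*} [Ring k] [AddCommGroup P] [Module k P] [AddCommGroup Q] [Module k Q]
  (f : P →ₗ[k] Q) {a b : P} {c d : Q}

theorem map_sub_of_eq (ha : f a = c) (hb : f b = d) : f (a - b) = c - d := by
  rw [map_sub, ha, hb]

theorem map_add_of_eq (ha : f a = c) (hb : f b = d) : f (a + b) = c + d := by
  rw [map_add, ha, hb]

end Combinations

section Bar

variable {k A : Type*} [Field k] [Ring A] [Algebra k A]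

/-- In this and the following computations the products of neighbouring factors cancel or combine by
the stated commutation rules alone, so the elements of A can be arbitrary. What remains has the
shape of φ applied to the differential of X. -/
theorem barD_shuffle_two_zero (g h p : A) (e : g * h = p) : barD k A 1 (barGen k ![g, h]) =
    freeAct k A _ g 1 (barGen k ![h]) - barGen k ![p] + freeAct k A _ 1 h (barGen k ![g]) :=
  e ▸ barD_one g h

theorem barD_shuffle_one_one (g v w : A) (e : g * v = w * g) :
    barD k A 1 (barGen k ![g, v] - barGen k ![w, g]) =
      freeAct k A _ g 1 (barGen k ![v]) - freeAct k A _ 1 g (barGen k ![w])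
        - (freeAct k A _ w 1 (barGen k ![g]) - freeAct k A _ 1 v (barGen k ![g])) := by
  rw [map_sub, barD_one, barD_one, e]
  abel

theorem barD_shuffle_zero_two (v w : A) (e : v * w = w * v) :
    barD k A 1 (barGen k ![v, w] - barGen k ![w, v]) =
      freeAct k A _ v 1 (barGen k ![w]) - freeAct k A _ 1 v (barGen k ![w])
        - (freeAct k A _ w 1 (barGen k ![v]) - freeAct k A _ 1 w (barGen k ![v])) := by
  rw [map_sub, barD_one, barD_one, e]
  abel

theorem barD_shuffle_three_zero (g h l p q : A) (e : g * h = p) (e' : h * l = q) :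
    barD k A 2 (barGen k ![g, h, l]) = freeAct k A _ g 1 (barGen k ![h, l]) - barGen k ![p, l]
      + barGen k ![g, q] - freeAct k A _ 1 l (barGen k ![g, h]) := by
  rw [barD_two, e, e']

theorem barD_shuffle_two_one (g h p v v' v'' : A) (e : g * h = p) (e' : h * v = v' * h)
    (e'' : g * v' = v'' * g) :
    barD k A 2 (barGen k ![g, h, v] - barGen k ![g, v', h] + barGen k ![v'', g, h]) =
      freeAct k A _ g 1 (barGen k ![h, v] - barGen k ![v', h])
        - (barGen k ![p, v] - barGen k ![v'', p])
        + freeAct k A _ 1 h (barGen k ![g, v'] - barGen k ![v'', g])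
        + (freeAct k A _ v'' 1 (barGen k ![g, h]) - freeAct k A _ 1 v (barGen k ![g, h])) := by
  simp only [map_add, map_sub, barD_two, e, e', e'']
  abel

theorem barD_shuffle_one_two (g v w v' w' : A) (e : g * v = v' * g) (e' : g * w = w' * g)
    (h : v * w = w * v) (h' : v' * w' = w' * v') :
    barD k A 2 (barGen k ![g, v, w] - barGen k ![g, w, v] + barGen k ![v', w', g]
        - barGen k ![w', v', g] - barGen k ![v', g, w] + barGen k ![w', g, v]) =
      freeAct k A _ g 1 (barGen k ![v, w] - barGen k ![w, v])
        - freeAct k A _ 1 g (barGen k ![v', w'] - barGen k ![w', v'])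
        - (freeAct k A _ v' 1 (barGen k ![g, w] - barGen k ![w', g])
          - freeAct k A _ 1 v (barGen k ![g, w] - barGen k ![w', g])
          - (freeAct k A _ w' 1 (barGen k ![g, v] - barGen k ![v', g])
          - freeAct k A _ 1 w (barGen k ![g, v] - barGen k ![v', g]))) := by
  simp only [map_add, map_sub, barD_two, e, e', h, h']
  abel

theorem barD_shuffle_zero_three (c : Fin 3 → A) (h : ∀ i j, c i * c j = c j * c i) :
    barD k A 2 (∑ s : Equiv.Perm (Fin 3),
        (Equiv.Perm.sign s : ℤ) • barGen k (fun i => c (s i))) =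
      (freeAct k A _ (c 0) 1 (barGen k ![c 1, c 2] - barGen k ![c 2, c 1])
          - freeAct k A _ 1 (c 0) (barGen k ![c 1, c 2] - barGen k ![c 2, c 1]))
        - (freeAct k A _ (c 1) 1 (barGen k ![c 0, c 2] - barGen k ![c 2, c 0])
          - freeAct k A _ 1 (c 1) (barGen k ![c 0, c 2] - barGen k ![c 2, c 0]))
        + (freeAct k A _ (c 2) 1 (barGen k ![c 0, c 1] - barGen k ![c 1, c 0])
          - freeAct k A _ 1 (c 2) (barGen k ![c 0, c 1] - barGen k ![c 1, c 0])) := by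
  have e (s : Equiv.Perm (Fin 3)) :
      barGen k (fun i => c (s i)) = barGen k ![c (s 0), c (s 1), c (s 2)] :=
    congrArg _ (by ext i; fin_cases i <;> rfl)
  simp only [e]
  rw [sum_perm_three fun i j l => barGen k ![c i, c j, c l]]
  simp only [map_add, map_sub, barD_two, h 1 0, h 2 0, h 2 1]
  abel

end Bar

variable {k G V : Type*} [Field k] [Group G] [AddCommGroup V] [Module k V]
  [DistribMulAction G V] [SMulCommClass G k V]

theorem xD_one_two_zero (g h : G) : xD k G V 1 (xGen k (i := 2) (j := 0) rfl ![g, h] ![])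
    = xAct k G V 1 (grp k V g) 1 (xGen k (i := 1) (j := 0) rfl ![h] ![])
      - xGen k (i := 1) (j := 0) rfl ![g * h] ![]
      + xAct k G V 1 1 (grp k V h) (xGen k (i := 1) (j := 0) rfl ![g] ![]) := by
  refine (xD_xGen_succ_zero 1 rfl ![g, h] _).trans ((sum_signs_two _ _ _).trans ?_)
  have e1 : Fin.tail ![g, h] = ![h] := by ext i; fin_cases i; rfl
  have e2 : Fin.contractNth (Fin.castSucc 0) (· * ·) ![g, h] = ![g * h] := by
    ext i; fin_cases i; rfl
  have e4 : Fin.init ![g, h] = ![g] := by ext i; fin_cases i; rfl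
  have e5 : (fun l => ![g, h] (Fin.last 1) • (![] : Fin 0 → V) l) = ![] := Subsingleton.elim _ _
  simp only [e1, e2, e4, e5]
  rfl

theorem xD_one_one_one (g : G) (v : V) : xD k G V 1 (xGen k (i := 1) (j := 1) rfl ![g] ![v])
    = xAct k G V 1 (grp k V g) 1 (xGen k (i := 0) (j := 1) rfl ![] ![v])
      - xAct k G V 1 1 (grp k V g) (xGen k (i := 0) (j := 1) rfl ![] ![g • v])
      - (xAct k G V 1 (vec k G (g • v)) 1 (xGen k (i := 1) (j := 0) rfl ![g] ![])
        - xAct k G V 1 1 (vec k G v) (xGen k (i := 1) (j := 0) rfl ![g] ![])) := by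
  refine (xD_xGen_succ_succ (i := 0) (j := 0) 1 rfl ![g] ![v]).trans
    ((sum_signs_one_one _ _ _ _).trans ?_)
  have e1 : Fin.tail ![g] = ![] := Subsingleton.elim _ _
  have e4 : Fin.init ![g] = ![] := Subsingleton.elim _ _
  have e5 : (fun l => ![g] (Fin.last 0) • ![v] l) = ![g • v] := by ext i; fin_cases i; rfl
  have e6 : Fin.removeNth 0 ![v] = ![] := Subsingleton.elim _ _
  have e7 : (List.ofFn ![g]).prod = g := by simp
  simp only [e1, e4, e5, e6, e7]
  rfl

theorem xD_one_zero_two (v w : V) : xD k G V 1 (xGen k (i := 0) (j := 2) rfl ![] ![v, w])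
    = (xAct k G V 1 (vec k G v) 1 (xGen k (i := 0) (j := 1) rfl ![] ![w])
        - xAct k G V 1 1 (vec k G v) (xGen k (i := 0) (j := 1) rfl ![] ![w]))
      - (xAct k G V 1 (vec k G w) 1 (xGen k (i := 0) (j := 1) rfl ![] ![v])
        - xAct k G V 1 1 (vec k G w) (xGen k (i := 0) (j := 1) rfl ![] ![v])) := by
  refine (xD_xGen_zero_succ 1 rfl ![] ![v, w]).trans ((sum_signs_zero_two _).trans ?_)
  have e6 : Fin.removeNth 0 ![v, w] = ![w] := by ext i; fin_cases i; rfl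
  have e7 : Fin.removeNth 1 ![v, w] = ![v] := by ext i; fin_cases i; rfl
  simp only [e6, e7, List.ofFn_zero, List.prod_nil, one_smul]
  rfl

theorem xD_zero_one_zero (g : G) : xD k G V 0 (xGen k (i := 1) (j := 0) rfl ![g] ![])
    = xAct k G V 0 (grp k V g) 1 (xGen k (i := 0) (j := 0) rfl ![] ![])
      - xAct k G V 0 1 (grp k V g) (xGen k (i := 0) (j := 0) rfl ![] ![]) := by
  refine (xD_xGen_succ_zero 0 rfl ![g] _).trans ((sum_signs_one _ _ _).trans ?_)
  have e1 : Fin.tail ![g] = ![] := Subsingleton.elim _ _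
  have e4 : Fin.init ![g] = ![] := Subsingleton.elim _ _
  have e5 : (fun l => ![g] (Fin.last 0) • (![] : Fin 0 → V) l) = ![] := Subsingleton.elim _ _
  simp only [e1, e4, e5]
  rfl

theorem xD_zero_zero_one (v : V) : xD k G V 0 (xGen k (i := 0) (j := 1) rfl ![] ![v])
    = xAct k G V 0 (vec k G v) 1 (xGen k (i := 0) (j := 0) rfl ![] ![])
      - xAct k G V 0 1 (vec k G v) (xGen k (i := 0) (j := 0) rfl ![] ![]) := by
  refine (xD_xGen_zero_succ 0 rfl ![] ![v]).trans ((sum_signs_zero_one _).trans ?_)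
  have e6 : Fin.removeNth 0 ![v] = ![] := Subsingleton.elim _ _
  simp only [e6, List.ofFn_zero, List.prod_nil, one_smul]
  rfl

/-! ### Compatibility with the differentials and the gradings -/

theorem phiMap_comm_of_xGen (n : ℕ) (h : ∀ (i j : ℕ) (hij : i + j = n + 1) (g : Fin i → G)
    (v : Fin j → V), barD k (Skew k G V) n (phiMap k G V (n + 1) (xGen k hij g v)) =
      phiMap k G V n (xD k G V n (xGen k hij g v))) :
    barD k (Skew k G V) n ∘ₗ phiMap k G V (n + 1) = phiMap k G V n ∘ₗ xD k G V n := by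
  refine x_hom_ext fun a b i j hij g v => ?_
  rw [LinearMap.comp_apply, LinearMap.comp_apply, phiMap_xAct, barD_freeAct, h, xD_xAct,
    phiMap_xAct]

theorem phiMap_xAct_of_eq {n : ℕ} {x : X k G V n} {y : Bar k (Skew k G V) n}
    (h : phiMap k G V n x = y) (a b : Skew k G V) :
    phiMap k G V n (xAct k G V n a b x) = freeAct k _ _ a b y :=
  (phiMap_xAct n a b x).trans (congrArg _ h)

theorem phiMap_comm_zero :
    barD k (Skew k G V) 0 ∘ₗ phiMap k G V 1 = phiMap k G V 0 ∘ₗ xD k G V 0 := by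
  refine phiMap_comm_of_xGen 0 fun i j hij g v => ?_
  have hi : i ≤ 1 := by omega
  interval_cases i
  · obtain rfl : j = 1 := by omega
    obtain rfl := Subsingleton.elim ![] g
    obtain ⟨v, rfl⟩ : ∃ w, v = ![w] := ⟨v 0, by ext i; fin_cases i; rfl⟩
    exact ((congrArg _ (phiMap_zero_one v)).trans (barD_zero _)).trans
      ((congrArg _ (xD_zero_zero_one v)).trans (map_sub_of_eq (phiMap k G V 0)
        (phiMap_xAct_of_eq phiMap_zero _ _) (phiMap_xAct_of_eq phiMap_zero _ _))).symm
  · obtain rfl : j = 0 := by omega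
    obtain rfl := Subsingleton.elim ![] v
    obtain ⟨g, rfl⟩ : ∃ h, g = ![h] := ⟨g 0, by ext i; fin_cases i; rfl⟩
    exact ((congrArg _ (phiMap_one_zero g)).trans (barD_zero _)).trans
      ((congrArg _ (xD_zero_one_zero g)).trans (map_sub_of_eq (phiMap k G V 0)
        (phiMap_xAct_of_eq phiMap_zero _ _) (phiMap_xAct_of_eq phiMap_zero _ _))).symm

theorem phiMap_comm_one :
    barD k (Skew k G V) 1 ∘ₗ phiMap k G V 2 = phiMap k G V 1 ∘ₗ xD k G V 1 := by
  refine phiMap_comm_of_xGen 1 fun i j hij g v => ?_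
  have hi : i ≤ 2 := by omega
  interval_cases i
  · obtain rfl : j = 2 := by omega
    obtain rfl := Subsingleton.elim ![] g
    obtain ⟨v, w, rfl⟩ : ∃ a b, v = ![a, b] := ⟨v 0, v 1, by ext i; fin_cases i <;> rfl⟩
    have hv := phiMap_xAct_of_eq (phiMap_zero_one (k := k) (G := G) v)
    have hw := phiMap_xAct_of_eq (phiMap_zero_one (k := k) (G := G) w)
    exact ((congrArg _ (phiMap_zero_two v w)).trans (barD_shuffle_zero_two _ _
      (vec_mul_comm v w))).trans ((congrArg _ (xD_one_zero_two v w)).trans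
        (map_sub_of_eq (phiMap k G V 1) (map_sub_of_eq (phiMap k G V 1) (hw _ _) (hw _ _))
          (map_sub_of_eq (phiMap k G V 1) (hv _ _) (hv _ _)))).symm
  · obtain rfl : j = 1 := by omega
    obtain ⟨v, rfl⟩ : ∃ w, v = ![w] := ⟨v 0, by ext i; fin_cases i; rfl⟩
    obtain ⟨g, rfl⟩ : ∃ h, g = ![h] := ⟨g 0, by ext i; fin_cases i; rfl⟩
    have hv := phiMap_xAct_of_eq (phiMap_zero_one (k := k) (G := G) v)
    have hw := phiMap_xAct_of_eq (phiMap_zero_one (k := k) (G := G) (g • v))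
    have hg := phiMap_xAct_of_eq (phiMap_one_zero (k := k) (V := V) g)
    exact ((congrArg _ (phiMap_one_one g v)).trans (barD_shuffle_one_one _ _ _
      (grp_mul_vec g v))).trans ((congrArg _ (xD_one_one_one g v)).trans
        (map_sub_of_eq (phiMap k G V 1) (map_sub_of_eq (phiMap k G V 1) (hv _ _) (hw _ _))
          (map_sub_of_eq (phiMap k G V 1) (hg _ _) (hg _ _)))).symm
  · obtain rfl : j = 0 := by omega
    obtain rfl := Subsingleton.elim ![] v
    obtain ⟨g, h, rfl⟩ : ∃ a b, g = ![a, b] := ⟨g 0, g 1, by ext i; fin_cases i <;> rfl⟩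
    exact ((congrArg _ (phiMap_two_zero g h)).trans (barD_shuffle_two_zero _ _ _
      (grp_mul_grp g h))).trans ((congrArg _ (xD_one_two_zero g h)).trans
        (map_add_of_eq (phiMap k G V 1) (map_sub_of_eq (phiMap k G V 1)
          (phiMap_xAct_of_eq (phiMap_one_zero h) _ _) (phiMap_one_zero _))
          (phiMap_xAct_of_eq (phiMap_one_zero g) _ _))).symm

theorem phiMap_comm_two :
    barD k (Skew k G V) 2 ∘ₗ phiMap k G V 3 = phiMap k G V 2 ∘ₗ xD k G V 2 := by
  refine phiMap_comm_of_xGen 2 fun i j hij g v => ?_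
  have hi : i ≤ 3 := by omega
  interval_cases i
  · obtain rfl : j = 3 := by omega
    obtain rfl := Subsingleton.elim ![] g
    have h (i j) := phiMap_xAct_of_eq (phiMap_zero_two (k := k) (G := G) (v i) (v j))
    exact ((congrArg _ (phiMap_zero_three v)).trans (barD_shuffle_zero_three
      (fun i => vec k G (v i)) fun i j => vec_mul_comm _ _)).trans
      ((congrArg _ (xD_two_zero_three ![] v)).trans (map_add_of_eq (phiMap k G V 2)
        (map_sub_of_eq (phiMap k G V 2)
          (map_sub_of_eq (phiMap k G V 2) (h 1 2 _ _) (h 1 2 _ _))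
          (map_sub_of_eq (phiMap k G V 2) (h 0 2 _ _) (h 0 2 _ _)))
        (map_sub_of_eq (phiMap k G V 2) (h 0 1 _ _) (h 0 1 _ _)))).symm
  · obtain rfl : j = 2 := by omega
    obtain ⟨v, w, rfl⟩ : ∃ a b, v = ![a, b] := ⟨v 0, v 1, by ext i; fin_cases i <;> rfl⟩
    obtain ⟨g, rfl⟩ : ∃ h, g = ![h] := ⟨g 0, by ext i; fin_cases i; rfl⟩
    have hv := phiMap_xAct_of_eq (phiMap_one_one (k := k) g v)
    have hw := phiMap_xAct_of_eq (phiMap_one_one (k := k) g w)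
    exact ((congrArg _ (phiMap_one_two g v w)).trans (barD_shuffle_one_two _ _ _ _ _
      (grp_mul_vec g v) (grp_mul_vec g w) (vec_mul_comm v w) (vec_mul_comm _ _))).trans
      ((congrArg _ (xD_two_one_two ![g] ![v, w])).trans (map_sub_of_eq (phiMap k G V 2)
        (map_sub_of_eq (phiMap k G V 2) (phiMap_xAct_of_eq (phiMap_zero_two _ _) _ _)
          (phiMap_xAct_of_eq (phiMap_zero_two _ _) _ _))
        (map_sub_of_eq (phiMap k G V 2)
          (map_sub_of_eq (phiMap k G V 2) (hw _ _) (hw _ _))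
          (map_sub_of_eq (phiMap k G V 2) (hv _ _) (hv _ _))))).symm
  · obtain rfl : j = 1 := by omega
    obtain ⟨v, rfl⟩ : ∃ w, v = ![w] := ⟨v 0, by ext i; fin_cases i; rfl⟩
    obtain ⟨g, h, rfl⟩ : ∃ a b, g = ![a, b] := ⟨g 0, g 1, by ext i; fin_cases i <;> rfl⟩
    have hgh := phiMap_xAct_of_eq (phiMap_two_zero (k := k) (V := V) g h)
    -- The formula for φ_3 involves the vector moved by gh, whereas the cross relation moves it by h
    -- and then by g.
    have e : grp k V g * vec k G (h • v) = vec k G ((g * h) • v) * grp k V g := by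
      rw [grp_mul_vec, mul_smul]
    have e' : phiMap k G V 2 (xGen (i := 1) (j := 1) k rfl ![g] ![h • v]) =
        barGen k ![grp k V g, vec k G (h • v)] - barGen k ![vec k G ((g * h) • v), grp k V g] := by
      rw [mul_smul]
      exact phiMap_one_one g (h • v)
    exact ((congrArg _ (phiMap_two_one g h v)).trans (barD_shuffle_two_one _ _ _ _ _ _
      (grp_mul_grp g h) (grp_mul_vec h v) e)).trans
      ((congrArg _ (xD_two_two_one ![g, h] ![v])).trans (map_add_of_eq (phiMap k G V 2)
        (map_add_of_eq (phiMap k G V 2) (map_sub_of_eq (phiMap k G V 2)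
          (phiMap_xAct_of_eq (phiMap_one_one h v) _ _) (phiMap_one_one (g * h) v))
          (phiMap_xAct_of_eq e' _ _))
        (map_sub_of_eq (phiMap k G V 2) (hgh _ _) (hgh _ _)))).symm
  · obtain rfl : j = 0 := by omega
    obtain rfl := Subsingleton.elim ![] v
    obtain ⟨g, h, l, rfl⟩ : ∃ a b c, g = ![a, b, c] :=
      ⟨g 0, g 1, g 2, by ext i; fin_cases i <;> rfl⟩
    exact ((congrArg _ (phiMap_three_zero g h l)).trans (barD_shuffle_three_zero _ _ _ _ _
      (grp_mul_grp g h) (grp_mul_grp h l))).trans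
      ((congrArg _ (xD_two_three_zero ![g, h, l] ![])).trans (map_sub_of_eq (phiMap k G V 2)
        (map_add_of_eq (phiMap k G V 2) (map_sub_of_eq (phiMap k G V 2)
          (phiMap_xAct_of_eq (phiMap_two_zero h l) _ _) (phiMap_two_zero _ _))
          (phiMap_two_zero _ _)) (phiMap_xAct_of_eq (phiMap_two_zero g h) _ _))).symm

theorem barGen_mem_barDeg {n d : ℕ} {x : Fin n → Skew k G V} (c : Fin n → ℕ)
    (hx : ∀ i, x i ∈ skewDeg k G V (c i)) (hd : ∑ i, c i = d) :
    barGen k x ∈ barDeg k G V n d :=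
  Submodule.subset_span ⟨x, c, 0, 0, hx, 1, one_mem_skewDeg, 1, one_mem_skewDeg, by omega,
    (freeAct_one _).symm⟩

theorem barGen_one_mem {d : ℕ} {a : Skew k G V} (ha : a ∈ skewDeg k G V d) :
    barGen k ![a] ∈ barDeg k G V 1 d :=
  barGen_mem_barDeg ![d] (by intro i; fin_cases i; exact ha) (by simp)

theorem barGen_two_mem {p q d : ℕ} {a b : Skew k G V} (ha : a ∈ skewDeg k G V p)
    (hb : b ∈ skewDeg k G V q) (h : p + q = d) : barGen k ![a, b] ∈ barDeg k G V 2 d :=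
  barGen_mem_barDeg ![p, q] (by intro i; fin_cases i; exacts [ha, hb])
    (by rw [Fin.sum_univ_two]; exact h)

theorem barGen_three_mem {p q r d : ℕ} {a b c : Skew k G V} (ha : a ∈ skewDeg k G V p)
    (hb : b ∈ skewDeg k G V q) (hc : c ∈ skewDeg k G V r) (h : p + q + r = d) :
    barGen k ![a, b, c] ∈ barDeg k G V 3 d :=
  barGen_mem_barDeg ![p, q, r] (by intro i; fin_cases i; exacts [ha, hb, hc])
    (by rw [Fin.sum_univ_three]; exact h)

theorem phiMap_xGen_mem (n i j : ℕ) (hij : i + j = n) (g : Fin i → G) (v : Fin j → V) :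
    phiMap k G V n (xGen k hij g v) ∈ barDeg k G V n j := by
  have G0 := grp_mem_skewDeg (k := k) (G := G) (V := V)
  have V1 := vec_mem_skewDeg (k := k) (G := G) (V := V)
  obtain rfl | rfl | rfl | rfl | ⟨m, rfl⟩ : n = 0 ∨ n = 1 ∨ n = 2 ∨ n = 3 ∨ ∃ m, n = m + 4 := by
    rcases lt_or_ge n 4 with h | h
    · omega
    · exact .inr (.inr (.inr (.inr ⟨n - 4, by omega⟩)))
  · obtain rfl : i = 0 := by omega
    obtain rfl : j = 0 := by omega
    rw [Subsingleton.elim g ![], Subsingleton.elim v ![]]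
    refine (phiMap_zero (k := k) (G := G) (V := V)).symm ▸ ?_
    exact barGen_mem_barDeg ![] (fun i => i.elim0) (by simp)
  · have hi : i ≤ 1 := by omega
    interval_cases i
    · obtain rfl : j = 1 := by omega
      obtain rfl := Subsingleton.elim ![] g
      obtain ⟨v, rfl⟩ : ∃ w, v = ![w] := ⟨v 0, by ext i; fin_cases i; rfl⟩
      exact (phiMap_zero_one (k := k) (G := G) v).symm ▸ barGen_one_mem (V1 v)
    · obtain rfl : j = 0 := by omega
      obtain rfl := Subsingleton.elim ![] v
      obtain ⟨g, rfl⟩ : ∃ h, g = ![h] := ⟨g 0, by ext i; fin_cases i; rfl⟩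
      exact (phiMap_one_zero (k := k) (V := V) g).symm ▸ barGen_one_mem (G0 g)
  · have hi : i ≤ 2 := by omega
    interval_cases i
    · obtain rfl : j = 2 := by omega
      obtain rfl := Subsingleton.elim ![] g
      obtain ⟨v, w, rfl⟩ : ∃ a b, v = ![a, b] := ⟨v 0, v 1, by ext i; fin_cases i <;> rfl⟩
      exact (phiMap_zero_two (k := k) (G := G) v w).symm ▸
        sub_mem (barGen_two_mem (V1 v) (V1 w) rfl)
        (barGen_two_mem (V1 w) (V1 v) rfl)
    · obtain rfl : j = 1 := by omega
      obtain ⟨v, rfl⟩ : ∃ w, v = ![w] := ⟨v 0, by ext i; fin_cases i; rfl⟩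
      obtain ⟨g, rfl⟩ : ∃ h, g = ![h] := ⟨g 0, by ext i; fin_cases i; rfl⟩
      exact (phiMap_one_one (k := k) g v).symm ▸ sub_mem (barGen_two_mem (G0 g) (V1 v) rfl)
        (barGen_two_mem (V1 _) (G0 g) rfl)
    · obtain rfl : j = 0 := by omega
      obtain rfl := Subsingleton.elim ![] v
      obtain ⟨g, h, rfl⟩ : ∃ a b, g = ![a, b] := ⟨g 0, g 1, by ext i; fin_cases i <;> rfl⟩
      exact (phiMap_two_zero (k := k) (V := V) g h).symm ▸ barGen_two_mem (G0 g) (G0 h) rfl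
  · have hi : i ≤ 3 := by omega
    interval_cases i
    · obtain rfl : j = 3 := by omega
      obtain rfl := Subsingleton.elim ![] g
      refine (phiMap_zero_three (k := k) (G := G) v).symm ▸
        Submodule.sum_mem _ fun s _ => zsmul_mem ?_ _
      exact barGen_mem_barDeg (fun _ => 1) (fun i => V1 _) (by simp)
    · obtain rfl : j = 2 := by omega
      obtain ⟨v, w, rfl⟩ : ∃ a b, v = ![a, b] := ⟨v 0, v 1, by ext i; fin_cases i <;> rfl⟩
      obtain ⟨g, rfl⟩ : ∃ h, g = ![h] := ⟨g 0, by ext i; fin_cases i; rfl⟩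
      have h1 (a b) := barGen_three_mem (G0 g) (V1 a) (V1 b) (d := 2) rfl
      have h2 (a b) := barGen_three_mem (V1 a) (V1 b) (G0 g) (d := 2) rfl
      have h3 (a b) := barGen_three_mem (V1 a) (G0 g) (V1 b) (d := 2) rfl
      exact (phiMap_one_two (k := k) g v w).symm ▸ add_mem (sub_mem (sub_mem (add_mem (sub_mem
        (h1 _ _) (h1 _ _)) (h2 _ _)) (h2 _ _)) (h3 _ _)) (h3 _ _)
    · obtain rfl : j = 1 := by omega
      obtain ⟨v, rfl⟩ : ∃ w, v = ![w] := ⟨v 0, by ext i; fin_cases i; rfl⟩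
      obtain ⟨g, h, rfl⟩ : ∃ a b, g = ![a, b] := ⟨g 0, g 1, by ext i; fin_cases i <;> rfl⟩
      exact (phiMap_two_one (k := k) g h v).symm ▸ add_mem (sub_mem
        (barGen_three_mem (G0 g) (G0 h) (V1 v) rfl) (barGen_three_mem (G0 g) (V1 _) (G0 h) rfl))
        (barGen_three_mem (V1 _) (G0 g) (G0 h) rfl)
    · obtain rfl : j = 0 := by omega
      obtain rfl := Subsingleton.elim ![] v
      obtain ⟨g, h, l, rfl⟩ : ∃ a b c, g = ![a, b, c] :=
        ⟨g 0, g 1, g 2, by ext i; fin_cases i <;> rfl⟩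
      exact (phiMap_three_zero (k := k) (V := V) g h l).symm ▸
        barGen_three_mem (G0 g) (G0 h) (G0 l) rfl
  -- Above homological degree 3 the map is zero by definition, since no chain map property is
  -- required there.
  · have e : phiMap k G V (m + 4) (xGen k hij g v) = 0 :=
      (phiMap_xGen hij g v).trans (map_zero _)
    exact e.symm ▸ zero_mem _

theorem phiMap_mem_barDeg (n d : ℕ) (x : X k G V n) (hx : x ∈ xDeg k G V n d) :
    phiMap k G V n x ∈ barDeg k G V n d := by
  refine (Submodule.span_le (p := (barDeg k G V n d).comap (phiMap k G V n))).2 ?_ hx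
  rintro _ ⟨i, j, h, g, v, p, q, a, ha, b, hb, rfl, rfl⟩
  rw [SetLike.mem_coe, Submodule.mem_comap, phiMap_xAct]
  refine (Submodule.span_le (p := (barDeg k G V n (p + j + q)).comap
    (freeAct k (Skew k G V) _ a b))).2 ?_ (phiMap_xGen_mem n i j h g v)
  rintro _ ⟨y, c, p', q', hy, a', ha', b', hb', rfl, rfl⟩
  rw [SetLike.mem_coe, Submodule.mem_comap, freeAct_freeAct]
  exact Submodule.subset_span ⟨y, c, p + p', q' + q, hy, a * a', mul_mem_skewDeg ha ha',
    b' * b, mul_mem_skewDeg hb' hb, by omega, rfl⟩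

end

noncomputable section

/-! ### Derivations -/

section Derivation

variable {k A Q : Type*} [Field k] [Ring A] [Algebra k A] [AddCommGroup Q] [Module k Q]

/-- For a bimodule `Q`, the left action of `(a, x)` in the square zero extension `A × Q` on that
extension. -/
def extensionMul (β : A →ₗ[k] A →ₗ[k] Q →ₗ[k] Q) : A × Q →ₗ[k] Module.End k (A × Q) :=
  LinearMap.mk₂ k (fun s t => (s.1 * t.1, β s.1 1 t.2 + β 1 t.1 s.2))
    (fun s s' t => by
      ext
      · exact add_mul _ _ _
      · simp only [Prod.fst_add, Prod.snd_add, map_add, LinearMap.add_apply]; abel)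
    (fun c s t => by
      ext
      · exact smul_mul_assoc _ _ _
      · simp only [Prod.smul_fst, Prod.smul_snd, map_smul, LinearMap.smul_apply, smul_add])
    (fun s t t' => by
      ext
      · exact mul_add _ _ _
      · simp only [Prod.fst_add, Prod.snd_add, map_add, LinearMap.add_apply]; abel)
    (fun c s t => by
      ext
      · exact mul_smul_comm _ _ _
      · simp only [Prod.smul_fst, Prod.smul_snd, map_smul, LinearMap.smul_apply, smul_add])

variable (β : A →ₗ[k] A →ₗ[k] Q →ₗ[k] Q)

theorem extensionMul_apply (s t : A × Q) :
    extensionMul β s t = (s.1 * t.1, β s.1 1 t.2 + β 1 t.1 s.2) := rfl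

theorem extensionMul_mul (hβ : ∀ a b a' b' x, β a b (β a' b' x) = β (a * a') (b' * b) x)
    (s t : A × Q) : extensionMul β s * extensionMul β t =
      extensionMul β (s.1 * t.1, β s.1 1 t.2 + β 1 t.1 s.2) := by
  refine LinearMap.ext fun u => ?_
  rw [Module.End.mul_apply, extensionMul_apply, extensionMul_apply, extensionMul_apply]
  ext
  · exact (mul_assoc _ _ _).symm
  · simp only [map_add, hβ, mul_one, one_mul]
    abel

/-- Derivations into Q correspond to algebra maps into the square zero extension A × Q that are the
identity on A. The extension is represented by its left multiplication operators, so no ring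
structure on A × Q is needed, and D is read off by applying F to (1, 0). -/
theorem exists_derivation_of_algHom (hβ : ∀ a b a' b' x, β a b (β a' b' x) = β (a * a') (b' * b) x)
    (hβ' : ∀ x, β 1 1 x = x) {S : Type*} (a : S → A)
    (hind : ∀ W : Submodule k A, 1 ∈ W → (∀ s, ∀ b ∈ W, a s * b ∈ W) → ∀ b, b ∈ W) (d : S → Q)
    (F : A →ₐ[k] Module.End k (A × Q)) (hF : ∀ s, F (a s) = extensionMul β (a s, d s)) :
    ∃ D : A →ₗ[k] Q, (∀ s, D (a s) = d s) ∧ ∀ b c, D (b * c) = β b 1 (D c) + β 1 c (D b) := by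
  let D : A →ₗ[k] Q := LinearMap.snd k A Q ∘ₗ LinearMap.applyₗ (1, 0) ∘ₗ F.toLinearMap
  have hD (b : A) : D b = (F b (1, 0)).2 := rfl
  have hev (s : A × Q) : (extensionMul β s (1, 0)).2 = s.2 := by
    rw [extensionMul_apply]; simp [hβ']
  have hone : D 1 = 0 := by rw [hD, map_one]; rfl
  have hs (s : S) : D (a s) = d s := by rw [hD, hF, hev]
  -- Known for the generators, and preserved by left multiplication with them: F takes values in
  -- left multiplications by elements of the extension, whose first entry is b.
  have key (b : A) : F b = extensionMul β (b, D b) := by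
    refine hind (LinearMap.eqLocus F.toLinearMap (extensionMul β ∘ₗ LinearMap.id.prod D)) ?_ ?_ b
    · change F 1 = extensionMul β (1, D 1)
      rw [map_one, hone]
      refine LinearMap.ext fun u => ?_
      rw [extensionMul_apply]
      ext <;> simp [hβ']
    · intro s b hb
      change F b = extensionMul β (b, D b) at hb
      change F (a s * b) = extensionMul β (a s * b, D (a s * b))
      have e : F (a s * b) = extensionMul β (a s * b, β (a s) 1 (D b) + β 1 b (d s)) := by
        rw [map_mul, hF, hb, extensionMul_mul β hβ]
      rw [hD, e, hev]
  refine ⟨D, hs, fun b c => ?_⟩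
  rw [hD, map_mul, key b, key c, extensionMul_mul β hβ, hev]

end Derivation

section Quotient

variable {k A P : Type*} [Field k] [Ring A] [Algebra k A] [AddCommGroup P] [Module k P]

/-- The bimodule structure of the quotient by a subbimodule. -/
def quotAct (β : A →ₗ[k] A →ₗ[k] P →ₗ[k] P) (N : Submodule k P)
    (hN : ∀ a b, N ≤ N.comap (β a b)) : A →ₗ[k] A →ₗ[k] (P ⧸ N) →ₗ[k] (P ⧸ N) :=
  LinearMap.mk₂ k (fun a b => N.mapQ N (β a b) (hN a b))
    (fun a a' b => Submodule.linearMap_qext _ (LinearMap.ext fun x => by simp))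
    (fun c a b => Submodule.linearMap_qext _ (LinearMap.ext fun x => by simp))
    (fun a b b' => Submodule.linearMap_qext _ (LinearMap.ext fun x => by simp))
    (fun c a b => Submodule.linearMap_qext _ (LinearMap.ext fun x => by simp))

theorem quotAct_mk (β : A →ₗ[k] A →ₗ[k] P →ₗ[k] P) (N : Submodule k P)
    (hN : ∀ a b, N ≤ N.comap (β a b)) (a b : A) (x : P) :
    quotAct β N hN a b (N.mkQ x) = N.mkQ (β a b x) := rfl

theorem quotAct_quotAct (β : A →ₗ[k] A →ₗ[k] P →ₗ[k] P) (N : Submodule k P)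
    (hN : ∀ a b, N ≤ N.comap (β a b))
    (hβ : ∀ a b a' b' x, β a b (β a' b' x) = β (a * a') (b' * b) x) (a b a' b' : A) (x : P ⧸ N) :
    quotAct β N hN a b (quotAct β N hN a' b' x) = quotAct β N hN (a * a') (b' * b) x := by
  obtain ⟨y, rfl⟩ := N.mkQ_surjective x
  exact congrArg N.mkQ (hβ a b a' b' y)

theorem quotAct_one (β : A →ₗ[k] A →ₗ[k] P →ₗ[k] P) (N : Submodule k P)
    (hN : ∀ a b, N ≤ N.comap (β a b)) (hβ : ∀ x, β 1 1 x = x) (x : P ⧸ N) :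
    quotAct β N hN 1 1 x = x := by
  obtain ⟨y, rfl⟩ := N.mkQ_surjective x
  exact congrArg N.mkQ (hβ y)

end Quotient

section Bilinear

variable {k V P A : Type*} [Field k] [AddCommGroup V] [Module k V] [AddCommGroup P] [Module k P]
  [AddCommGroup A] [Module k A]

/-- Every alternating bilinear map is of the form `(v, w) ↦ β(v, w) - β(w, v)`. -/
theorem exists_bilinear_sub_flip (f : V [⋀^Fin 2]→ₗ[k] P) :
    ∃ β : V →ₗ[k] V →ₗ[k] P, ∀ v w, β v w - β w v = f ![v, w] := by
  classical
  let b := Module.Basis.ofVectorSpace k V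
  let _ : LinearOrder (Module.Basis.ofVectorSpaceIndex k V) := linearOrderOfSTO WellOrderingRel
  -- The strictly upper triangular part of f in an ordered basis. It takes the place of ½ f, which
  -- is unavailable in characteristic two.
  let β : V →ₗ[k] V →ₗ[k] P :=
    b.constr k fun i => b.constr k fun j => if i < j then f ![b i, b j] else 0
  have hβ (i j) : β (b i) (b j) = if i < j then f ![b i, b j] else 0 := by
    simp only [β, Module.Basis.constr_basis]
  refine ⟨β, fun v w => ?_⟩
  suffices h : β - β.flip = alternatingBilin f from LinearMap.congr_fun₂ h v w
  refine b.ext fun i => b.ext fun j => ?_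
  change β (b i) (b j) - β (b j) (b i) = f ![b i, b j]
  rw [hβ, hβ]
  rcases lt_trichotomy i j with h | h | h
  · rw [if_pos h, if_neg h.not_gt, sub_zero]
  · subst h
    rw [sub_self, f.map_eq_zero_of_eq ![b i, b i] (i := 0) (j := 1) rfl (by decide)]
  · rw [if_neg h.not_gt, if_pos h, zero_sub, alternating_swap, neg_neg]

variable {P' : Type*} [AddCommMonoid P'] [Module k P']

/-- The linear map on `A^{⊗2}` given by a bilinear map. -/
def ofBilinear (B : A →ₗ[k] A →ₗ[k] P') : (⨂[k]^2 A) →ₗ[k] P' :=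
  PiTensorProduct.lift (MultilinearMap.mk' (fun a => B (a 0) (a 1))
    (by intro a i x y; fin_cases i <;> simp) (by intro a i x y; fin_cases i <;> simp))

theorem ofBilinear_tprod (B : A →ₗ[k] A →ₗ[k] P') (a : Fin 2 → A) :
    ofBilinear B (PiTensorProduct.tprod k a) = B (a 0) (a 1) := PiTensorProduct.lift.tprod _

/-- The linear map on `A^{⊗1}` given by a linear map. -/
def ofLinear (f : A →ₗ[k] P') : (⨂[k]^1 A) →ₗ[k] P' :=
  f ∘ₗ (PiTensorProduct.subsingletonEquiv (0 : Fin 1)).toLinearMap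

theorem ofLinear_tprod (f : A →ₗ[k] P') (a : Fin 1 → A) :
    ofLinear f (PiTensorProduct.tprod k a) = f (a 0) :=
  congrArg f (PiTensorProduct.subsingletonEquiv_apply_tprod 0 a)

end Bilinear

variable {k G V : Type*} [Field k] [Group G] [AddCommGroup V] [Module k V]
  [DistribMulAction G V] [SMulCommClass G k V]

/-- A derivation of `A` is given by its values on vectors and group elements. -/
theorem exists_skew_derivation {Q : Type*} [AddCommGroup Q] [Module k Q]
    (β : Skew k G V →ₗ[k] Skew k G V →ₗ[k] Q →ₗ[k] Q)
    (hβ : ∀ a b a' b' x, β a b (β a' b' x) = β (a * a') (b' * b) x) (hβ' : ∀ x, β 1 1 x = x)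
    (f : V →ₗ[k] Q) (ρ : G → Q)
    (hff : ∀ v w, β (vec k G v) 1 (f w) + β 1 (vec k G w) (f v) =
      β (vec k G w) 1 (f v) + β 1 (vec k G v) (f w))
    (hρρ : ∀ g h, ρ (g * h) = β (grp k V g) 1 (ρ h) + β 1 (grp k V h) (ρ g))
    (hρf : ∀ g v, β (grp k V g) 1 (f v) + β 1 (vec k G v) (ρ g) =
      β (vec k G (g • v)) 1 (ρ g) + β 1 (grp k V g) (f (g • v))) :
    ∃ D : Skew k G V →ₗ[k] Q, (∀ v, D (vec k G v) = f v) ∧ (∀ g, D (grp k V g) = ρ g) ∧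
      ∀ a b, D (a * b) = β a 1 (D b) + β 1 b (D a) := by
  have hρ1 : ρ 1 = 0 := by
    have h := hρρ 1 1
    rw [grp_one, hβ', mul_one] at h
    exact add_eq_left.1 h.symm
  have hmul (s t : Skew k G V × Q) := extensionMul_mul β hβ s t
  let ρ' : G →* Module.End k (Skew k G V × Q) :=
    { toFun := fun g => extensionMul β (grp k V g, ρ g)
      map_one' := by
        refine LinearMap.ext fun u => ?_
        rw [extensionMul_apply, hρ1, grp_one, map_zero, hβ', one_mul, add_zero]
        rfl
      map_mul' := fun g h => by rw [hmul, grp_mul_grp, hρρ] }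
  obtain ⟨F, hFv, hFg⟩ := exists_skew_lift
    (extensionMul β ∘ₗ (vec k G).prod f) ρ'
    (fun v w => by
      change extensionMul β (vec k G v, f v) * extensionMul β (vec k G w, f w) =
        extensionMul β (vec k G w, f w) * extensionMul β (vec k G v, f v)
      rw [hmul, hmul, vec_mul_comm, hff])
    (fun g v => by
      change extensionMul β (grp k V g, ρ g) * extensionMul β (vec k G v, f v) =
        extensionMul β (vec k G (g • v), f (g • v)) * extensionMul β (grp k V g, ρ g)
      rw [hmul, hmul, grp_mul_vec, hρf])
  obtain ⟨D, hD, hDm⟩ := exists_derivation_of_algHom β hβ hβ'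
    (Sum.elim (vec k G) (grp k V)) (fun W h1 hW => mem_of_grp_vec W
      (fun g => mul_one (grp k V g) ▸ hW (.inr g) 1 h1) fun v a ha => hW (.inl v) a ha)
    (Sum.elim f ρ) F (by rintro (v | g); exacts [hFv v, hFg g])
  exact ⟨D, fun v => hD (.inl v), fun g => hD (.inr g), hDm⟩

/-- A derivation of `A` into the quotient of a bimodule by a subbimodule, in terms of
representatives of its values. -/
theorem exists_skew_derivation_quotient {P : Type*} [AddCommGroup P] [Module k P]
    (β : Skew k G V →ₗ[k] Skew k G V →ₗ[k] P →ₗ[k] P) (N : Submodule k P)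
    (hN : ∀ a b, N ≤ N.comap (β a b))
    (hβ : ∀ a b a' b' x, β a b (β a' b' x) = β (a * a') (b' * b) x) (hβ' : ∀ x, β 1 1 x = x)
    (f : V →ₗ[k] P) (e : V → P) (hf : ∀ v, f v = e v) (ρ : G → P)
    (hff : ∀ v w, N.mkQ (β (vec k G v) 1 (e w)) + N.mkQ (β 1 (vec k G w) (e v)) =
      N.mkQ (β (vec k G w) 1 (e v)) + N.mkQ (β 1 (vec k G v) (e w)))
    (hρρ : ∀ g h, N.mkQ (ρ (g * h)) =
      N.mkQ (β (grp k V g) 1 (ρ h)) + N.mkQ (β 1 (grp k V h) (ρ g)))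
    (hρf : ∀ g v, N.mkQ (β (grp k V g) 1 (e v)) + N.mkQ (β 1 (vec k G v) (ρ g)) =
      N.mkQ (β (vec k G (g • v)) 1 (ρ g)) + N.mkQ (β 1 (grp k V g) (e (g • v)))) :
    ∃ D : Skew k G V →ₗ[k] P ⧸ N, (∀ v, D (vec k G v) = N.mkQ (e v)) ∧
      (∀ g, D (grp k V g) = N.mkQ (ρ g)) ∧ ∀ a b x y, D a = N.mkQ x → D b = N.mkQ y →
        D (a * b) = N.mkQ (β a 1 y + β 1 b x) := by
  obtain rfl : (f : V → P) = e := funext hf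
  obtain ⟨D, h1, h2, h3⟩ := exists_skew_derivation (quotAct β N hN)
    (quotAct_quotAct β N hN hβ) (quotAct_one β N hN hβ') (N.mkQ ∘ₗ f) (fun g => N.mkQ (ρ g))
    hff hρρ hρf
  refine ⟨D, h1, h2, fun a b x y hx hy => ?_⟩
  rw [h3, hx, hy, map_add, quotAct_mk, quotAct_mk]

end

noncomputable section

variable {k G V : Type*} [Field k] [Group G] [AddCommGroup V] [Module k V]
  [DistribMulAction G V] [SMulCommClass G k V]

/-- Supplies the subtraction on generators used in constructing retractions, on top of the existing
addition. -/
instance genAddCommGroup (n : ℕ) : AddCommGroup (XGenTot k G V n) :=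
  Module.addCommMonoidToAddCommGroup k

/-! ### Left inverses of the maps from `X` on generators -/

/-- A linear left inverse of kG → A exists over a field. Composing it with the projection to degree
zero makes it graded, as the retractions of φ have to be. The same is done for V in degree one. -/
theorem exists_groupCoef : ∃ c : Skew k G V →ₗ[k] MonoidAlgebra k G,
    (∀ g, c (grp k V g) = MonoidAlgebra.of k G g) ∧
      ∀ m ≠ 0, ∀ a ∈ skewDeg k G V m, c a = 0 := by
  obtain ⟨π, h1, h2⟩ := exists_skew_projection (k := k) (G := G) (V := V) 0
  obtain ⟨c, hc⟩ := (groupIncl k G V).toLinearMap.exists_leftInverse_of_injective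
    (LinearMap.ker_eq_bot.2 groupIncl_injective)
  refine ⟨c ∘ₗ π, fun g => ?_, fun m hm a ha => ?_⟩
  · rw [LinearMap.comp_apply, h1 _ (grp_mem_skewDeg g), ← groupIncl_of]
    exact LinearMap.congr_fun hc _
  · rw [LinearMap.comp_apply, h2 m hm a ha, map_zero]

theorem exists_vecCoef : ∃ c : Skew k G V →ₗ[k] V, (∀ v, c (vec k G v) = v) ∧
    ∀ m ≠ 1, ∀ a ∈ skewDeg k G V m, c a = 0 := by
  obtain ⟨π, h1, h2⟩ := exists_skew_projection (k := k) (G := G) (V := V) 1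
  have hinj : Function.Injective (vec k G : V →ₗ[k] Skew k G V) := fun v w h => by
    have e : vecGrp k G V (Finsupp.single 1 v) = vecGrp k G V (Finsupp.single 1 w) := by
      rw [vecGrp_single, vecGrp_single, h]
    exact Finsupp.single_injective _ (vecGrp_injective e)
  obtain ⟨c, hc⟩ := (vec k G : V →ₗ[k] Skew k G V).exists_leftInverse_of_injective
    (LinearMap.ker_eq_bot.2 hinj)
  refine ⟨c ∘ₗ π, fun v => ?_, fun m hm a ha => ?_⟩
  · rw [LinearMap.comp_apply, h1 _ (vec_mem_skewDeg v)]
    exact LinearMap.congr_fun hc _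
  · rw [LinearMap.comp_apply, h2 m hm a ha, map_zero]

theorem genIncl_mem_genDeg {n i j : ℕ} (h : i + j = n) (g : Fin i → G) (x : ⋀[k]^j V) :
    genIncl h g x ∈ genDeg k G V n j := by
  have hx : x ∈ Submodule.span k (Set.range (exteriorPower.ιMulti k j)) := by
    rw [exteriorPower.ιMulti_span]; trivial
  refine (Submodule.span_le (p := (genDeg k G V n j).comap (genIncl h g))).2 ?_ hx
  rintro _ ⟨v, rfl⟩
  exact gen_mem_genDeg h g v

theorem groupLinear_mem {P : Type*} [AddCommMonoid P] [Module k P] {f : G → P} {S : Submodule k P}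
    (h : ∀ g, f g ∈ S) (r : MonoidAlgebra k G) : groupLinear f r ∈ S :=
  Submodule.sum_mem _ fun g _ => Submodule.smul_mem _ _ (h g)

/-- `g_1 ⊗ ⋯ ⊗ g_i ⊗ v`, as a linear function of `v`. -/
def genVec {n i : ℕ} (h : i + 1 = n) (g : Fin i → G) : V →ₗ[k] XGenTot k G V n :=
  genIncl h g ∘ₗ (exteriorPower.oneEquiv k V).symm.toLinearMap

theorem genVec_apply {n i : ℕ} (h : i + 1 = n) (g : Fin i → G) (v : V) :
    genVec h g v = gen k h g ![v] := by
  have e : (exteriorPower.oneEquiv k V).symm v = exteriorPower.ιMulti k 1 ![v] := by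
    rw [LinearEquiv.symm_apply_eq, exteriorPower.oneEquiv_ιMulti]; rfl
  exact congrArg (genIncl h g) e

theorem genVec_mem {n i : ℕ} (h : i + 1 = n) (g : Fin i → G) (v : V) :
    genVec h g v ∈ genDeg k G V n 1 := genIncl_mem_genDeg h g _

variable (k G V) in
-- The retraction takes the group coefficients and the vector coefficient of an element of A. It is
-- used to correct ψ_1, so only linearity and the grading matter.
theorem exists_retraction_one : ∃ r : (⨂[k]^1 (Skew k G V)) →ₗ[k] XGenTot k G V 1,
    r ∘ₗ phiGen k G V 1 = LinearMap.id ∧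
      ∀ d, ∀ z ∈ tensorDeg k G V 1 d, r z ∈ genDeg k G V 1 d := by
  obtain ⟨c, hc, hc'⟩ := exists_groupCoef (k := k) (G := G) (V := V)
  obtain ⟨e, he, he'⟩ := exists_vecCoef (k := k) (G := G) (V := V)
  let f : MonoidAlgebra k G →ₗ[k] XGenTot k G V 1 :=
    groupLinear fun g => gen k (j := 0) rfl ![g] ![]
  have hf (r) : f r ∈ genDeg k G V 1 0 := groupLinear_mem (fun g => gen_mem_genDeg _ _ _) r
  let R : Skew k G V →ₗ[k] XGenTot k G V 1 := f ∘ₗ c + genVec rfl ![] ∘ₗ e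
  have hR (a) : R a = f (c a) + genVec rfl ![] (e a) := rfl
  refine ⟨ofLinear R, gen_hom_ext (P := XGenTot k G V 1) fun i j hij g v => ?_, fun d z hz => ?_⟩
  · rw [LinearMap.comp_apply, LinearMap.id_apply, phiGen, genLift_gen]
    have hi : i ≤ 1 := by omega
    interval_cases i
    · obtain rfl : j = 1 := by omega
      obtain rfl := Subsingleton.elim ![] g
      obtain ⟨v, rfl⟩ : ∃ w, v = ![w] := ⟨v 0, by ext i; fin_cases i; rfl⟩
      refine (ofLinear_tprod R ![vec k G v]).trans ?_
      change R (vec k G v) = _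
      rw [hR, he, hc' 1 one_ne_zero _ (vec_mem_skewDeg v), map_zero, zero_add, genVec_apply]
    · obtain rfl : j = 0 := by omega
      obtain rfl := Subsingleton.elim ![] v
      obtain ⟨g, rfl⟩ : ∃ h, g = ![h] := ⟨g 0, by ext i; fin_cases i; rfl⟩
      refine (ofLinear_tprod R ![grp k V g]).trans ?_
      change R (grp k V g) = _
      rw [hR, hc, he' 0 zero_ne_one _ (grp_mem_skewDeg g), map_zero, add_zero, groupLinear_of]
  · refine (Submodule.span_le (p := (genDeg k G V 1 d).comap (ofLinear R))).2 ?_ hz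
    rintro _ ⟨x, p, hx, rfl, rfl⟩
    rw [SetLike.mem_coe, Submodule.mem_comap, ofLinear_tprod, hR, Fin.sum_univ_one]
    have h := hx 0
    refine add_mem ?_ ?_
    · by_cases h0 : p 0 = 0
      · rw [h0]; exact hf _
      · rw [hc' _ h0 _ h, map_zero]; exact zero_mem _
    · by_cases h1 : p 0 = 1
      · rw [h1]; exact genVec_mem _ _ _
      · rw [he' _ h1 _ h, map_zero]; exact zero_mem _

variable (k G V) in
-- The difficulty is to undo v ∧ w ↦ v ⊗ w - w ⊗ v without dividing by two. A bilinear map whose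
-- antisymmetrization is the wedge product does it.
theorem exists_retraction_two : ∃ r : (⨂[k]^2 (Skew k G V)) →ₗ[k] XGenTot k G V 2,
    r ∘ₗ phiGen k G V 2 = LinearMap.id ∧
      ∀ d, ∀ z ∈ tensorDeg k G V 2 d, r z ∈ genDeg k G V 2 d := by
  obtain ⟨c, hc, hc'⟩ := exists_groupCoef (k := k) (G := G) (V := V)
  obtain ⟨e, he, he'⟩ := exists_vecCoef (k := k) (G := G) (V := V)
  obtain ⟨β, hβ⟩ := exists_bilinear_sub_flip (exteriorPower.ιMulti k 2 (M := V))
  let f : MonoidAlgebra k G →ₗ[k] MonoidAlgebra k G →ₗ[k] XGenTot k G V 2 :=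
    groupLinear fun g => groupLinear fun h => gen k (j := 0) rfl ![g, h] ![]
  have hf (r s) : f r s ∈ genDeg k G V 2 0 :=
    groupLinear_mem (S := (genDeg k G V 2 0).comap (LinearMap.applyₗ s))
      (fun g => groupLinear_mem (fun h => gen_mem_genDeg _ _ _) s) r
  let f' : MonoidAlgebra k G →ₗ[k] V →ₗ[k] XGenTot k G V 2 := groupLinear fun g => genVec rfl ![g]
  have hf' (r v) : f' r v ∈ genDeg k G V 2 1 :=
    groupLinear_mem (S := (genDeg k G V 2 1).comap (LinearMap.applyₗ v))
      (fun g => genVec_mem _ _ v) r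
  let f'' : V →ₗ[k] V →ₗ[k] XGenTot k G V 2 := β.compr₂ (genIncl rfl ![])
  have hf'' (v w) : f'' v w ∈ genDeg k G V 2 2 := genIncl_mem_genDeg _ _ _
  have hfg (g h) : f (MonoidAlgebra.of k G g) (MonoidAlgebra.of k G h) =
      gen k (j := 0) rfl ![g, h] ![] := by
    simp only [f, groupLinear_of]
  have hfg' (g v) : f' (MonoidAlgebra.of k G g) v = gen k rfl ![g] ![v] := by
    simp only [f', groupLinear_of, genVec_apply]
  have hfg'' (v w) : f'' v w - f'' w v = gen k rfl ![] ![v, w] :=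
    (map_sub (genIncl rfl ![]) _ _).symm.trans (congrArg _ (hβ v w))
  have zl (s) : f 0 s = 0 := LinearMap.map_zero₂ f s
  have zr (r) : f r 0 = 0 := (f r).map_zero
  have zl' (s) : f' 0 s = 0 := LinearMap.map_zero₂ f' s
  have zr' (r) : f' r 0 = 0 := (f' r).map_zero
  have zl'' (s) : f'' 0 s = 0 := LinearMap.map_zero₂ f'' s
  have zr'' (r) : f'' r 0 = 0 := (f'' r).map_zero
  clear_value f f' f''
  -- There is deliberately no term for a vector followed by a group element, so that in g ⊗ v - ᵍv ⊗
  -- g only the first summand counts.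
  let R : Skew k G V →ₗ[k] Skew k G V →ₗ[k] XGenTot k G V 2 :=
    f.compl₁₂ c c + f'.compl₁₂ c e + f''.compl₁₂ e e
  have hR (a b) : R a b = f (c a) (c b) + f' (c a) (e b) + f'' (e a) (e b) := rfl
  have hcv (v : V) : c (vec k G v) = 0 := hc' 1 one_ne_zero _ (vec_mem_skewDeg v)
  have heg (g : G) : e (grp k V g) = 0 := he' 0 zero_ne_one _ (grp_mem_skewDeg g)
  refine ⟨ofBilinear R, gen_hom_ext (P := XGenTot k G V 2) fun i j hij g v => ?_, fun d z hz => ?_⟩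
  · rw [LinearMap.comp_apply, LinearMap.id_apply, phiGen, genLift_gen]
    have hi : i ≤ 2 := by omega
    interval_cases i
    · obtain rfl : j = 2 := by omega
      obtain rfl := Subsingleton.elim ![] g
      obtain ⟨v, w, rfl⟩ : ∃ a b, v = ![a, b] := ⟨v 0, v 1, by ext i; fin_cases i <;> rfl⟩
      refine ((congrArg (ofBilinear R) (antisymmetrize_apply _ _)).trans
        (map_sub_of_eq (ofBilinear R)
        (ofBilinear_tprod R ![vec k G v, vec k G w])
        (ofBilinear_tprod R ![vec k G w, vec k G v]))).trans ?_
      change R (vec k G v) (vec k G w) - R (vec k G w) (vec k G v) = _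
      rw [hR, hR, hcv, hcv, he, he, zl, zl', zl', zero_add, zero_add, zero_add]
      exact hfg'' v w
    · obtain rfl : j = 1 := by omega
      obtain ⟨v, rfl⟩ : ∃ w, v = ![w] := ⟨v 0, by ext i; fin_cases i; rfl⟩
      obtain ⟨g, rfl⟩ : ∃ h, g = ![h] := ⟨g 0, by ext i; fin_cases i; rfl⟩
      refine (map_sub_of_eq (ofBilinear R) (ofBilinear_tprod R ![grp k V g, vec k G v])
        (ofBilinear_tprod R ![vec k G (g • v), grp k V g])).trans ?_
      change R (grp k V g) (vec k G v) - R (vec k G (g • v)) (grp k V g) = _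
      rw [hR, hR, hcv, hcv, hc, heg, he, zr, zl, zl', zl'', zr'', hfg', zero_add, add_zero,
        add_zero, add_zero, sub_zero]
    · obtain rfl : j = 0 := by omega
      obtain rfl := Subsingleton.elim ![] v
      obtain ⟨g, h, rfl⟩ : ∃ a b, g = ![a, b] := ⟨g 0, g 1, by ext i; fin_cases i <;> rfl⟩
      refine (ofBilinear_tprod R ![grp k V g, grp k V h]).trans ?_
      change R (grp k V g) (grp k V h) = _
      rw [hR, hc, hc, heg, heg, zr', zr'', add_zero, add_zero, hfg]
  · refine (Submodule.span_le (p := (genDeg k G V 2 d).comap (ofBilinear R))).2 ?_ hz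
    rintro _ ⟨x, p, hx, rfl, rfl⟩
    rw [SetLike.mem_coe, Submodule.mem_comap, ofBilinear_tprod, hR, Fin.sum_univ_two]
    have hc0 (i) (h : p i ≠ 0) : c (x i) = 0 := hc' _ h _ (hx i)
    have he1 (i) (h : p i ≠ 1) : e (x i) = 0 := he' _ h _ (hx i)
    refine add_mem (add_mem ?_ ?_) ?_
    · by_cases h0 : p 0 = 0
      · by_cases h1 : p 1 = 0
        · rw [h0, h1]; exact hf _ _
        · rw [hc0 1 h1, zr]; exact zero_mem _
      · rw [hc0 0 h0, zl]; exact zero_mem _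
    · by_cases h0 : p 0 = 0
      · by_cases h1 : p 1 = 1
        · rw [h0, h1]; exact hf' _ _
        · rw [he1 1 h1, zr']; exact zero_mem _
      · rw [hc0 0 h0, zl']; exact zero_mem _
    · by_cases h0 : p 0 = 1
      · by_cases h1 : p 1 = 1
        · rw [h0, h1]; exact hf'' _ _
        · rw [he1 1 h1, zr'']; exact zero_mem _
      · rw [he1 0 h0, zl'']; exact zero_mem _

/-! ### Adjusting a map from the bar resolution to be a left inverse -/

theorem freeIncl_phiGen (n : ℕ) (m : XGenTot k G V n) :
    phiMap k G V n (freeIncl k (Skew k G V) m) = freeIncl k (Skew k G V) (phiGen k G V n m) :=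
  biExtend_freeIncl _ freeAct_one _ m

theorem free_hom_ext_of_act {A M P : Type*} [Ring A] [Algebra k A] [AddCommMonoid M] [Module k M]
    [AddCommGroup P] [Module k P] (β : A →ₗ[k] A →ₗ[k] P →ₗ[k] P) {f f' : Free k A M →ₗ[k] P}
    (hf : ∀ a b x, f (freeAct k A M a b x) = β a b (f x))
    (hf' : ∀ a b x, f' (freeAct k A M a b x) = β a b (f' x))
    (h : f ∘ₗ freeIncl k A = f' ∘ₗ freeIncl k A) : f = f' :=
  free_hom_ext fun a b m => by
    rw [hf, hf']; exact congrArg (β a b) (LinearMap.congr_fun h m)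

theorem eq_id_of_freeIncl {A M : Type*} [Ring A] [Algebra k A] [AddCommMonoid M] [Module k M]
    {f : Free k A M →ₗ[k] Free k A M}
    (hf : ∀ a b x, f (freeAct k A M a b x) = freeAct k A M a b (f x))
    (h : ∀ m, f (freeIncl k A m) = freeIncl k A m) : f = LinearMap.id :=
  free_hom_ext fun a b m => by rw [hf, h]; rfl

/-- The defect E = fφ - 1 takes values in the kernel of T. Replacing f by f - E r, where r is a
retraction of φ on generators, removes the defect and leaves T f and the degrees unchanged. -/
theorem exists_left_inverse_correction {n : ℕ} {P : Type*} [AddCommGroup P] [Module k P]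
    (T : X k G V n →ₗ[k] P) (f : (⨂[k]^n (Skew k G V)) →ₗ[k] X k G V n)
    (hf : ∀ d, ∀ z ∈ tensorDeg k G V n d, f z ∈ xDeg k G V n d)
    (r : (⨂[k]^n (Skew k G V)) →ₗ[k] XGenTot k G V n)
    (hr : r ∘ₗ phiGen k G V n = LinearMap.id)
    (hr' : ∀ d, ∀ z ∈ tensorDeg k G V n d, r z ∈ genDeg k G V n d)
    (hT : ∀ m, T (f (phiGen k G V n m)) = T (freeIncl k (Skew k G V) m)) :
    ∃ f' : (⨂[k]^n (Skew k G V)) →ₗ[k] X k G V n, T ∘ₗ f' = T ∘ₗ f ∧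
      (∀ d, ∀ z ∈ tensorDeg k G V n d, f' z ∈ xDeg k G V n d) ∧
      biExtend (xAct k G V n) f' ∘ₗ phiMap k G V n = LinearMap.id := by
  let E : XGenTot k G V n →ₗ[k] X k G V n := f ∘ₗ phiGen k G V n - freeIncl k (Skew k G V)
  have hE (m) : E m = f (phiGen k G V n m) - freeIncl k (Skew k G V) m := rfl
  have hE' (m) : f (phiGen k G V n m) =
      biExtend (xAct k G V n) f (phiMap k G V n (freeIncl k (Skew k G V) m)) := by
    rw [freeIncl_phiGen, biExtend_freeIncl _ freeAct_one]
  refine ⟨f - E ∘ₗ r, LinearMap.ext fun z => ?_, fun d z hz => ?_, ?_⟩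
  · change T (f z - E (r z)) = T (f z)
    rw [map_sub, hE, map_sub, hT, sub_self, sub_zero]
  · refine sub_mem (hf d z hz) ?_
    rw [LinearMap.comp_apply, hE, hE']
    have h := freeIncl_mem_xDeg (hr' d z hz)
    exact sub_mem (biExtend_mem_xDeg f hf (phiMap_mem_barDeg n d _ h)) h
  · refine eq_id_of_freeIncl (fun a b x => ?_) fun m => ?_
    · rw [LinearMap.comp_apply, phiMap_xAct, biExtend_freeAct _ freeAct_freeAct]
      rfl
    · rw [LinearMap.comp_apply, freeIncl_phiGen, biExtend_freeIncl _ freeAct_one]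
      change f (phiGen k G V n m) - E (r (phiGen k G V n m)) = freeIncl k (Skew k G V) m
      have e : r (phiGen k G V n m) = m := LinearMap.congr_fun hr m
      rw [e, hE, sub_sub_cancel]

end

noncomputable section

section Bar

variable {k A : Type*} [Field k] [Ring A] [Algebra k A]

theorem barD_barD_zero (x : Bar k A 2) : barD k A 0 (barD k A 1 x) = 0 := by
  suffices h : barD k A 0 ∘ₗ barD k A 1 = 0 from LinearMap.congr_fun h x
  refine free_hom_ext_of_act (freeAct k A _) (fun a b x => ?_) (fun a b x => (map_zero _).symm) ?_
  · rw [LinearMap.comp_apply, barD_freeAct, barD_freeAct, LinearMap.comp_apply]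
  · refine PiTensorProduct.ext (MultilinearMap.ext fun a => ?_)
    change barD k A 0 (barD k A 1 (barGen k a)) = 0
    have ha : a = ![a 0, a 1] := by ext i; fin_cases i <;> rfl
    rw [ha, barD_one, map_add, map_sub, barD_freeAct, barD_freeAct, barD_zero, barD_zero, barD_zero,
      map_sub, map_sub, freeAct_freeAct, freeAct_freeAct, freeAct_freeAct, freeAct_freeAct]
    simp

end Bar

section Quotient

variable {k P : Type*} [Field k] [AddCommGroup P] [Module k P] {N : Submodule k P} {x a b c d : P}

theorem mkQ_add_eq_of_sub_sub (hx : x ∈ N) (h : x = a - b - (c - d)) :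
    N.mkQ a + N.mkQ d = N.mkQ c + N.mkQ b := by
  rw [← map_add, ← map_add, ← sub_eq_zero, ← map_sub]
  refine (Submodule.Quotient.mk_eq_zero _).2 ?_
  rw [show a + d - (c + b) = x by rw [h]; abel]
  exact hx

theorem mkQ_eq_add_of_sub_add (hx : x ∈ N) (h : x = a - b + c) :
    N.mkQ b = N.mkQ a + N.mkQ c := by
  rw [← map_add, eq_comm, ← sub_eq_zero, ← map_sub]
  refine (Submodule.Quotient.mk_eq_zero _).2 ?_
  rw [show a + c - b = x by rw [h]; abel]
  exact hx

end Quotient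

variable {k G V : Type*} [Field k] [Group G] [AddCommGroup V] [Module k V]
  [DistribMulAction G V] [SMulCommClass G k V]

/-! ### The map from the bar resolution to `X` -/

theorem xAct_xGen_mem {n i j p q d : ℕ} {a b : Skew k G V} (ha : a ∈ skewDeg k G V p)
    (hb : b ∈ skewDeg k G V q) (h : i + j = n) (g : Fin i → G) (v : Fin j → V)
    (hd : p + j + q = d) : xAct k G V n a b (xGen k h g v) ∈ xDeg k G V n d :=
  Submodule.subset_span ⟨i, j, h, g, v, p, q, a, ha, b, hb, hd, rfl⟩

theorem xD_one_xGen_mem (i j : ℕ) (hij : i + j = 2) (g : Fin i → G) (v : Fin j → V) :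
    xD k G V 1 (xGen k hij g v) ∈ xDeg k G V 1 j := by
  have G0 := grp_mem_skewDeg (k := k) (G := G) (V := V)
  have V1 := vec_mem_skewDeg (k := k) (G := G) (V := V)
  have O := one_mem_skewDeg (k := k) (G := G) (V := V)
  have hi : i ≤ 2 := by omega
  interval_cases i
  · obtain rfl : j = 2 := by omega
    obtain rfl := Subsingleton.elim ![] g
    obtain ⟨v, w, rfl⟩ : ∃ a b, v = ![a, b] := ⟨v 0, v 1, by ext i; fin_cases i <;> rfl⟩
    refine (xD_one_zero_two (k := k) (G := G) v w).symm ▸ ?_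
    exact sub_mem (sub_mem (xAct_xGen_mem (V1 v) O _ _ _ rfl) (xAct_xGen_mem O (V1 v) _ _ _ rfl))
      (sub_mem (xAct_xGen_mem (V1 w) O _ _ _ rfl) (xAct_xGen_mem O (V1 w) _ _ _ rfl))
  · obtain rfl : j = 1 := by omega
    obtain ⟨v, rfl⟩ : ∃ w, v = ![w] := ⟨v 0, by ext i; fin_cases i; rfl⟩
    obtain ⟨g, rfl⟩ : ∃ h, g = ![h] := ⟨g 0, by ext i; fin_cases i; rfl⟩
    refine (xD_one_one_one (k := k) g v).symm ▸ ?_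
    exact sub_mem (sub_mem (xAct_xGen_mem (G0 g) O _ _ _ rfl) (xAct_xGen_mem O (G0 g) _ _ _ rfl))
      (sub_mem (xAct_xGen_mem (V1 _) O _ _ _ rfl) (xAct_xGen_mem O (V1 v) _ _ _ rfl))
  · obtain rfl : j = 0 := by omega
    obtain rfl := Subsingleton.elim ![] v
    obtain ⟨g, h, rfl⟩ : ∃ a b, g = ![a, b] := ⟨g 0, g 1, by ext i; fin_cases i <;> rfl⟩
    refine (xD_one_two_zero (k := k) (V := V) g h).symm ▸ ?_
    exact add_mem (sub_mem (xAct_xGen_mem (G0 g) O _ _ _ rfl) (xGen_mem_xDeg _ _ _))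
      (xAct_xGen_mem O (G0 h) _ _ _ rfl)

theorem xD_one_mem (d : ℕ) (y : X k G V 2) (hy : y ∈ xDeg k G V 2 d) :
    xD k G V 1 y ∈ xDeg k G V 1 d := by
  refine (Submodule.span_le (p := (xDeg k G V 1 d).comap (xD k G V 1))).2 ?_ hy
  rintro _ ⟨i, j, h, g, v, p, q, a, ha, b, hb, rfl, rfl⟩
  rw [SetLike.mem_coe, Submodule.mem_comap, xD_xAct]
  exact xAct_mem_xDeg ha hb (xD_one_xGen_mem i j h g v)

variable (k G V) in
/-- The map `A^{⊗0} → X_0` with `1 ↦ 1 ⊗ 1`. -/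
def psiZero : (⨂[k]^0 (Skew k G V)) →ₗ[k] X k G V 0 :=
  LinearMap.toSpanSingleton k _ (xGen k (i := 0) (j := 0) rfl ![] ![]) ∘ₗ
    (PiTensorProduct.isEmptyEquiv (Fin 0)).toLinearMap

theorem psiZero_tprod (x : Fin 0 → Skew k G V) : psiZero k G V (PiTensorProduct.tprod k x) =
    xGen k (i := 0) (j := 0) rfl ![] ![] := by
  rw [psiZero, LinearMap.comp_apply, LinearEquiv.coe_coe, PiTensorProduct.isEmptyEquiv_apply_tprod,
    LinearMap.toSpanSingleton_apply, one_smul]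

theorem psiZero_mem (d : ℕ) (z) (hz : z ∈ tensorDeg k G V 0 d) :
    psiZero k G V z ∈ xDeg k G V 0 d := by
  refine (Submodule.span_le (p := (xDeg k G V 0 d).comap (psiZero k G V))).2 ?_ hz
  rintro _ ⟨x, c, hx, rfl, rfl⟩
  rw [SetLike.mem_coe, Submodule.mem_comap, psiZero_tprod]
  exact xGen_mem_xDeg _ _ _

theorem psiZero_phiMap :
    biExtend (xAct k G V 0) (psiZero k G V) ∘ₗ phiMap k G V 0 = LinearMap.id := by
  refine x_hom_ext fun a b i j hij g v => ?_
  obtain rfl : i = 0 := by omega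
  obtain rfl : j = 0 := by omega
  obtain rfl := Subsingleton.elim ![] g
  obtain rfl := Subsingleton.elim ![] v
  have h : biExtend (xAct k G V 0) (psiZero k G V) (barGen k ![]) =
      xGen k (i := 0) (j := 0) rfl ![] ![] :=
    (biExtend_freeIncl _ freeAct_one _ _).trans (psiZero_tprod _)
  have h' : biExtend (xAct k G V 0) (psiZero k G V) (phiMap k G V 0
      (xAct k G V 0 a b (xGen k (i := 0) (j := 0) rfl ![] ![]))) =
      xAct k G V 0 a b (xGen k (i := 0) (j := 0) rfl ![] ![]) :=
    (congrArg _ (phiMap_xAct_of_eq phiMap_zero a b)).trans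
      ((biExtend_freeAct _ freeAct_freeAct _ a b _).trans (congrArg (xAct k G V 0 a b) h))
  exact h'.trans (LinearMap.id_apply _).symm

/-- Inherited from the bar resolution: φ commutes with the differentials, and φ_0 has a left
inverse. -/
theorem xD_xD_zero (y : X k G V 2) : xD k G V 0 (xD k G V 1 y) = 0 := by
  have h0 (x : X k G V 1) : phiMap k G V 0 (xD k G V 0 x) = barD k _ 0 (phiMap k G V 1 x) :=
    (LinearMap.congr_fun phiMap_comm_zero x).symm
  have h1 : phiMap k G V 1 (xD k G V 1 y) = barD k _ 1 (phiMap k G V 2 y) :=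
    (LinearMap.congr_fun phiMap_comm_one y).symm
  have h2 : biExtend (xAct k G V 0) (psiZero k G V) (phiMap k G V 0 (xD k G V 0 (xD k G V 1 y))) =
      xD k G V 0 (xD k G V 1 y) := LinearMap.congr_fun psiZero_phiMap _
  rw [← h2, h0, h1, barD_barD_zero, map_zero]

variable (k G V) in
/-- The derivation of `A` into the quotient of `X_1` by the boundaries. -/
theorem exists_x_derivation : ∃ D : Skew k G V →ₗ[k] X k G V 1 ⧸ LinearMap.range (xD k G V 1),
    (∀ v, D (vec k G v) =
      (LinearMap.range (xD k G V 1)).mkQ (xGen k (i := 0) (j := 1) rfl ![] ![v])) ∧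
    (∀ g, D (grp k V g) =
      (LinearMap.range (xD k G V 1)).mkQ (xGen k (i := 1) (j := 0) rfl ![g] ![])) ∧
    ∀ a b y z, D a = (LinearMap.range (xD k G V 1)).mkQ y →
      D b = (LinearMap.range (xD k G V 1)).mkQ z →
      D (a * b) = (LinearMap.range (xD k G V 1)).mkQ (xAct k G V 1 a 1 z + xAct k G V 1 1 b y) := by
  let N : Submodule k (X k G V 1) := LinearMap.range (xD k G V 1)
  have hN (a b : Skew k G V) : N ≤ N.comap (xAct k G V 1 a b) := by
    rintro _ ⟨y, rfl⟩
    exact ⟨xAct k G V 2 a b y, xD_xAct 1 a b y⟩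
  have hx (y) : xD k G V 1 y ∈ N := ⟨y, rfl⟩
  -- The three conditions on a derivation, from the relations vw = wv, the product of G, and gv =
  -- (ᵍv)g, hold modulo the boundaries of v ∧ w, g ⊗ h and g ⊗ v respectively.
  exact exists_skew_derivation_quotient (xAct k G V 1) N hN freeAct_freeAct freeAct_one
    (freeIncl k (Skew k G V) ∘ₗ genVec rfl ![]) _
    (fun v => congrArg (freeIncl k (Skew k G V)) (genVec_apply rfl ![] v)) _
    (fun v w => mkQ_add_eq_of_sub_sub (hx _) (xD_one_zero_two v w))
    (fun g h => mkQ_eq_add_of_sub_add (hx _) (xD_one_two_zero g h))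
    (fun g v => mkQ_add_eq_of_sub_sub (hx _) (xD_one_one_one g v))

end

/-! ### Homogeneous lifts of the universal derivation -/

noncomputable section

variable {k G V : Type*} [Field k] [Group G] [AddCommGroup V] [Module k V]
  [DistribMulAction G V] [SMulCommClass G k V]

theorem eq_one_tuple {A : Type*} (x : Fin 1 → A) : x = ![x 0] := by ext i; fin_cases i; rfl

theorem eq_two_tuple {A : Type*} (x : Fin 2 → A) : x = ![x 0, x 1] := by
  ext i; fin_cases i <;> rfl

theorem psi_comm_of_barGen (n : ℕ) (f : (⨂[k]^n (Skew k G V)) →ₗ[k] X k G V n)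
    (f' : (⨂[k]^(n + 1) (Skew k G V)) →ₗ[k] X k G V (n + 1))
    (h : ∀ x : Fin (n + 1) → Skew k G V, xD k G V n (f' (PiTensorProduct.tprod k x)) =
      biExtend (xAct k G V n) f (barD k (Skew k G V) n (barGen k x))) :
    xD k G V n ∘ₗ biExtend (xAct k G V (n + 1)) f' =
      biExtend (xAct k G V n) f ∘ₗ barD k (Skew k G V) n := by
  refine free_hom_ext_of_act (xAct k G V n) (fun a b x => ?_) (fun a b x => ?_)
    (PiTensorProduct.ext (MultilinearMap.ext fun x => ?_))
  · rw [LinearMap.comp_apply, biExtend_freeAct _ freeAct_freeAct, xD_xAct, LinearMap.comp_apply]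
  · exact (congrArg _ (barD_freeAct n a b x)).trans (biExtend_freeAct _ freeAct_freeAct f a b _)
  · exact (congrArg _ (biExtend_freeIncl _ freeAct_one f' _)).trans (h x)

/-- The inner derivation `a ↦ a x - x a`. -/
def innerDerivation {A P : Type*} [Ring A] [Algebra k A] [AddCommGroup P] [Module k P]
    (β : A →ₗ[k] A →ₗ[k] P →ₗ[k] P) (x : P) : A →ₗ[k] P :=
  (β.flip 1).flip x - (β 1).flip x

theorem innerDerivation_apply {A P : Type*} [Ring A] [Algebra k A] [AddCommGroup P] [Module k P]
    (β : A →ₗ[k] A →ₗ[k] P →ₗ[k] P) (x : P) (a : A) :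
    innerDerivation β x a = β a 1 x - β 1 a x := rfl

theorem innerDerivation_mul {A P : Type*} [Ring A] [Algebra k A] [AddCommGroup P] [Module k P]
    (β : A →ₗ[k] A →ₗ[k] P →ₗ[k] P)
    (hβ : ∀ a b a' b' x, β a b (β a' b' x) = β (a * a') (b' * b) x) (x : P) (a b : A) :
    innerDerivation β x (a * b) =
      β a 1 (innerDerivation β x b) + β 1 b (innerDerivation β x a) := by
  simp only [innerDerivation_apply, map_sub, hβ, mul_one, one_mul]
  abel

section Derivation

variable {Q : Type*} [AddCommGroup Q] [Module k Q]

/-- `T : X_1 → Q` respects the bimodule structure, and `D : A → Q` is a derivation with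
`D(v) = T(1 ⊗ v ⊗ 1)` and `D(g) = T(1 ⊗ g ⊗ 1)`. -/
structure IsUniversalDerivation (T : X k G V 1 →ₗ[k] Q) (D : Skew k G V →ₗ[k] Q) : Prop where
  map_vec (v : V) : D (vec k G v) = T (xGen k (i := 0) (j := 1) rfl ![] ![v])
  map_grp (g : G) : D (grp k V g) = T (xGen k (i := 1) (j := 0) rfl ![g] ![])
  map_mul (a b : Skew k G V) (y z : X k G V 1) : D a = T y → D b = T z →
    D (a * b) = T (xAct k G V 1 a 1 z + xAct k G V 1 1 b y)

variable {T : X k G V 1 →ₗ[k] Q} {D : Skew k G V →ₗ[k] Q}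

/-- The Leibniz rule, applied one letter at a time, writes the value at a monomial through terms
whose degree is the length of the monomial. -/
theorem IsUniversalDerivation.exists_mono_lift (H : IsUniversalDerivation T D) (l : List V) (g : G) :
    ∃ y ∈ xDeg k G V 1 l.length, T y = D (mono l g) := by
  induction l with
  | nil =>
    exact ⟨xGen k (i := 1) (j := 0) rfl ![g] ![], xGen_mem_xDeg _ _ _,
      (H.map_grp g).symm.trans (congrArg D (mono_nil g).symm)⟩
  | cons v l ih =>
    obtain ⟨y, hy, e⟩ := ih
    have h1 := xAct_mem_xDeg (vec_mem_skewDeg v) one_mem_skewDeg hy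
    have h2 := xAct_xGen_mem (n := 1) (i := 0) (j := 1) (d := (v :: l).length) one_mem_skewDeg
      (mono_mem_skewDeg (k := k) l g) rfl ![] ![v] (by rw [List.length_cons]; omega)
    rw [show 1 + l.length + 0 = (v :: l).length by rw [List.length_cons]; omega] at h1
    exact ⟨_, add_mem h1 h2,
      (H.map_mul _ _ _ _ (H.map_vec v) e.symm).symm.trans (congrArg D (mono_cons v l g).symm)⟩

theorem IsUniversalDerivation.exists_lift (H : IsUniversalDerivation T D) (d : ℕ) (a : Skew k G V)
    (ha : a ∈ skewDeg k G V d) : ∃ y ∈ xDeg k G V 1 d, T y = D a := by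
  rw [skewDeg_eq_span] at ha
  refine (Submodule.span_le (p := ((xDeg k G V 1 d).map T).comap D)).2 ?_ ha
  rintro _ ⟨l, g, rfl, rfl⟩
  exact H.exists_mono_lift l g

/-- With T the quotient map and L induced by the differential, both sides are derivations A → X_0
with the same values on vectors and group elements. The right-hand side is the differential of the
bar resolution in lowest degree, so this yields the chain map property of ψ_1. -/
theorem IsUniversalDerivation.xD_zero (H : IsUniversalDerivation T D)
    (hT : Function.Surjective T) (L : Q →ₗ[k] X k G V 0)
    (hL : ∀ y, L (T y) = xD k G V 0 y) (a : Skew k G V) :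
    L (D a) = innerDerivation (xAct k G V 0) (xGen k (i := 0) (j := 0) rfl ![] ![]) a := by
  refine mem_of_grp_vec (LinearMap.eqLocus (L ∘ₗ D)
    (innerDerivation (xAct k G V 0) (xGen k (i := 0) (j := 0) rfl ![] ![])))
    (fun g => ?_) (fun v b hb => ?_) a
  · exact (congrArg L (H.map_grp g)).trans ((hL _).trans (xD_zero_one_zero g))
  · obtain ⟨y, hy⟩ := hT (D b)
    have e1 : xD k G V 0 y = innerDerivation (xAct k G V 0)
      (xGen k (i := 0) (j := 0) rfl ![] ![]) b := (hL y).symm.trans ((congrArg L hy).trans hb)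
    have e2 : xD k G V 0 (xGen k (i := 0) (j := 1) rfl ![] ![v]) = innerDerivation (xAct k G V 0)
      (xGen k (i := 0) (j := 0) rfl ![] ![]) (vec k G v) := xD_zero_zero_one v
    refine (congrArg L (H.map_mul _ _ _ _ (H.map_vec v) hy.symm)).trans ((hL _).trans ?_)
    refine (map_add_of_eq (xD k G V 0)
      ((xD_xAct 0 _ _ _).trans (congrArg (xAct k G V 0 (vec k G v) 1) e1))
      ((xD_xAct 0 _ _ _).trans (congrArg (xAct k G V 0 1 b) e2))).trans ?_
    exact (innerDerivation_mul _ freeAct_freeAct _ _ _).symm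

/-- In degree one φ sends generators to themselves, where D has the prescribed values; thus the
defect of f as a left inverse lies in the kernel of T. -/
theorem IsUniversalDerivation.phiGen_lift (H : IsUniversalDerivation T D)
    (f : (⨂[k]^1 (Skew k G V)) →ₗ[k] X k G V 1)
    (hf : T ∘ₗ f = ofLinear D) (m : XGenTot k G V 1) :
    T (f (phiGen k G V 1 m)) = T (freeIncl k (Skew k G V) m) := by
  suffices h : T ∘ₗ f ∘ₗ phiGen k G V 1 = T ∘ₗ freeIncl k (Skew k G V) from
    LinearMap.congr_fun h m
  refine gen_hom_ext fun i j hij g v => ?_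
  refine (LinearMap.congr_fun hf _).trans ?_
  rw [phiGen, genLift_gen]
  have hi : i ≤ 1 := by omega
  interval_cases i
  · obtain rfl : j = 1 := by omega
    obtain rfl := Subsingleton.elim ![] g
    obtain ⟨v, rfl⟩ : ∃ w, v = ![w] := ⟨v 0, by ext i; fin_cases i; rfl⟩
    exact (ofLinear_tprod D ![vec k G v]).trans (H.map_vec v)
  · obtain rfl : j = 0 := by omega
    obtain rfl := Subsingleton.elim ![] v
    obtain ⟨g, rfl⟩ : ∃ h, g = ![h] := ⟨g 0, by ext i; fin_cases i; rfl⟩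
    exact (ofLinear_tprod D ![grp k V g]).trans (H.map_grp g)

end Derivation

end

/-! ### Construction of ψ in degrees one and two, and existence of the chain maps -/

noncomputable section

theorem map_sub_add_eq_zero {k P Q : Type*} [Ring k] [AddCommGroup P] [Module k P] [AddCommGroup Q]
    [Module k Q] (f : P →ₗ[k] Q) {x y z : P} (h : f y = f (x + z)) : f (x - y + z) = 0 := by
  rw [map_add, map_sub, h, map_add]
  abel

variable {k G V : Type*} [Field k] [Group G] [AddCommGroup V] [Module k V]
  [DistribMulAction G V] [SMulCommClass G k V]

/-- ψ_1 is a homogeneous lift of D, corrected to be a left inverse of φ_1. The correction does not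
change T f, so the Leibniz rule for D persists modulo the kernel of T; this is what the construction
of ψ_2 requires. -/
theorem exists_psi_one_of_derivation {Q : Type*} [AddCommGroup Q] [Module k Q]
    {T : X k G V 1 →ₗ[k] Q} {D : Skew k G V →ₗ[k] Q} (H : IsUniversalDerivation T D)
    (hT : Function.Surjective T) (L : Q →ₗ[k] X k G V 0) (hL : ∀ y, L (T y) = xD k G V 0 y) :
    ∃ f : (⨂[k]^1 (Skew k G V)) →ₗ[k] X k G V 1,
      (∀ d, ∀ z ∈ tensorDeg k G V 1 d, f z ∈ xDeg k G V 1 d) ∧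
      biExtend (xAct k G V 1) f ∘ₗ phiMap k G V 1 = LinearMap.id ∧
      xD k G V 0 ∘ₗ biExtend (xAct k G V 1) f =
        biExtend (xAct k G V 0) (psiZero k G V) ∘ₗ barD k (Skew k G V) 0 ∧
      ∀ a b, T (xAct k G V 1 a 1 (f (PiTensorProduct.tprod k ![b])) -
        f (PiTensorProduct.tprod k ![a * b]) +
        xAct k G V 1 1 b (f (PiTensorProduct.tprod k ![a]))) = 0 := by
  obtain ⟨f, hf, hf'⟩ := exists_graded_lift 1 T (ofLinear D)
    (fun x c hx => by
      rw [ofLinear_tprod, Fin.sum_univ_one]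
      exact H.exists_lift _ _ (hx 0))
  obtain ⟨r, hr, hr'⟩ := exists_retraction_one k G V
  obtain ⟨f', h1, h2, h3⟩ := exists_left_inverse_correction T f hf' r hr hr'
    (H.phiGen_lift f hf)
  have hD (a) : T (f' (PiTensorProduct.tprod k ![a])) = D a :=
    (LinearMap.congr_fun (h1.trans hf) _).trans (ofLinear_tprod D ![a])
  refine ⟨f', h2, h3, psi_comm_of_barGen 0 _ _ fun x => ?_, fun a b => ?_⟩
  · obtain ⟨a, rfl⟩ : ∃ a, x = ![a] := ⟨x 0, eq_one_tuple x⟩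
    have h0 : biExtend (xAct k G V 0) (psiZero k G V) (barGen k ![]) =
        xGen k (i := 0) (j := 0) rfl ![] ![] :=
      (biExtend_freeIncl _ freeAct_one _ _).trans (psiZero_tprod _)
    have e1 := (hL (f' (PiTensorProduct.tprod k ![a]))).symm.trans ((congrArg L (hD a)).trans
      (H.xD_zero hT L hL a))
    refine e1.trans ((congrArg _ (barD_zero a)).trans (map_sub_of_eq (biExtend _ _)
      ((biExtend_freeAct _ freeAct_freeAct _ _ _ _).trans (congrArg (xAct k G V 0 a 1) h0))
      ((biExtend_freeAct _ freeAct_freeAct _ _ _ _).trans (congrArg (xAct k G V 0 1 a) h0)))).symm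
  · have e := H.map_mul a b _ _ (hD a).symm (hD b).symm
    exact map_sub_add_eq_zero T ((hD (a * b)).trans e)

variable (k G V) in
theorem exists_psi_one : ∃ f : (⨂[k]^1 (Skew k G V)) →ₗ[k] X k G V 1,
    (∀ d, ∀ z ∈ tensorDeg k G V 1 d, f z ∈ xDeg k G V 1 d) ∧
    biExtend (xAct k G V 1) f ∘ₗ phiMap k G V 1 = LinearMap.id ∧
    xD k G V 0 ∘ₗ biExtend (xAct k G V 1) f =
      biExtend (xAct k G V 0) (psiZero k G V) ∘ₗ barD k (Skew k G V) 0 ∧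
    ∀ a b, xAct k G V 1 a 1 (f (PiTensorProduct.tprod k ![b])) -
      f (PiTensorProduct.tprod k ![a * b]) +
      xAct k G V 1 1 b (f (PiTensorProduct.tprod k ![a])) ∈ LinearMap.range (xD k G V 1) := by
  obtain ⟨D, hv, hg, hm⟩ := exists_x_derivation k G V
  have h0 : LinearMap.range (xD k G V 1) ≤ LinearMap.ker (xD k G V 0) := by
    rintro _ ⟨y, rfl⟩
    exact xD_xD_zero y
  obtain ⟨f, h1, h2, h3, h4⟩ := exists_psi_one_of_derivation
    (T := (LinearMap.range (xD k G V 1)).mkQ) ⟨hv, hg, hm⟩ (Submodule.mkQ_surjective _)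
    ((LinearMap.range (xD k G V 1)).liftQ (xD k G V 0) h0) (fun y => rfl)
  exact ⟨f, h1, h2, h3, fun a b => (Submodule.Quotient.mk_eq_zero _).1 (h4 a b)⟩

/-- The last hypothesis says that ψ_1 maps the bar boundary of every a ⊗ b to a boundary of X, so a
lift through d exists without knowing that X is exact. It can be chosen homogeneous because d
preserves degrees. -/
theorem exists_psi_two (f : (⨂[k]^1 (Skew k G V)) →ₗ[k] X k G V 1)
    (hf : ∀ d, ∀ z ∈ tensorDeg k G V 1 d, f z ∈ xDeg k G V 1 d)
    (hf' : biExtend (xAct k G V 1) f ∘ₗ phiMap k G V 1 = LinearMap.id)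
    (hr : ∀ a b, xAct k G V 1 a 1 (f (PiTensorProduct.tprod k ![b])) -
      f (PiTensorProduct.tprod k ![a * b]) +
      xAct k G V 1 1 b (f (PiTensorProduct.tprod k ![a])) ∈ LinearMap.range (xD k G V 1)) :
    ∃ f' : (⨂[k]^2 (Skew k G V)) →ₗ[k] X k G V 2,
      (∀ d, ∀ z ∈ tensorDeg k G V 2 d, f' z ∈ xDeg k G V 2 d) ∧
      biExtend (xAct k G V 2) f' ∘ₗ phiMap k G V 2 = LinearMap.id ∧
      xD k G V 1 ∘ₗ biExtend (xAct k G V 2) f' =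
        biExtend (xAct k G V 1) f ∘ₗ barD k (Skew k G V) 1 := by
  have hact (a b c : Skew k G V) : biExtend (xAct k G V 1) f (freeAct k _ _ a b (barGen k ![c])) =
      xAct k G V 1 a b (f (PiTensorProduct.tprod k ![c])) :=
    (biExtend_freeAct _ freeAct_freeAct f a b _).trans
      (congrArg (xAct k G V 1 a b) (biExtend_freeIncl _ freeAct_one f _))
  have hbar (a b : Skew k G V) : biExtend (xAct k G V 1) f (barD k _ 1 (barGen k ![a, b])) =
      xAct k G V 1 a 1 (f (PiTensorProduct.tprod k ![b])) -
      f (PiTensorProduct.tprod k ![a * b]) +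
      xAct k G V 1 1 b (f (PiTensorProduct.tprod k ![a])) :=
    (congrArg _ (barD_one a b)).trans (map_add_of_eq (biExtend (xAct k G V 1) f)
      (map_sub_of_eq (biExtend (xAct k G V 1) f) (hact _ _ _) (biExtend_freeIncl _ freeAct_one f _))
      (hact _ _ _))
  have hone {d : ℕ} {a : Skew k G V} (ha : a ∈ skewDeg k G V d) :
      f (PiTensorProduct.tprod k ![a]) ∈ xDeg k G V 1 d :=
    hf d _ (tprod_mem_tensorDeg ![d] (by intro i; fin_cases i; exact ha) (by simp))
  obtain ⟨F, hF, hF'⟩ := exists_graded_lift 2 (xD k G V 1)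
    (biExtend (xAct k G V 1) f ∘ₗ barD k (Skew k G V) 1 ∘ₗ freeIncl k (Skew k G V))
    (fun x c hx => by
      have e : biExtend (xAct k G V 1) f (barD k _ 1 (barGen k x)) = _ :=
        (congrArg (fun y => biExtend (xAct k G V 1) f (barD k _ 1 (barGen k y)))
          (eq_two_tuple x)).trans (hbar (x 0) (x 1))
      refine exists_homogeneous_preimage (xD k G V 1) xD_one_mem (z := biExtend (xAct k G V 1) f
        (barD k _ 1 (barGen k x))) ?_ ?_
      · rw [e, Fin.sum_univ_two]
        have h1 := xAct_mem_xDeg (hx 0) one_mem_skewDeg (hone (hx 1))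
        have h2 := xAct_mem_xDeg one_mem_skewDeg (hx 1) (hone (hx 0))
        rw [add_zero] at h1
        rw [zero_add] at h2
        exact add_mem (sub_mem h1 (hone (mul_mem_skewDeg (hx 0) (hx 1)))) h2
      · rw [e]
        exact hr _ _)
  obtain ⟨r, hr, hr'⟩ := exists_retraction_two k G V
  obtain ⟨f', h1, h2, h3⟩ := exists_left_inverse_correction (xD k G V 1) F hF' r hr hr'
    -- The defect is killed by d, because dψ_2φ_2 = ψ_1∂φ_2 = ψ_1φ_1 d = d, by ψ_1φ_1 = id.
    (fun m => by
      have e1 := LinearMap.congr_fun hF (phiGen k G V 2 m)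
      have e2 := congrArg (fun y => biExtend (xAct k G V 1) f (barD k (Skew k G V) 1 y))
        (freeIncl_phiGen 2 m).symm
      have e3 := congrArg (biExtend (xAct k G V 1) f)
        (LinearMap.congr_fun phiMap_comm_one (freeIncl k (Skew k G V) m))
      have e4 := LinearMap.congr_fun hf' (xD k G V 1 (freeIncl k (Skew k G V) m))
      exact e1.trans (e2.trans (e3.trans e4)))
  exact ⟨f', h2, h3, psi_comm_of_barGen 1 f f' fun x => LinearMap.congr_fun (h1.trans hF) _⟩

/-- A sequence of maps `A^{⊗n} → X_n`, from its terms for `n ≤ 2`. -/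
def psiFamily (f₀ : (⨂[k]^0 (Skew k G V)) →ₗ[k] X k G V 0)
    (f₁ : (⨂[k]^1 (Skew k G V)) →ₗ[k] X k G V 1) (f₂ : (⨂[k]^2 (Skew k G V)) →ₗ[k] X k G V 2) :
    (n : ℕ) → (⨂[k]^n (Skew k G V)) →ₗ[k] X k G V n
  | 0 => f₀
  | 1 => f₁
  | 2 => f₂
  | _ + 3 => 0

variable (k G V) in
-- The explicit φ is combined with the ψ just constructed. Above homological degree 2, ψ is set to
-- zero, since nothing but linearity over A and the grading is required of it there.
theorem nonempty_chainMaps : Nonempty (ChainMaps k G V) := by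
  obtain ⟨f₁, h1, h1', h1'', h1'''⟩ := exists_psi_one k G V
  obtain ⟨f₂, h2, h2', h2''⟩ := exists_psi_two f₁ h1 h1' h1'''
  have hF (n d) (z : ⨂[k]^n (Skew k G V)) (hz : z ∈ tensorDeg k G V n d) :
      psiFamily (psiZero k G V) f₁ f₂ n z ∈ xDeg k G V n d :=
    match n with
    | 0 => psiZero_mem d z hz
    | 1 => h1 d z hz
    | 2 => h2 d z hz
    | _ + 3 => zero_mem _
  exact ⟨{
    phi := phiMap k G V
    psi := fun n => biExtend (xAct k G V n) (psiFamily (psiZero k G V) f₁ f₂ n)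
    phi_act := phiMap_xAct
    psi_act := fun n a b x => biExtend_freeAct _ freeAct_freeAct _ a b x
    phi_deg := phiMap_mem_barDeg
    psi_deg := fun n d x hx => biExtend_mem_xDeg _ (hF n) hx
    phi_comm := fun n hn => match n with
      | 0 => phiMap_comm_zero
      | 1 => phiMap_comm_one
      | 2 => phiMap_comm_two
    psi_comm := fun n hn => match n with
      | 0 => h1''
      | 1 => h2''
    psi_phi := fun n hn => match n with
      | 0 => psiZero_phiMap
      | 1 => h1'
      | 2 => h2'
    phi_00 := phiMap_zero
    phi_10 := phiMap_one_zero
    phi_01 := phiMap_zero_one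
    phi_20 := phiMap_two_zero
    phi_11 := phiMap_one_one
    phi_02 := phiMap_zero_two
    phi_30 := phiMap_three_zero
    phi_21 := phiMap_two_one
    phi_12 := phiMap_one_two
    phi_03 := phiMap_zero_three }⟩

end

end SkewHecke

theorem mainTheorem3 {k G V : Type*} [Field k] [Group G] [Finite G] [AddCommGroup V] [Module k V]
    [Module.Finite k V] [DistribMulAction G V] [SMulCommClass G k V]
    (lam : MonoidAlgebra k G →ₗ[k] V →ₗ[k] MonoidAlgebra k G)
    (kap : V [⋀^Fin 2]→ₗ[k] MonoidAlgebra k G) :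
    Nonempty (SkewHecke.ChainMaps k G V) ∧
    ∀ C : SkewHecke.ChainMaps k G V,
      (SkewHecke.HasPBW lam kap ↔
        SkewHecke.dStar (SkewHecke.lamCochain lam) = 0 ∧
        C.halfSquare (SkewHecke.lamCochain lam) = SkewHecke.dStar (SkewHecke.kapCochain kap) ∧
        C.bracket (SkewHecke.lamCochain lam) (SkewHecke.kapCochain kap) = 0) ∧
      ((2 : k) ≠ 0 →
        (SkewHecke.HasPBW lam kap ↔
          SkewHecke.dStar (SkewHecke.lamCochain lam) = 0 ∧
          C.bracket (SkewHecke.lamCochain lam) (SkewHecke.lamCochain lam) =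
            (2 : k) • SkewHecke.dStar (SkewHecke.kapCochain kap) ∧
          C.bracket (SkewHecke.lamCochain lam) (SkewHecke.kapCochain kap) = 0)) := by
  exact ⟨SkewHecke.nonempty_chainMaps k G V, fun C =>
    ⟨SkewHecke.hasPBW_iff_compatible.trans (C.compatible_iff lam kap), fun h2 =>
      SkewHecke.hasPBW_iff_compatible.trans (C.compatible_iff_of_two_ne_zero lam kap h2)⟩⟩
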